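/- Let $\phi_{\mathbf y}(\mathbf x)=e^{-\epsilon^2\|\mathbf x-\mathbf y\|^2}$ ($\epsilon>0$) be the Gaussian on $\mathbb R^2$ centred at $\mathbf y$, and let $\Delta_{\mathbf y}\phi$ be its Laplacian with respect to the centre. For $\mathbf x=(x_0,y_0)$ and $h>0$ write $u_{i,j}=u(x_0+ih,y_0+jh)$; let $E=\{(\pm1,0),(0,\pm1)\}$, $K=\{(\pm1,\pm1)\}$, $D=\{(\pm2,0),(0,\pm2)\}$, and call the grid point $(x_0+ih,y_0+jh)$ the node $(i,j)$. **Order 4.** The 9-point Gaussian RBF-HFD formula is $$L_4u=\alpha_0u_{0,0}+\alpha_1\sum_{E}u_{i,j}+\alpha_2\sum_{K}u_{i,j}+\beta_1\sum_{E}(\Delta u)_{i,j},$$ where, for some $\gamma\in\mathbb R$, the weights satisfy $L_4\phi_{\mathbf y}+\gamma=\Delta\phi_{\mathbf y}(\mathbf x)$ for all nine nodes $\mathbf y$, $L_4(\Delta_{\mathbf y}\phi)=\Delta(\Delta_{\mathbf y}\phi)(\mathbf x)$ for the four nodes $\mathbf y$ in $E$, and $L_41=0$. There is $\delta>0$ such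 that for all $\epsilon,h>0$ with $\epsilon h<\delta$ the weights exist, are unique and do not depend on $\mathbf x$, and, uniformly in such $\epsilon,h$, $$\alpha_0=-\tfrac5{h^2}-\tfrac{19\epsilon^2}{24}+\tfrac{4069\epsilon^4h^2}{1440}+\tfrac{9791\epsilon^6h^4}{8640}+O(\epsilon^8h^6),$$ $$\alpha_1=\tfrac1{h^2}-\tfrac{13\epsilon^2}{24}-\tfrac{2273\epsilon^4h^2}{1440}-\tfrac{4459\epsilon^6h^4}{8640}+O(\epsilon^8h^6),$$ $$\alpha_2=\tfrac1{4h^2}+\tfrac{71\epsilon^2}{96}+\tfrac{5023\epsilon^4h^2}{5760}+\tfrac{1609\epsilon^6h^4}{6912}+O(\epsilon^8h^6),$$ $$\beta_1=-\tfrac18-\tfrac{15\epsilon^2h^2}{64}-\tfrac{213\epsilon^4h^4}{1280}+\tfrac{373\epsilon^6h^6}{7680}+O(\epsilon^8h^8).$$ In particular, for fixed $h$ and $\epsilon\to0^+$, $(\alpha_0,\alpha_1,\alpha_2,\beta_1)\to(-\frac5{h^2},\frac1{h^2},\frac1{4h^2},-\frac18)$. If $u$ is $C^8$ near $\mathbf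 x$, then the local truncation error $\tau_0=L_4u-\Delta u(\mathbf x)$ satisfies $$\tau_0=\tfrac{h^4}{480}\bigl(-240\epsilon^4(u^{(2,0)}+u^{(0,2)})-75\epsilon^2(u^{(4,0)}+u^{(0,4)})-3(u^{(6,0)}+u^{(0,6)})+5(u^{(2,4)}+u^{(4,2)})+130\epsilon^2u^{(2,2)}\bigr)(\mathbf x)+O(h^6P_3(\epsilon^2)).$$ **Order 6.** The 13-point Gaussian RBF-HFD formula is $$L_6u=\alpha_0u_{0,0}+\alpha_1\sum_{E\cup K}u_{i,j}+\alpha_2\sum_{D}u_{i,j}+\beta_1\sum_{E}(\Delta u)_{i,j}+\beta_2\sum_{K}(\Delta u)_{i,j},$$ where, for some $\gamma\in\mathbb R$, the weights satisfy one equation per unknown up to symmetry: $L_6\phi_{\mathbf y}+\gamma=\Delta\phi_{\mathbf y}(\mathbf x)$ for the nodes $\mathbf y$ in $\{(0,0)\}\cup E\cup D$, $L_6(\Delta_{\mathbf y}\phi)=\Delta(\Delta_{\mathbf y}\phi)(\mathbf x)$ for the nodes $\mathbf y$ in $E\cup K$, and $L_61=0$. There is $\delta>0$ such that for all $\epsilon,h>0$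 with $\epsilon h<\delta$ the weights exist, are unique and do not depend on $\mathbf x$, and, uniformly in such $\epsilon,h$, $$\alpha_0=-\tfrac{105}{23h^2}+\tfrac{61761\epsilon^2}{83582}-\tfrac{2668325501\epsilon^4h^2}{1518684940}-\tfrac{2725280260345847\epsilon^6h^4}{289742306277900}+O(\epsilon^8h^6),$$ $$\alpha_1=\tfrac{12}{23h^2}-\tfrac{17646\epsilon^2}{208955}+\tfrac{3697010966\epsilon^4h^2}{13288493225}+\tfrac{1329393861667\epsilon^6h^4}{724355765694750}+O(\epsilon^8h^6),$$ $$\alpha_2=\tfrac{9}{92h^2}-\tfrac{26469\epsilon^2}{1671640}-\tfrac{24912958377\epsilon^4h^2}{212615891600}+\tfrac{4535043666647521\epsilon^6h^4}{1931615375186000}+O(\epsilon^8h^6),$$ $$\beta_1=-\tfrac5{23}+\tfrac{97053\epsilon^2h^2}{835820}+\tfrac{19096725789\epsilon^4h^4}{106307945800}-\tfrac{2108622124065179\epsilon^6h^6}{724355765694750}+O(\epsilon^8h^8),$$ $$\beta_2=-\tfrac1{46}-\tfrac{61761\epsilon^2h^2}{1671640}-\tfrac{8234946399\epsilon^4h^4}{30373698800}-\tfrac{828029839457483\epsilon^6h^6}{5794846125558000}+O(\epsilon^8h^8).$$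 In particular, for fixed $h$ and $\epsilon\to0^+$, $(\alpha_0,\alpha_1,\alpha_2,\beta_1,\beta_2)\to(-\frac{105}{23h^2},\frac{12}{23h^2},\frac9{92h^2},-\frac5{23},-\frac1{46})$. If $u$ is $C^{10}$ near $\mathbf x$, then $\tau_0=L_6u-\Delta u(\mathbf x)$ satisfies $$\tau_0=\tfrac{h^6}{3052560}\bigl(-8605128\epsilon^6(u^{(2,0)}+u^{(0,2)})-1371468\epsilon^4(u^{(4,0)}+u^{(0,4)})+1817(u^{(8,0)}+u^{(0,8)})-123522\epsilon^2(u^{(2,4)}+u^{(4,2)})-3318(u^{(2,6)}+u^{(6,2)})-1364496\epsilon^4u^{(2,2)}\bigr)(\mathbf x)+O(h^8P_4(\epsilon^2)).$$ Here $O(h^mP_k(\epsilon^2))$ is a term bounded in absolute value by $h^mP_k(\epsilon^2)$ for all $\epsilon>0$ and all sufficiently small $h>0$ with $\epsilon h<\delta$, where $P_k$ is a real polynomial of degree at most $k$ that depends only on $u$ and $\mathbf x$. -/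

import Mathlib

open Filter Topology

noncomputable section

namespace RBFHFD

/-- The plane with its Euclidean norm. -/
abbrev Plane : Type := EuclideanSpace ℝ (Fin 2)

/-- The node `x₀ + h (i, j)` of the uniform grid with step size `h` around `x₀`. -/
def node (x₀ : Plane) (h : ℝ) (p : ℤ × ℤ) : Plane :=
  x₀ + h • !₂[(p.1 : ℝ), (p.2 : ℝ)]

/-- The four nearest neighbours of the reference node. -/
def edges : Finset (ℤ × ℤ) := {(1, 0), (0, 1), (-1, 0), (0, -1)}

/-- The four diagonal neighbours of the reference node. -/
def corners : Finset (ℤ × ℤ) := {(1, 1), (-1, 1), (-1, -1), (1, -1)}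

/-- The four nodes at distance `2h` on the axes. -/
def far : Finset (ℤ × ℤ) := {(2, 0), (0, 2), (-2, 0), (0, -2)}

/-- The Laplacian (Mathlib's) of a real function on the plane. -/
def lap (u : Plane → ℝ) : Plane → ℝ := Laplacian.laplacian u

/-- The Gaussian radial function `φ(x, y) = exp (-ε² ‖x - y‖²)` with shape parameter `ε`. -/
def gauss (ε : ℝ) (x y : Plane) : ℝ := Real.exp (-(ε ^ 2 * ‖x - y‖ ^ 2))

/-- The function `φ_y` of `x` centred at `y`. -/
def basisFun (ε : ℝ) (y : Plane) : Plane → ℝ := fun x => gauss ε x y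

/-- The Laplacian of the Gaussian with respect to its second argument (the centre), at `y`,
as a function of the first argument `x`. -/
def lapBasisFun (ε : ℝ) (y : Plane) : Plane → ℝ := fun x => lap (fun y' => gauss ε x y') y

/-- The partial derivative in the `i`-th coordinate direction. -/
def pderiv (i : Fin 2) (u : Plane → ℝ) : Plane → ℝ :=
  fun x => fderiv ℝ u x (EuclideanSpace.single i 1)

/-- The mixed partial derivative `u^(m,n) = ∂₁^m ∂₂^n u`. -/
def mixed (m n : ℕ) (u : Plane → ℝ) : Plane → ℝ := (pderiv 0)^[m] ((pderiv 1)^[n] u)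

/-! ### The nine-point formula of order four -/

/-- The weights of the symmetric nine-point formula. -/
@[ext] structure Weights4 where
  α₀ : ℝ
  α₁ : ℝ
  α₂ : ℝ
  β₁ : ℝ

/-- The nine-point formula applied to `u` at `x₀`. -/
def Weights4.apply (w : Weights4) (h : ℝ) (x₀ : Plane) (u : Plane → ℝ) : ℝ :=
  w.α₀ * u x₀ + w.α₁ * ∑ p ∈ edges, u (node x₀ h p) + w.α₂ * ∑ p ∈ corners, u (node x₀ h p)
    + w.β₁ * ∑ p ∈ edges, lap u (node x₀ h p)

/-- The local truncation error of the nine-point formula at `x₀`. -/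
def Weights4.lte (w : Weights4) (h : ℝ) (x₀ : Plane) (u : Plane → ℝ) : ℝ :=
  w.apply h x₀ u - lap u x₀

/-- The linear system (with a constant appended and multiplier `γ`) for the weights of the
Gaussian nine-point formula: collocation on the Gaussians centred at all nine nodes, on the
Laplacians of the Gaussians centred at the four nearest neighbours, and on the constants. The
entry of `γ` is the value of the constant `1` in the rows of the former, and its Laplacian `0`
in the rows of the latter. -/
def Weights4.IsGaussian (w : Weights4) (ε h : ℝ) (x₀ : Plane) : Prop :=
  (∃ γ : ℝ,
    (∀ p ∈ {((0 : ℤ), (0 : ℤ))} ∪ edges ∪ corners,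
      w.apply h x₀ (basisFun ε (node x₀ h p)) + γ = lap (basisFun ε (node x₀ h p)) x₀) ∧
    (∀ p ∈ edges,
      w.apply h x₀ (lapBasisFun ε (node x₀ h p)) = lap (lapBasisFun ε (node x₀ h p)) x₀)) ∧
  w.apply h x₀ (fun _ => 1) = 0

/-! ### The thirteen-point formula of order six -/

/-- The weights of the symmetric thirteen-point formula; the eight neighbours share `α₁`. -/
@[ext] structure Weights6 where
  α₀ : ℝ
  α₁ : ℝ
  α₂ : ℝ
  β₁ : ℝ
  β₂ : ℝ

/-- The thirteen-point formula applied to `u` at `x₀`. -/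
def Weights6.apply (w : Weights6) (h : ℝ) (x₀ : Plane) (u : Plane → ℝ) : ℝ :=
  w.α₀ * u x₀ + w.α₁ * ∑ p ∈ edges ∪ corners, u (node x₀ h p)
    + w.α₂ * ∑ p ∈ far, u (node x₀ h p)
    + w.β₁ * ∑ p ∈ edges, lap u (node x₀ h p) + w.β₂ * ∑ p ∈ corners, lap u (node x₀ h p)

/-- The local truncation error of the thirteen-point formula at `x₀`. -/
def Weights6.lte (w : Weights6) (h : ℝ) (x₀ : Plane) (u : Plane → ℝ) : ℝ :=
  w.apply h x₀ u - lap u x₀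

/-- The linear system (with a constant appended and multiplier `γ`) for the weights of the
Gaussian thirteen-point formula. As `α₁` is shared by the nearest and the diagonal neighbours,
there is one equation for each unknown up to symmetry: collocation on the Gaussians centred at
the reference node (for `α₀`), at the nearest neighbours (for `α₁`) and at the nodes at distance
`2h` (for `α₂`), on the Laplacians of the Gaussians centred at the nearest neighbours (for `β₁`)
and at the diagonal neighbours (for `β₂`), and on the constants (for `γ`). -/
def Weights6.IsGaussian (w : Weights6) (ε h : ℝ) (x₀ : Plane) : Prop :=
  (∃ γ : ℝ,
    (∀ p ∈ {((0 : ℤ), (0 : ℤ))} ∪ edges ∪ far,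
      w.apply h x₀ (basisFun ε (node x₀ h p)) + γ = lap (basisFun ε (node x₀ h p)) x₀) ∧
    (∀ p ∈ edges ∪ corners,
      w.apply h x₀ (lapBasisFun ε (node x₀ h p)) = lap (lapBasisFun ε (node x₀ h p)) x₀)) ∧
  w.apply h x₀ (fun _ => 1) = 0

end RBFHFD

end

/-! Symmetry and scaling reduce each formula to a small linear system in the single parameter s =
ε²h². The condition on constants eliminates α₀, and subtracting the collocation equation at the
reference node eliminates γ. By the symmetry of the square, the equations at all nodes of one orbit
coincide. Multiplying the α's by h² then leaves M(s) v = r(s), with three or four unknowns. This is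
why the weights do not depend on the reference node and why their expansions, up to powers of h, are
series in s.

The obstacle is that M(s) degenerates at s = 0, where all Gaussians become constant. Explicit row
operations P(s), polynomial in s and of constant nonzero determinant, give P(s) M(s) = D(s) (A + s
G(s)), where D(s) is diagonal with entries s^(m i), A is a constant invertible matrix and G is
continuous. For small s > 0 the system is therefore uniquely solvable. If T(s) is the vector of
claimed cubic polynomials, row i of P (M T - r) is divisible by s^(m i + 4). Cancelling D(s) shows
that the solution is T + s⁴ V with V bounded near 0. This is `exists_solution_of_row_reduction`;
existence, uniqueness, uniform expansions and flat limits all follow from it. The divisibilities are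
polynomial identities: each exponential is its Taylor polynomial plus s^n times a continuous
remainder, and that remainder is carried along exactly.

For the truncation error, u and Δu are Taylor expanded at the nodes (`taylor_sum_nodes`) and the
weights are inserted. Odd derivatives cancel by symmetry. A derivative of order 2m ≥ 2 comes with
h^(2m-2) times a cubic in s plus s⁴ times a bounded function, that is, with products h^(2m-2+2j)
ε^(2j). All products of low degree in h cancel against Δu(x), those in h⁴ (respectively h⁶) form the
stated principal part, and the rest is h⁶ (respectively h⁸) times a polynomial in ε² with bounded
coefficients. -/

noncomputable section

namespace RBFHFD

/-! ### Exact Taylor remainders of the exponential; linear systems that degenerate at s = 0 -/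

/-- The exponential function is its Taylor polynomial plus a power times a continuous function. -/
theorem exists_continuous_exp_remainder (n : ℕ) :
    ∃ R : ℝ → ℝ, Continuous R ∧
      ∀ x, Real.exp x = ∑ i ∈ Finset.range n, x ^ i / (i.factorial : ℝ) + x ^ n * R x := by
  set p : ℝ → ℝ := fun x => ∑ i ∈ Finset.range n, x ^ i / (i.factorial : ℝ) with hp
  have hpc : Continuous p := by fun_prop
  -- The value at 0 is the next Taylor coefficient, the only one that makes the quotient continuous
  -- there.
  refine ⟨fun x => if x = 0 then 1 / (n.factorial : ℝ) else (Real.exp x - p x) / x ^ n, ?_, ?_⟩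
  · rw [continuous_iff_continuousAt]
    intro x
    rcases eq_or_ne x 0 with rfl | hx
    · have hb : ∀ᶠ x : ℝ in 𝓝 0,
          |(if x = 0 then 1 / (n.factorial : ℝ) else (Real.exp x - p x) / x ^ n)
            - 1 / (n.factorial : ℝ)| ≤
          |x| * ((n + 1).succ / ((n + 1).factorial * (n + 1 : ℕ))) := by
        have : ∀ᶠ x : ℝ in 𝓝 0, |x| < 1 :=
          (continuous_abs.tendsto (0 : ℝ)).eventually (gt_mem_nhds (by simp))
        filter_upwards [this] with x hx
        by_cases h0 : x = 0
        · simp [h0]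
        -- One term more than in `p`: its last summand x^n / n! becomes the constant 1 / n! after
        -- division by x^n, and the bound then leaves O(|x|).
        · have h := Real.exp_bound hx.le (n := n + 1) (Nat.succ_pos _)
          rw [Finset.sum_range_succ] at h
          have hxn : 0 < |x| ^ n := by positivity
          rw [if_neg h0, ← mul_le_mul_iff_right₀ hxn]
          have e : |x| ^ n * |(Real.exp x - p x) / x ^ n - 1 / (n.factorial : ℝ)|
              = |Real.exp x - (p x + x ^ n / (n.factorial : ℝ))| := by
            rw [← abs_pow, ← abs_mul]
            congr 1
            field_simp
            ring
          rw [e]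
          calc _ ≤ _ := h
            _ = _ := by ring
      rw [ContinuousAt, if_pos rfl, tendsto_iff_norm_sub_tendsto_zero]
      refine squeeze_zero' (Eventually.of_forall fun _ => norm_nonneg _) hb ?_
      have : Continuous fun x : ℝ =>
          |x| * (((n + 1).succ : ℝ) / ((n + 1).factorial * (n + 1 : ℕ))) := by
        fun_prop
      simpa using this.tendsto 0
    · have : ContinuousAt (fun x => (Real.exp x - p x) / x ^ n) x :=
        ContinuousAt.div (by fun_prop) (by fun_prop) (pow_ne_zero _ hx)
      refine this.congr ?_
      filter_upwards [isOpen_ne.mem_nhds hx] with y hy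
      rw [if_neg hy]
  · intro x
    by_cases h0 : x = 0
    · subst h0
      rcases n with _ | n
      · simp
      · simp [Finset.sum_range_succ']
    · simp only [if_neg h0]
      field_simp
      simp [hp]

/-- Expansion of `s ↦ exp (-(k s))` at `0`. -/
theorem exists_continuous_exp_neg_remainder (n : ℕ) (k : ℝ) :
    ∃ R : ℝ → ℝ, Continuous R ∧ ∀ s, Real.exp (-(k * s)) =
      ∑ i ∈ Finset.range n, (-k) ^ i / (i.factorial : ℝ) * s ^ i + s ^ n * R s := by
  obtain ⟨R, hR, h⟩ := exists_continuous_exp_remainder n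
  refine ⟨fun s => (-k) ^ n * R (-k * s), by fun_prop, fun s => ?_⟩
  rw [← neg_mul, h]
  congr 1
  · refine Finset.sum_congr rfl fun i _ => ?_
    rw [mul_pow]
    ring
  · rw [mul_pow]
    ring

/-- A linear system that degenerates at `s = 0` but becomes regular there after the row
operations `P s` and division of the rows by powers of `s` has, for small `s > 0`, a unique
solution, which agrees with `T s` up to order `k` when the transformed residual of `T` does. -/
theorem exists_solution_of_row_reduction {n k : ℕ} (m : Fin n → ℕ)
    (M P : ℝ → Matrix (Fin n) (Fin n) ℝ) (A : Matrix (Fin n) (Fin n) ℝ) (r T : ℝ → Fin n → ℝ)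
    (hA : A.det ≠ 0)
    (hM : ∀ i j, ∃ g : ℝ → ℝ, Continuous g ∧
      ∀ s, (P s * M s) i j = s ^ m i * (A i j + s * g s))
    (hr : ∀ i, ∃ g : ℝ → ℝ, Continuous g ∧
      ∀ s, (P s).mulVec ((M s).mulVec (T s) - r s) i = s ^ (m i + k) * g s) :
    ∃ s₀ > 0, ∃ V : ℝ → Fin n → ℝ, ∃ C : ℝ, ∀ s, 0 < s → s < s₀ →
      (∀ i, |V s i| ≤ C) ∧
      ∀ v, (M s).mulVec v = r s ↔ v = T s + s ^ k • V s := by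
  choose g hg hM using hM
  choose η hη hr using hr
  set G : ℝ → Matrix (Fin n) (Fin n) ℝ := fun s => Matrix.of fun i j => g i j s with hGdef
  set H : ℝ → Fin n → ℝ := fun s i => η i s with hHdef
  have hG : Continuous G := continuous_matrix hg
  have hH : Continuous H := continuous_pi hη
  set N : ℝ → Matrix (Fin n) (Fin n) ℝ := fun s => A + s • G s with hN
  have hNc : Continuous N := by fun_prop
  have hdet : Continuous fun s => (N s).det := hNc.matrix_det
  have h0 : (N 0).det ≠ 0 := by simpa [hN] using hA
  -- Cramer's rule for N V = -H. Written with the adjugate, V is visibly continuous at 0, hence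
  -- bounded nearby.
  set V : ℝ → Fin n → ℝ := fun s => -(((N s).det)⁻¹ • (N s).adjugate.mulVec (H s)) with hV
  have hVc : ContinuousAt V 0 := by
    refine ((hdet.continuousAt.inv₀ h0).smul ?_).neg
    exact ((hNc.matrix_adjugate).matrix_mulVec hH).continuousAt
  have hev : ∀ᶠ s in 𝓝 (0 : ℝ), (N s).det ≠ 0 ∧ ‖V s‖ < ‖V 0‖ + 1 :=
    (hdet.continuousAt.eventually_ne h0).and
      (hVc.norm.eventually (gt_mem_nhds (by linarith)))
  obtain ⟨s₀, hs₀, hs⟩ := Metric.eventually_nhds_iff.1 hev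
  refine ⟨s₀, hs₀, V, ‖V 0‖ + 1, fun s hs0 hs1 => ?_⟩
  obtain ⟨hd, hb⟩ := hs (y := s) (by simpa [abs_of_pos hs0] using hs1)
  refine ⟨fun i => (norm_le_pi_norm (V s) i).trans hb.le, ?_⟩
  have hPM : P s * M s = Matrix.diagonal (fun i => s ^ m i) * N s := by
    ext i j
    rw [hM, Matrix.diagonal_mul]
    simp [hN, hGdef]
  have hdiag : (Matrix.diagonal fun i => s ^ m i).det ≠ 0 := by
    rw [Matrix.det_diagonal]
    exact Finset.prod_ne_zero_iff.2 fun i _ => pow_ne_zero _ hs0.ne'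
  -- Invertibility of both `P s` and `M s` is read off from their product, so nothing about `P s`
  -- has to be assumed.
  have hPMd : (P s).det * (M s).det ≠ 0 := by
    rw [← Matrix.det_mul, hPM, Matrix.det_mul]
    exact mul_ne_zero hdiag hd
  have hPd := left_ne_zero_of_mul hPMd
  have hinj : ∀ B : Matrix (Fin n) (Fin n) ℝ, B.det ≠ 0 → Function.Injective B.mulVec :=
    fun B hB => Matrix.mulVec_injective_of_isUnit
      ((Matrix.isUnit_iff_isUnit_det _).2 (isUnit_iff_ne_zero.2 hB))
  have hNV : (N s).mulVec (V s) = -H s := by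
    rw [hV]
    simp only
    rw [Matrix.mulVec_neg, Matrix.mulVec_smul, Matrix.mulVec_mulVec, Matrix.mul_adjugate,
      Matrix.smul_mulVec, Matrix.one_mulVec, smul_smul, inv_mul_cancel₀ hd, one_smul]
  -- As P(s) is injective, the system may be checked after row reduction, where s^k V contributes
  -- the negative of the residual of T.
  have hsol : (M s).mulVec (T s + s ^ k • V s) = r s := by
    apply hinj _ hPd
    have h1 : (P s).mulVec ((M s).mulVec (T s)) - (P s).mulVec (r s)
        = fun i => s ^ (m i + k) * H s i := by
      rw [← Matrix.mulVec_sub]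
      exact funext fun i => hr i s
    have h2 : (P s).mulVec ((M s).mulVec (s ^ k • V s))
        = fun i => -(s ^ (m i + k) * H s i) := by
      rw [Matrix.mulVec_mulVec, hPM, Matrix.mulVec_smul, ← Matrix.mulVec_mulVec, hNV]
      ext i
      simp [Matrix.mulVec_diagonal]
      ring
    rw [Matrix.mulVec_add, Matrix.mulVec_add, h2]
    ext i
    have := congrFun h1 i
    simp only [Pi.sub_apply, Pi.add_apply] at this ⊢
    linarith
  intro v
  refine ⟨fun h => hinj _ (right_ne_zero_of_mul hPMd) (h.trans hsol.symm), ?_⟩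
  rintro rfl
  exact hsol

/-! ### Partial derivatives and the Laplacian -/

/-- A derivative depends only on the germ of the function. Identities between derivatives are
therefore kept as equalities near the point: equality at the point alone could not be differentiated
again. -/
theorem pderiv_eventuallyEq {f g : Plane → ℝ} {x : Plane} (i : Fin 2) (h : f =ᶠ[𝓝 x] g) :
    pderiv i f =ᶠ[𝓝 x] pderiv i g := by
  filter_upwards [h.fderiv (𝕜 := ℝ)] with y hy
  rw [pderiv, pderiv, hy]

theorem iterate_pderiv_eventuallyEq {f g : Plane → ℝ} {x : Plane} (i : Fin 2) (n : ℕ)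
    (h : f =ᶠ[𝓝 x] g) : (pderiv i)^[n] f =ᶠ[𝓝 x] (pderiv i)^[n] g := by
  induction n with
  | zero => exact h
  | succ n ih =>
    rw [Function.iterate_succ_apply', Function.iterate_succ_apply']
    exact pderiv_eventuallyEq i ih

theorem mixed_eventuallyEq {f g : Plane → ℝ} {x : Plane} (m n : ℕ) (h : f =ᶠ[𝓝 x] g) :
    mixed m n f =ᶠ[𝓝 x] mixed m n g :=
  iterate_pderiv_eventuallyEq 0 m (iterate_pderiv_eventuallyEq 1 n h)

theorem contDiffAt_pderiv {f : Plane → ℝ} {x : Plane} {n : ℕ} (i : Fin 2)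
    (h : ContDiffAt ℝ (n + 1 : ℕ) f x) : ContDiffAt ℝ n (pderiv i f) x :=
  (h.fderiv_right (m := (n : WithTop ℕ∞)) (by exact_mod_cast le_rfl)).clm_apply contDiffAt_const

theorem contDiffAt_iterate_pderiv {f : Plane → ℝ} {x : Plane} {n : ℕ} (i : Fin 2) (m : ℕ)
    (h : ContDiffAt ℝ (n + m : ℕ) f x) : ContDiffAt ℝ n ((pderiv i)^[m] f) x := by
  induction m generalizing f with
  | zero => exact h
  | succ m ih =>
    rw [Function.iterate_succ_apply]
    exact ih (contDiffAt_pderiv i (by rwa [add_assoc]))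

theorem contDiffAt_mixed {f : Plane → ℝ} {x : Plane} {n i j : ℕ}
    (h : ContDiffAt ℝ (n + i + j : ℕ) f x) : ContDiffAt ℝ n (mixed i j f) x :=
  contDiffAt_iterate_pderiv 0 i (contDiffAt_iterate_pderiv 1 j h)

theorem mixed_succ_left (i j : ℕ) (f : Plane → ℝ) :
    mixed (i + 1) j f = pderiv 0 (mixed i j f) := by
  rw [mixed, Function.iterate_succ_apply', ← mixed]

theorem mixed_zero_succ (j : ℕ) (f : Plane → ℝ) :
    mixed 0 (j + 1) f = pderiv 1 (mixed 0 j f) := by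
  simp only [mixed, Function.iterate_succ_apply', Function.iterate_zero, id]

theorem pderiv_pderiv_apply {f : Plane → ℝ} {x : Plane} (i j : Fin 2)
    (h : ContDiffAt ℝ 2 f x) : pderiv i (pderiv j f) x =
      fderiv ℝ (fderiv ℝ f) x (EuclideanSpace.single i 1) (EuclideanSpace.single j 1) := by
  have hd : DifferentiableAt ℝ (fderiv ℝ f) x :=
    (h.fderiv_right (m := 1) (by norm_num)).differentiableAt (by norm_num)
  unfold pderiv
  rw [fderiv_clm_apply hd (differentiableAt_const _)]
  simp

theorem pderiv_comm {f : Plane → ℝ} {x : Plane} (i j : Fin 2) (h : ContDiffAt ℝ 2 f x) :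
    pderiv i (pderiv j f) x = pderiv j (pderiv i f) x := by
  rw [pderiv_pderiv_apply i j h, pderiv_pderiv_apply j i h]
  exact (h.isSymmSndFDerivAt (by simp)).eq _ _

/-- The derivative ∂₂ is moved inwards past the i derivatives ∂₁ one at a time, by symmetry of the
second derivative of a C² function. -/
theorem eventually_pderiv_one_mixed {f : Plane → ℝ} {x : Plane} {i j : ℕ}
    (h : ContDiffAt ℝ (i + j + 1 : ℕ) f x) :
    pderiv 1 (mixed i j f) =ᶠ[𝓝 x] mixed i (j + 1) f := by
  induction i with
  | zero => rw [mixed_zero_succ]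
  | succ i ih =>
    have ih' := ih (h.of_le (by exact_mod_cast (by omega)))
    have hc : ∀ᶠ y in 𝓝 x, ContDiffAt ℝ 2 (mixed i j f) y := by
      refine ContDiffAt.eventually ?_ (by norm_num)
      exact contDiffAt_mixed (n := 2) (h.of_le (by exact_mod_cast (by omega)))
    rw [mixed_succ_left, mixed_succ_left]
    refine EventuallyEq.trans ?_ (pderiv_eventuallyEq 0 ih')
    filter_upwards [hc] with y hy using pderiv_comm 1 0 hy

theorem lap_apply {u : Plane → ℝ} {x : Plane} (h : ContDiffAt ℝ 2 u x) :
    lap u x = mixed 2 0 u x + mixed 0 2 u x := by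
  have e0 : mixed 2 0 u = pderiv 0 (pderiv 0 u) := rfl
  have e1 : mixed 0 2 u = pderiv 1 (pderiv 1 u) := rfl
  rw [e0, e1, pderiv_pderiv_apply 0 0 h, pderiv_pderiv_apply 1 1 h, lap,
    InnerProductSpace.laplacian_eq_iteratedFDeriv_orthonormalBasis u
      (EuclideanSpace.basisFun (Fin 2) ℝ)]
  simp [iteratedFDeriv_two_apply]

theorem lap_eventuallyEq {u : Plane → ℝ} {x : Plane} (h : ContDiffAt ℝ 2 u x) :
    lap u =ᶠ[𝓝 x] fun y => mixed 2 0 u y + mixed 0 2 u y := by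
  filter_upwards [h.eventually (by norm_num)] with y hy using lap_apply hy

theorem contDiffAt_lap {u : Plane → ℝ} {x : Plane} {n : ℕ} (h : ContDiffAt ℝ (n + 2 : ℕ) u x) :
    ContDiffAt ℝ n (lap u) x := by
  have h2 : ContDiffAt ℝ 2 u x := h.of_le (by exact_mod_cast (by omega))
  refine ContDiffAt.congr_of_eventuallyEq ?_ (lap_eventuallyEq h2)
  exact (contDiffAt_mixed (i := 2) (j := 0) h).add (contDiffAt_mixed (i := 0) (j := 2) h)

theorem pderiv_add_eventuallyEq {f g : Plane → ℝ} {x : Plane} (i : Fin 2)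
    (hf : ContDiffAt ℝ 1 f x) (hg : ContDiffAt ℝ 1 g x) :
    pderiv i (fun y => f y + g y) =ᶠ[𝓝 x] fun y => pderiv i f y + pderiv i g y := by
  filter_upwards [hf.eventually (by norm_num), hg.eventually (by norm_num)] with y h1 h2
  simp only [pderiv]
  rw [fderiv_fun_add (h1.differentiableAt (by norm_num)) (h2.differentiableAt (by norm_num))]
  rfl

theorem iterate_pderiv_add_eventuallyEq {f g : Plane → ℝ} {x : Plane} (i : Fin 2) (n : ℕ)
    (hf : ContDiffAt ℝ n f x) (hg : ContDiffAt ℝ n g x) :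
    (pderiv i)^[n] (fun y => f y + g y) =ᶠ[𝓝 x]
      fun y => (pderiv i)^[n] f y + (pderiv i)^[n] g y := by
  induction n with
  | zero => rfl
  | succ n ih =>
    simp only [Function.iterate_succ_apply']
    have hle : ((n : ℕ) : WithTop ℕ∞) ≤ ((n + 1 : ℕ) : WithTop ℕ∞) := by
      exact_mod_cast Nat.le_succ n
    refine (pderiv_eventuallyEq i (ih (hf.of_le hle) (hg.of_le hle))).trans ?_
    refine pderiv_add_eventuallyEq i ?_ ?_
    · exact contDiffAt_iterate_pderiv (n := 1) i n (by rwa [add_comm])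
    · exact contDiffAt_iterate_pderiv (n := 1) i n (by rwa [add_comm])

/-- It rewrites the Taylor coefficients of Δu in terms of derivatives of u. The term from ∂₂² is
already in the normal order; in the one from ∂₁², the outer ∂₂'s have to pass ∂₁². -/
theorem mixed_lap {u : Plane → ℝ} {x : Plane} {i j : ℕ}
    (h : ContDiffAt ℝ (i + j + 2 : ℕ) u x) :
    mixed i j (lap u) x = mixed (i + 2) j u x + mixed i (j + 2) u x := by
  have h2 : ContDiffAt ℝ 2 u x := h.of_le (by exact_mod_cast (by omega))
  have e1 : mixed i j (lap u) =ᶠ[𝓝 x] mixed i j fun y => mixed 2 0 u y + mixed 0 2 u y :=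
    mixed_eventuallyEq i j (lap_eventuallyEq h2)
  have c1 : ContDiffAt ℝ (i + j : ℕ) (mixed 2 0 u) x := contDiffAt_mixed (i := 2) (j := 0) h
  have c2 : ContDiffAt ℝ (i + j : ℕ) (mixed 0 2 u) x := contDiffAt_mixed (i := 0) (j := 2) h
  have e2 : (pderiv 1)^[j] (fun y => mixed 2 0 u y + mixed 0 2 u y) =ᶠ[𝓝 x]
      fun y => (pderiv 1)^[j] (mixed 2 0 u) y + (pderiv 1)^[j] (mixed 0 2 u) y :=
    iterate_pderiv_add_eventuallyEq 1 j (c1.of_le (by exact_mod_cast (by omega)))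
      (c2.of_le (by exact_mod_cast (by omega)))
  have e3 : mixed i j (fun y => mixed 2 0 u y + mixed 0 2 u y) =ᶠ[𝓝 x]
      fun y => mixed i j (mixed 2 0 u) y + mixed i j (mixed 0 2 u) y :=
    (iterate_pderiv_eventuallyEq 0 i e2).trans (iterate_pderiv_add_eventuallyEq 0 i
      (contDiffAt_iterate_pderiv 1 j c1) (contDiffAt_iterate_pderiv 1 j c2))
  -- Induction on the number of ∂₂'s already commuted past ∂₁²; the bound k ≤ j keeps the smoothness
  -- hypothesis sufficient.
  have e4 : ∀ k ≤ j, (pderiv 1)^[k] (mixed 2 0 u) =ᶠ[𝓝 x] mixed 2 k u := by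
    intro k
    induction k with
    | zero => intro _; rfl
    | succ k ih =>
      intro hk
      rw [Function.iterate_succ_apply']
      exact (pderiv_eventuallyEq 1 (ih (by omega))).trans
        (eventually_pderiv_one_mixed (h.of_le (by exact_mod_cast (by omega))))
  have e5 : mixed i j (mixed 2 0 u) =ᶠ[𝓝 x] mixed (i + 2) j u := by
    have := iterate_pderiv_eventuallyEq 0 i (e4 j le_rfl)
    refine this.trans (Eq.eventuallyEq ?_)
    rw [mixed, mixed, Function.iterate_add_apply]
  have e6 : mixed i j (mixed 0 2 u) = mixed i (j + 2) u := by
    simp only [mixed, Function.iterate_add_apply, Function.iterate_zero, id]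
  rw [e1.eq_of_nhds, e3.eq_of_nhds, e5.eq_of_nhds, e6]

/-! ### Taylor expansion along a direction -/

theorem plane_eq_smul_single (a b : ℝ) : (!₂[a, b] : Plane) =
    a • EuclideanSpace.single (0 : Fin 2) (1 : ℝ) + b • EuclideanSpace.single (1 : Fin 2) 1 := by
  ext i
  fin_cases i <;> simp

theorem hasDerivAt_line {f : Plane → ℝ} {x v : Plane} {t : ℝ}
    (h : DifferentiableAt ℝ f (x + t • v)) :
    HasDerivAt (fun t : ℝ => f (x + t • v)) (fderiv ℝ f (x + t • v) v) t := by
  have h1 : HasDerivAt (fun t : ℝ => x + t • v) v t := by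
    simpa using ((hasDerivAt_id t).smul_const v).const_add x
  exact h.hasFDerivAt.comp_hasDerivAt t h1

theorem tendsto_line (x v : Plane) : Tendsto (fun t : ℝ => x + t • v) (𝓝 0) (𝓝 x) := by
  have : Continuous fun t : ℝ => x + t • v := by fun_prop
  simpa using this.tendsto 0

/-- Along the line, d/dt acts as a ∂₁ + b ∂₂; these commute, so its k-th power expands by the
binomial theorem. The induction step is Pascal's rule, and it differentiates the previous formula,
which must therefore hold near 0. -/
theorem iteratedDeriv_line {f : Plane → ℝ} {x : Plane} {n : ℕ} (hf : ContDiffAt ℝ n f x)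
    (a b : ℝ) {k : ℕ} (hk : k ≤ n) :
    iteratedDeriv k (fun t : ℝ => f (x + t • !₂[a, b])) =ᶠ[𝓝 0] fun t =>
      ∑ ij ∈ Finset.HasAntidiagonal.antidiagonal k, k.choose ij.1 •
        (a ^ ij.1 * b ^ ij.2 * mixed ij.1 ij.2 f (x + t • !₂[a, b])) := by
  induction k with
  | zero => simp [mixed]
  | succ k ih =>
    rw [iteratedDeriv_succ]
    refine (ih (by omega)).deriv.trans ?_
    have hev : ∀ᶠ y in 𝓝 x, ∀ ij ∈ Finset.HasAntidiagonal.antidiagonal k,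
        DifferentiableAt ℝ (mixed ij.1 ij.2 f) y ∧
          pderiv 1 (mixed ij.1 ij.2 f) y = mixed ij.1 (ij.2 + 1) f y := by
      rw [Filter.eventually_all_finset]
      intro ij hij
      rw [Finset.HasAntidiagonal.mem_antidiagonal] at hij
      have hc : ContDiffAt ℝ 1 (mixed ij.1 ij.2 f) x :=
        contDiffAt_mixed (n := 1) (hf.of_le (by exact_mod_cast (by omega)))
      filter_upwards [hc.eventually (by norm_num), eventually_pderiv_one_mixed
        (i := ij.1) (j := ij.2) (hf.of_le (by exact_mod_cast (by omega)))] with y h1 h2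
      exact ⟨h1.differentiableAt (by norm_num), h2⟩
    filter_upwards [(tendsto_line x !₂[a, b]).eventually hev] with t ht
    have hd : HasDerivAt (fun t : ℝ => ∑ ij ∈ Finset.HasAntidiagonal.antidiagonal k, k.choose ij.1 •
        (a ^ ij.1 * b ^ ij.2 * mixed ij.1 ij.2 f (x + t • !₂[a, b])))
        (∑ ij ∈ Finset.HasAntidiagonal.antidiagonal k, k.choose ij.1 • (a ^ ij.1 * b ^ ij.2 *
          fderiv ℝ (mixed ij.1 ij.2 f) (x + t • !₂[a, b]) !₂[a, b])) t := by
      refine HasDerivAt.fun_sum fun ij hij => ?_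
      exact ((hasDerivAt_line (ht ij hij).1).const_mul _).const_smul (k.choose ij.1)
    rw [hd.deriv, Finset.sum_antidiagonal_choose_succ_nsmul
      (fun i j => a ^ i * b ^ j * mixed i j f (x + t • !₂[a, b])), ← Finset.sum_add_distrib]
    refine Finset.sum_congr rfl fun ij hij => ?_
    -- Pascal's rule produces the second sum with the complementary binomial coefficient, equal to
    -- the first one on the antidiagonal.
    have hc : k.choose ij.2 = k.choose ij.1 :=
      Nat.choose_symm_of_eq_add (by rw [← Finset.HasAntidiagonal.mem_antidiagonal.1 hij, add_comm])
    rw [hc, ← smul_add]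
    congr 1
    have e := (ht ij hij).2
    rw [mixed_succ_left, ← e]
    conv_lhs => rw [plane_eq_smul_single]
    rw [map_add, map_smul, map_smul, ← plane_eq_smul_single]
    simp only [pderiv, smul_eq_mul]
    ring

/-- One-variable Taylor theorem on [0, δ/2]. One-sided steps h > 0 are enough, since opposite nodes
correspond to opposite directions (a, b). -/
theorem taylor_bound_line {f : Plane → ℝ} {x : Plane} {n : ℕ}
    (hf : ContDiffAt ℝ (n + 1 : ℕ) f x) (a b : ℝ) :
    ∃ C : ℝ, ∀ᶠ h in 𝓝[>] (0 : ℝ), |f (x + h • !₂[a, b]) - ∑ k ∈ Finset.range (n + 1),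
      h ^ k / (k.factorial : ℝ) * ∑ ij ∈ Finset.HasAntidiagonal.antidiagonal k, k.choose ij.1 •
        (a ^ ij.1 * b ^ ij.2 * mixed ij.1 ij.2 f x)| ≤ C * h ^ (n + 1) := by
  set g : ℝ → ℝ := fun t => f (x + t • !₂[a, b]) with hg
  have hgc : ContDiffAt ℝ (n + 1 : ℕ) g 0 := by
    refine ContDiffAt.comp (0 : ℝ) (g := f) ?_ (by fun_prop)
    simpa using hf
  obtain ⟨δ, hδ, hball⟩ := Metric.eventually_nhds_iff.1 (hgc.eventually (by simp))
  have hcd : ContDiffOn ℝ (n + 1 : ℕ) g (Set.Icc 0 (δ / 2)) := fun t ht =>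
    (hball (by
      rw [Real.dist_eq, sub_zero, abs_of_nonneg ht.1]
      linarith [ht.2])).contDiffWithinAt
  obtain ⟨C, hC⟩ := exists_taylor_mean_remainder_bound (n := n) (by linarith : (0 : ℝ) ≤ δ / 2)
    (by exact_mod_cast hcd)
  refine ⟨C, ?_⟩
  filter_upwards [Ioo_mem_nhdsGT (by linarith : (0 : ℝ) < δ / 2)] with h hh
  have := hC h ⟨hh.1.le, hh.2.le⟩
  rw [sub_zero, Real.norm_eq_abs] at this
  refine le_trans (le_of_eq ?_) this
  congr 2
  rw [taylor_within_apply]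
  refine Finset.sum_congr rfl fun k hk => ?_
  have hk' : k ≤ n + 1 := (Finset.mem_range.1 hk).le
  -- At the endpoint 0 the derivatives within the interval are the ordinary ones, because g is
  -- smooth on both sides of 0.
  rw [iteratedDerivWithin_eq_iteratedDeriv (uniqueDiffOn_Icc (by linarith))
    (hgc.of_le (by exact_mod_cast hk')) ⟨le_rfl, by linarith⟩,
    (iteratedDeriv_line hf a b hk').eq_of_nhds]
  simp only [sub_zero, zero_smul, add_zero, smul_eq_mul]
  ring

/-! ### Taylor expansions of sums over the nodes -/

/-- The Taylor polynomial of degree less than `n` at the origin in the direction `p`, for a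
function with partial derivatives `c`. -/
def dirTaylor (n : ℕ) (c : ℕ → ℕ → ℝ) (h : ℝ) (p : ℤ × ℤ) : ℝ :=
  ∑ k ∈ Finset.range n, h ^ k / (k.factorial : ℝ) *
    ∑ i ∈ Finset.range (k + 1),
      (k.choose i : ℝ) * ((p.1 : ℝ) ^ i * (p.2 : ℝ) ^ (k - i) * c i (k - i))

/-- The error estimate is turned into an exact identity by dividing the error by h^(n+1) and calling
the quotient ρ. The truncation error can then be computed by algebra, and only the boundedness of ρ
is needed afterwards. -/
theorem taylor_sum_nodes {f : Plane → ℝ} {x : Plane} {n : ℕ}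
    (hf : ContDiffAt ℝ (n + 1 : ℕ) f x) (S : Finset (ℤ × ℤ)) :
    ∃ ρ : ℝ → ℝ, ∃ C : ℝ, ∀ᶠ h in 𝓝[>] (0 : ℝ), |ρ h| ≤ C ∧
      ∑ p ∈ S, f (node x h p) =
        ∑ p ∈ S, dirTaylor (n + 1) (fun i j => mixed i j f x) h p + h ^ (n + 1) * ρ h := by
  choose C hC using fun p : ℤ × ℤ => taylor_bound_line hf (p.1 : ℝ) (p.2 : ℝ)
  refine ⟨fun h => (∑ p ∈ S, (f (node x h p)
    - dirTaylor (n + 1) (fun i j => mixed i j f x) h p)) / h ^ (n + 1), ∑ p ∈ S, C p, ?_⟩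
  have hall : ∀ᶠ h in 𝓝[>] (0 : ℝ), ∀ p ∈ S,
      |f (node x h p) - dirTaylor (n + 1) (fun i j => mixed i j f x) h p| ≤ C p * h ^ (n + 1) := by
    rw [Filter.eventually_all_finset]
    intro p _
    filter_upwards [hC p] with h hh
    simp only [Finset.Nat.sum_antidiagonal_eq_sum_range_succ_mk, nsmul_eq_mul] at hh
    exact hh
  filter_upwards [hall, self_mem_nhdsWithin] with h hh hpos
  have hpos' : 0 < h ^ (n + 1) := pow_pos hpos _
  constructor
  · rw [abs_div, abs_of_pos hpos', div_le_iff₀ hpos', Finset.sum_mul]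
    exact (Finset.abs_sum_le_sum_abs _ _).trans (Finset.sum_le_sum hh)
  · rw [mul_div_cancel₀ _ hpos'.ne', Finset.sum_sub_distrib]
    ring

theorem sum_edges (f : ℤ × ℤ → ℝ) :
    ∑ p ∈ edges, f p = f (1, 0) + f (0, 1) + f (-1, 0) + f (0, -1) := by
  simp [edges, add_assoc]

theorem sum_corners (f : ℤ × ℤ → ℝ) :
    ∑ p ∈ corners, f p = f (1, 1) + f (-1, 1) + f (-1, -1) + f (1, -1) := by
  simp [corners, add_assoc]

theorem sum_far (f : ℤ × ℤ → ℝ) :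
    ∑ p ∈ far, f p = f (2, 0) + f (0, 2) + f (-2, 0) + f (0, -2) := by
  simp [far, add_assoc]

theorem sum_edges_union_corners (f : ℤ × ℤ → ℝ) :
    ∑ p ∈ edges ∪ corners, f p = ∑ p ∈ edges, f p + ∑ p ∈ corners, f p :=
  Finset.sum_union (by decide)

/-- The node set is invariant under reflection in both axes, so derivatives of odd order in either
variable cancel. The same happens in the five expansions that follow. -/
theorem sum_edges_dirTaylor_six (c : ℕ → ℕ → ℝ) (h : ℝ) :
    ∑ p ∈ edges, dirTaylor 6 c h p = 4 * c 0 0 + h ^ 2 * (c 2 0 + c 0 2)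
      + h ^ 4 / 12 * (c 4 0 + c 0 4) := by
  simp [sum_edges, dirTaylor, Finset.sum_range_succ, Nat.factorial]
  ring

theorem sum_edges_dirTaylor_eight (c : ℕ → ℕ → ℝ) (h : ℝ) :
    ∑ p ∈ edges, dirTaylor 8 c h p = 4 * c 0 0 + h ^ 2 * (c 2 0 + c 0 2)
      + h ^ 4 / 12 * (c 4 0 + c 0 4) + h ^ 6 / 360 * (c 6 0 + c 0 6) := by
  simp [sum_edges, dirTaylor, Finset.sum_range_succ, Nat.factorial]
  ring

theorem sum_edges_dirTaylor_ten (c : ℕ → ℕ → ℝ) (h : ℝ) :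
    ∑ p ∈ edges, dirTaylor 10 c h p = 4 * c 0 0 + h ^ 2 * (c 2 0 + c 0 2)
      + h ^ 4 / 12 * (c 4 0 + c 0 4) + h ^ 6 / 360 * (c 6 0 + c 0 6)
      + h ^ 8 / 20160 * (c 8 0 + c 0 8) := by
  simp [sum_edges, dirTaylor, Finset.sum_range_succ, Nat.factorial]
  ring

theorem sum_corners_dirTaylor_eight (c : ℕ → ℕ → ℝ) (h : ℝ) :
    ∑ p ∈ corners, dirTaylor 8 c h p = 4 * c 0 0 + 2 * h ^ 2 * (c 2 0 + c 0 2)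
      + h ^ 4 / 6 * (c 4 0 + 6 * c 2 2 + c 0 4)
      + h ^ 6 / 180 * (c 6 0 + 15 * c 4 2 + 15 * c 2 4 + c 0 6) := by
  simp [sum_corners, dirTaylor, Finset.sum_range_succ, Nat.factorial, Nat.choose]
  ring

theorem sum_corners_dirTaylor_ten (c : ℕ → ℕ → ℝ) (h : ℝ) :
    ∑ p ∈ corners, dirTaylor 10 c h p = 4 * c 0 0 + 2 * h ^ 2 * (c 2 0 + c 0 2)
      + h ^ 4 / 6 * (c 4 0 + 6 * c 2 2 + c 0 4)
      + h ^ 6 / 180 * (c 6 0 + 15 * c 4 2 + 15 * c 2 4 + c 0 6)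
      + h ^ 8 / 10080 * (c 8 0 + 28 * c 6 2 + 70 * c 4 4 + 28 * c 2 6 + c 0 8) := by
  simp [sum_corners, dirTaylor, Finset.sum_range_succ, Nat.factorial, Nat.choose]
  ring

theorem sum_far_dirTaylor_ten (c : ℕ → ℕ → ℝ) (h : ℝ) :
    ∑ p ∈ far, dirTaylor 10 c h p = 4 * c 0 0 + 4 * h ^ 2 * (c 2 0 + c 0 2)
      + 4 * h ^ 4 / 3 * (c 4 0 + c 0 4) + 8 * h ^ 6 / 45 * (c 6 0 + c 0 6)
      + 4 * h ^ 8 / 315 * (c 8 0 + c 0 8) := by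
  simp [sum_far, dirTaylor, Finset.sum_range_succ, Nat.factorial]
  ring

/-! ### The Gaussian and its Laplacians at the nodes -/

theorem pderiv_radial {q q' : ℝ → ℝ} (hq : ∀ t, HasDerivAt q (q' t) t) (y x : Plane) (i : Fin 2) :
    pderiv i (fun x => q (‖x - y‖ ^ 2)) x = 2 * (x i - y i) * q' (‖x - y‖ ^ 2) := by
  have h1 : HasFDerivAt (fun x : Plane => ‖x - y‖ ^ 2) (2 • (innerSL ℝ (x - y))) x := by
    simpa using ((hasFDerivAt_id x).sub_const y).norm_sq
  have h2 := (hq (‖x - y‖ ^ 2)).comp_hasFDerivAt x h1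
  have h3 : HasFDerivAt (fun x : Plane => q (‖x - y‖ ^ 2)) _ x := h2
  rw [pderiv, h3.fderiv]
  simp [EuclideanSpace.inner_single_right]
  ring

/-- With r² = ‖x - y‖², each second partial derivative is 2 q' + 4 (xᵢ - yᵢ)² q''. Summing over the
two coordinates of the plane gives 4 q' + 4 r² q''. -/
theorem lap_radial {q q₁ q₂ : ℝ → ℝ} (hc : ContDiff ℝ 2 q) (h1 : ∀ t, HasDerivAt q (q₁ t) t)
    (h2 : ∀ t, HasDerivAt q₁ (q₂ t) t) (y x : Plane) :
    lap (fun x => q (‖x - y‖ ^ 2)) x =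
      4 * q₁ (‖x - y‖ ^ 2) + 4 * ‖x - y‖ ^ 2 * q₂ (‖x - y‖ ^ 2) := by
  have hcd : ContDiff ℝ 2 fun x : Plane => q (‖x - y‖ ^ 2) :=
    hc.comp ((contDiff_id.sub contDiff_const).norm_sq ℝ)
  have hp : ∀ i : Fin 2, pderiv i (pderiv i fun x => q (‖x - y‖ ^ 2)) x
      = 2 * q₁ (‖x - y‖ ^ 2) + 4 * (x i - y i) ^ 2 * q₂ (‖x - y‖ ^ 2) := by
    intro i
    rw [funext fun x => pderiv_radial h1 y x i]
    have hd1 : HasFDerivAt (fun x : Plane => 2 * (x i - y i))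
        ((2 : ℝ) • (EuclideanSpace.proj i : Plane →L[ℝ] ℝ)) x := by
      have := ((EuclideanSpace.proj i : Plane →L[ℝ] ℝ).hasFDerivAt (x := x)).sub_const (y i)
      exact this.const_mul 2
    have hd2 : DifferentiableAt ℝ (fun x : Plane => q₁ (‖x - y‖ ^ 2)) x := by
      have hn : DifferentiableAt ℝ (fun x : Plane => ‖x - y‖ ^ 2) x :=
        ((differentiableAt_id.sub_const y).norm_sq ℝ)
      exact (h2 _).differentiableAt.comp x hn
    have e := pderiv_radial h2 y x i
    rw [pderiv] at e ⊢
    rw [(hd1.fun_mul hd2.hasFDerivAt).fderiv]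
    simp only [add_apply, smul_apply, smul_eq_mul, e]
    simp
    ring
  rw [lap_apply hcd.contDiffAt]
  have e0 : ∀ f : Plane → ℝ, mixed 2 0 f x = pderiv 0 (pderiv 0 f) x := fun _ => rfl
  have e1 : ∀ f : Plane → ℝ, mixed 0 2 f x = pderiv 1 (pderiv 1 f) x := fun _ => rfl
  rw [e0, e1, hp, hp, EuclideanSpace.norm_sq_eq]
  simp [Fin.sum_univ_two]
  ring

theorem lap_const (c : ℝ) (x : Plane) : lap (fun _ => c) x = 0 := by
  simpa using lap_radial (q := fun _ => c) contDiff_const (fun t => hasDerivAt_const t c)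
    (fun t => hasDerivAt_const t 0) 0 x

theorem hasDerivAt_exp_mul (c t : ℝ) :
    HasDerivAt (fun t => Real.exp (-(c * t))) (-c * Real.exp (-(c * t))) t := by
  have := ((hasDerivAt_id t).const_mul c).neg.exp
  simpa [mul_comm] using this

theorem lap_basisFun (ε : ℝ) (y x : Plane) : lap (basisFun ε y) x =
    (4 * ε ^ 4 * ‖x - y‖ ^ 2 - 4 * ε ^ 2) * Real.exp (-(ε ^ 2 * ‖x - y‖ ^ 2)) := by
  have h := lap_radial (q := fun t => Real.exp (-(ε ^ 2 * t))) (by fun_prop)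
    (hasDerivAt_exp_mul (ε ^ 2)) (fun t => (hasDerivAt_exp_mul (ε ^ 2) t).const_mul (-ε ^ 2)) y x
  refine Eq.trans h ?_
  ring

/-- The Gaussian is symmetric in point and centre, so its Laplacian with respect to the centre is
the one with respect to the point. -/
theorem lapBasisFun_apply (ε : ℝ) (y x : Plane) : lapBasisFun ε y x =
    (4 * ε ^ 4 * ‖x - y‖ ^ 2 - 4 * ε ^ 2) * Real.exp (-(ε ^ 2 * ‖x - y‖ ^ 2)) := by
  rw [lapBasisFun, show (fun y' => gauss ε x y') = basisFun ε x from
    funext fun y' => by rw [basisFun, gauss, gauss, norm_sub_rev], lap_basisFun, norm_sub_rev]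

/-- Functions (a t + b) exp(-ε² t) are stable under d/dt, so `hlin` supplies both derivatives
required by `lap_radial`. -/
theorem lap_lapBasisFun (ε : ℝ) (y x : Plane) : lap (lapBasisFun ε y) x =
    (16 * ε ^ 8 * (‖x - y‖ ^ 2) ^ 2 - 64 * ε ^ 6 * ‖x - y‖ ^ 2 + 32 * ε ^ 4)
      * Real.exp (-(ε ^ 2 * ‖x - y‖ ^ 2)) := by
  have hlin : ∀ a b t : ℝ, HasDerivAt (fun t => (a * t + b) * Real.exp (-(ε ^ 2 * t)))
      ((-ε ^ 2 * a * t + (a - ε ^ 2 * b)) * Real.exp (-(ε ^ 2 * t))) t := by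
    intro a b t
    have := (((hasDerivAt_id t).const_mul a).add_const b).mul (hasDerivAt_exp_mul (ε ^ 2) t)
    refine this.congr_deriv ?_
    simp
    ring
  have h := lap_radial (q := fun t => (4 * ε ^ 4 * t + -4 * ε ^ 2) * Real.exp (-(ε ^ 2 * t)))
    (by fun_prop) (hlin _ _) (hlin _ _) y x
  rw [funext (lapBasisFun_apply ε y)]
  refine Eq.trans ?_ (h.trans ?_)
  · congr 1
    funext x
    ring
  · ring

theorem norm_node_sub_node_sq (x : Plane) (h : ℝ) (p q : ℤ × ℤ) :
    ‖node x h p - node x h q‖ ^ 2 = (((p.1 - q.1) ^ 2 + (p.2 - q.2) ^ 2 : ℤ) : ℝ) * h ^ 2 := by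
  rw [EuclideanSpace.norm_sq_eq]
  simp [node, Fin.sum_univ_two]
  ring

theorem node_zero (x : Plane) (h : ℝ) : node x h (0, 0) = x := by
  ext i
  fin_cases i <;> simp [node]

/-- The Gaussian at squared distance `d h²`, as a function of `s = ε² h²`. -/
def rbf (d s : ℝ) : ℝ := Real.exp (-(d * s))

/-- The Laplacian of the Gaussian at squared distance `d h²`, divided by `ε²`. -/
def rbfLap (d s : ℝ) : ℝ := 4 * (d * s - 1) * rbf d s

/-- The bi-Laplacian of the Gaussian at squared distance `d h²`, divided by `ε⁴`. -/
def rbfBilap (d s : ℝ) : ℝ := 16 * (d ^ 2 * s ^ 2 - 4 * d * s + 2) * rbf d s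

theorem rbf_zero (s : ℝ) : rbf 0 s = 1 := by simp [rbf]

/-- The sum of a function of the squared distance from an edge node over the edge nodes. -/
def edgeEdge (f : ℝ → ℝ) : ℝ := f 0 + 2 * f 2 + f 4

/-- The sum of a function of the squared distance from an edge node over the corners, or from a
corner over the edge nodes. -/
def edgeCorner (f : ℝ → ℝ) : ℝ := 2 * f 1 + 2 * f 5

/-- The sum of a function of the squared distance from a corner over the corners. -/
def cornerCorner (f : ℝ → ℝ) : ℝ := f 0 + 2 * f 4 + f 8

/-- The sum of a function of the squared distance from an edge node over the far nodes, or from a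
far node over the edge nodes. -/
def edgeFar (f : ℝ → ℝ) : ℝ := f 1 + 2 * f 5 + f 9

/-- The sum of a function of the squared distance from a far node over the far nodes. -/
def farFar (f : ℝ → ℝ) : ℝ := f 0 + 2 * f 8 + f 16

/-- The sum of a function of the squared distance from a far node over the corners, or from a
corner over the far nodes. -/
def farCorner (f : ℝ → ℝ) : ℝ := 2 * f 2 + 2 * f 10

/-- Eight Taylor terms: the largest row order is 4, and the residual must be divisible by four
further powers of s. -/
theorem exists_continuous_rbf_remainder_nine (d : ℝ) : ∃ R : ℝ → ℝ, Continuous R ∧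
    ∀ s, rbf d s = 1 - d * s + d ^ 2 / 2 * s ^ 2 - d ^ 3 / 6 * s ^ 3 + d ^ 4 / 24 * s ^ 4
      - d ^ 5 / 120 * s ^ 5 + d ^ 6 / 720 * s ^ 6 - d ^ 7 / 5040 * s ^ 7 + s ^ 8 * R s := by
  obtain ⟨R, hR, h⟩ := exists_continuous_exp_neg_remainder 8 d
  refine ⟨R, hR, fun s => ?_⟩
  rw [rbf, h]
  simp only [Finset.sum_range_succ, Finset.sum_range_zero, Nat.factorial]
  push_cast
  ring

/-- Ten Taylor terms: here the largest row order is 6, again with four further powers of s. -/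
theorem exists_continuous_rbf_remainder_thirteen (d : ℝ) : ∃ R : ℝ → ℝ, Continuous R ∧
    ∀ s, rbf d s = 1 - d * s + d ^ 2 / 2 * s ^ 2 - d ^ 3 / 6 * s ^ 3 + d ^ 4 / 24 * s ^ 4
      - d ^ 5 / 120 * s ^ 5 + d ^ 6 / 720 * s ^ 6 - d ^ 7 / 5040 * s ^ 7 + d ^ 8 / 40320 * s ^ 8
      - d ^ 9 / 362880 * s ^ 9 + s ^ 10 * R s := by
  obtain ⟨R, hR, h⟩ := exists_continuous_exp_neg_remainder 10 d
  refine ⟨R, hR, fun s => ?_⟩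
  rw [rbf, h]
  simp only [Finset.sum_range_succ, Finset.sum_range_zero, Nat.factorial]
  push_cast
  ring

/-! ### The reduced linear systems in s -/

/-- The system for the scaled weights `h² α₁`, `h² α₂`, `β₁` of the nine-point formula. -/
def nineMatrix (s : ℝ) : Matrix (Fin 3) (Fin 3) ℝ :=
  !![edgeEdge (rbf · s) - 8 * rbf 1 s + 4 * rbf 0 s,
      edgeCorner (rbf · s) - 4 * rbf 1 s - 4 * rbf 2 s + 4 * rbf 0 s,
      s * (edgeEdge (rbfLap · s) - 4 * rbfLap 1 s);
    edgeCorner (rbf · s) - 4 * rbf 2 s - 4 * rbf 1 s + 4 * rbf 0 s,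
      cornerCorner (rbf · s) - 8 * rbf 2 s + 4 * rbf 0 s,
      s * (edgeCorner (rbfLap · s) - 4 * rbfLap 1 s);
    edgeEdge (rbfLap · s) - 4 * rbfLap 1 s,
      edgeCorner (rbfLap · s) - 4 * rbfLap 1 s,
      s * edgeEdge (rbfBilap · s)]

/-- The right-hand side of the system for the scaled weights of the nine-point formula. -/
def nineRhs (s : ℝ) : Fin 3 → ℝ :=
  ![s * (rbfLap 1 s - rbfLap 0 s), s * (rbfLap 2 s - rbfLap 0 s), s * rbfBilap 1 s]

/-- The system for the scaled weights `h² α₁`, `h² α₂`, `β₁`, `β₂` of the thirteen-point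
formula. -/
def thirteenMatrix (s : ℝ) : Matrix (Fin 4) (Fin 4) ℝ :=
  !![edgeEdge (rbf · s) + edgeCorner (rbf · s) - 12 * rbf 1 s - 4 * rbf 2 s + 8 * rbf 0 s,
      edgeFar (rbf · s) - 4 * rbf 1 s - 4 * rbf 4 s + 4 * rbf 0 s,
      s * (edgeEdge (rbfLap · s) - 4 * rbfLap 1 s),
      s * (edgeCorner (rbfLap · s) - 4 * rbfLap 2 s);
    edgeFar (rbf · s) + farCorner (rbf · s) - 8 * rbf 4 s - 4 * rbf 1 s - 4 * rbf 2 s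
        + 8 * rbf 0 s,
      farFar (rbf · s) - 8 * rbf 4 s + 4 * rbf 0 s,
      s * (edgeFar (rbfLap · s) - 4 * rbfLap 1 s),
      s * (farCorner (rbfLap · s) - 4 * rbfLap 2 s);
    edgeEdge (rbfLap · s) + edgeCorner (rbfLap · s) - 8 * rbfLap 1 s,
      edgeFar (rbfLap · s) - 4 * rbfLap 1 s,
      s * edgeEdge (rbfBilap · s),
      s * edgeCorner (rbfBilap · s);
    edgeCorner (rbfLap · s) + cornerCorner (rbfLap · s) - 8 * rbfLap 2 s,
      farCorner (rbfLap · s) - 4 * rbfLap 2 s,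
      s * edgeCorner (rbfBilap · s),
      s * cornerCorner (rbfBilap · s)]

/-- The right-hand side of the system for the scaled weights of the thirteen-point formula. -/
def thirteenRhs (s : ℝ) : Fin 4 → ℝ :=
  ![s * (rbfLap 1 s - rbfLap 0 s), s * (rbfLap 4 s - rbfLap 0 s), s * rbfBilap 1 s,
    s * rbfBilap 2 s]

/-! ### Row reduction at s = 0 and the residuals of the claimed expansions -/

section RowReduction

set_option linter.unusedSimpArgs false

/-- Row operations that regularise `nineMatrix` at `s = 0`. -/
def nineRowOps (s : ℝ) : Matrix (Fin 3) (Fin 3) ℝ :=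
    !![-16, 0, 4 * s + 9 * s ^ 2;
      -4 + 3 * s, 2, 0;
      0, 0, 1]

/-- The orders at `s = 0` of the rows of `nineRowOps * nineMatrix`. -/
def nineOrders : Fin 3 → ℕ := ![4, 4, 1]

/-- The leading coefficients of `nineRowOps * nineMatrix`. -/
def nineLeading : Matrix (Fin 3) (Fin 3) ℝ :=
    !![-456, -736, -2816 / 3;
      16, 68, 152;
      32, 64, 128]

/-- The Taylor polynomials of the scaled weights. -/
def nineTaylor (s : ℝ) : Fin 3 → ℝ :=
    ![1 - 13 / 24 * s - 2273 / 1440 * s ^ 2 - 4459 / 8640 * s ^ 3,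
      1 / 4 + 71 / 96 * s + 5023 / 5760 * s ^ 2 + 1609 / 6912 * s ^ 3,
      -1 / 8 - 15 / 64 * s - 213 / 1280 * s ^ 2 + 373 / 7680 * s ^ 3]

/-- The first row of the system and s times its third row both start at s², with proportional
leading parts. The multiplier 4s + 9s² cancels the orders s² and s³ in all three columns at once. -/
theorem nineRowOps_mul_row0 (j : Fin 3) : ∃ g : ℝ → ℝ, Continuous g ∧ ∀ s,
    (nineRowOps s * nineMatrix s) 0 j =
      s ^ nineOrders 0 * (nineLeading 0 j + s * g s) := by
  obtain ⟨R1, hR1, h1⟩ := exists_continuous_rbf_remainder_nine 1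
  obtain ⟨R2, hR2, h2⟩ := exists_continuous_rbf_remainder_nine 2
  obtain ⟨R4, hR4, h4⟩ := exists_continuous_rbf_remainder_nine 4
  obtain ⟨R5, hR5, h5⟩ := exists_continuous_rbf_remainder_nine 5
  obtain ⟨R8, hR8, h8⟩ := exists_continuous_rbf_remainder_nine 8
  fin_cases j
  -- The witness is the explicit quotient: insert the Taylor polynomials with remainders `R1`, `R2`,
  -- ..., remove the leading term and divide by the power of s. Being a polynomial in s and the
  -- remainders, it is continuous, and `ring` verifies it. All later witnesses of this section arise
  -- in this way.
  · refine ⟨fun s =>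
      3064 / 3 - 61042 / 45 * s + 12128 / 9 * s ^ 2 - 332167 / 315 * s ^ 3 + 233404 / 315 * s ^ 4
      - 16511 / 35 * s ^ 5 + (128 * s ^ 3 + 64 * s ^ 4 + 80 * s ^ 5 - 144 * s ^ 6) * R1 s + (-32
      * s ^ 3 - 32 * s ^ 4 - 8 * s ^ 5 + 144 * s ^ 6) * R2 s + (-16 * s ^ 3 - 16 * s ^ 4 + 28 * s
      ^ 5 + 144 * s ^ 6) * R4 s, by fun_prop, fun s => ?_⟩
    -- Without the cancellation lemmas the goal stays an equation instead of becoming a disjunction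
    -- with a vanishing factor.
    simp [-mul_eq_mul_left_iff, -mul_eq_mul_right_iff, Matrix.mul_apply, Fin.sum_univ_three,
      nineRowOps, nineMatrix, nineOrders, nineLeading,
      edgeEdge, edgeCorner, cornerCorner, rbfLap, rbfBilap]
    simp only [rbf_zero, h1, h2, h4, h5, h8]
    ring
  · refine ⟨fun s =>
      2608 - 227264 / 45 * s + 6880 * s ^ 2 - 2195108 / 315 * s ^ 3 + 677072 / 105 * s ^ 4 -
      195312 / 35 * s ^ 5 + (32 * s ^ 3 + 32 * s ^ 4 + 40 * s ^ 5 - 72 * s ^ 6) * R1 s + (64 * s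
      ^ 3) * R2 s + (-32 * s ^ 3 - 32 * s ^ 4 + 88 * s ^ 5 + 360 * s ^ 6) * R5 s, by fun_prop,
      fun s => ?_⟩
    simp [-mul_eq_mul_left_iff, -mul_eq_mul_right_iff, Matrix.mul_apply, Fin.sum_univ_three,
      nineRowOps, nineMatrix, nineOrders, nineLeading,
      edgeEdge, edgeCorner, cornerCorner, rbfLap, rbfBilap]
    simp only [rbf_zero, h1, h2, h4, h5, h8]
    ring
  · refine ⟨fun s =>
      7456 - 94144 / 5 * s + 1354256 / 45 * s ^ 2 - 11182208 / 315 * s ^ 3 + 10374128 / 315 * s ^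
      4 - 2625536 / 105 * s ^ 5 + 1097216 / 63 * s ^ 6 - 263168 / 35 * s ^ 7 + (-256 * s ^ 4 +
      256 * s ^ 5) * R1 s + (128 * s ^ 4 - 448 * s ^ 6 - 1792 * s ^ 7 + 1152 * s ^ 8) * R2 s +
      (64 * s ^ 4 - 128 * s ^ 5 - 736 * s ^ 6 - 1280 * s ^ 7 + 2304 * s ^ 8) * R4 s, by fun_prop,
      fun s => ?_⟩
    simp [-mul_eq_mul_left_iff, -mul_eq_mul_right_iff, Matrix.mul_apply, Fin.sum_univ_three,
      nineRowOps, nineMatrix, nineOrders, nineLeading,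
      edgeEdge, edgeCorner, cornerCorner, rbfLap, rbfBilap]
    simp only [rbf_zero, h1, h2, h4, h5, h8]
    ring

/-- The s² part of the second row is twice that of the first, so -4 and 2 cancel it; the term 3s
then removes s³. -/
theorem nineRowOps_mul_row1 (j : Fin 3) : ∃ g : ℝ → ℝ, Continuous g ∧ ∀ s,
    (nineRowOps s * nineMatrix s) 1 j =
      s ^ nineOrders 1 * (nineLeading 1 j + s * g s) := by
  obtain ⟨R1, hR1, h1⟩ := exists_continuous_rbf_remainder_nine 1
  obtain ⟨R2, hR2, h2⟩ := exists_continuous_rbf_remainder_nine 2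
  obtain ⟨R4, hR4, h4⟩ := exists_continuous_rbf_remainder_nine 4
  obtain ⟨R5, hR5, h5⟩ := exists_continuous_rbf_remainder_nine 5
  obtain ⟨R8, hR8, h8⟩ := exists_continuous_rbf_remainder_nine 8
  fin_cases j
  · refine ⟨fun s =>
      -31 + 107 / 3 * s - 931 / 30 * s ^ 2 - 99 / 10 * s ^ 3 + (28 * s ^ 3 - 24 * s ^ 4) * R1 s +
      (-16 * s ^ 3 + 6 * s ^ 4) * R2 s + (-4 * s ^ 3 + 3 * s ^ 4) * R4 s + (4 * s ^ 3) * R5 s, by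
      fun_prop, fun s => ?_⟩
    simp [-mul_eq_mul_left_iff, -mul_eq_mul_right_iff, Matrix.mul_apply, Fin.sum_univ_three,
      nineRowOps, nineMatrix, nineOrders, nineLeading,
      edgeEdge, edgeCorner, cornerCorner, rbfLap, rbfBilap]
    simp only [rbf_zero, h1, h2, h4, h5, h8]
    ring
  · refine ⟨fun s =>
      -224 + 1273 / 3 * s - 8881 / 15 * s ^ 2 - 927 / 10 * s ^ 3 + (8 * s ^ 3 - 6 * s ^ 4) * R1 s
      + (-12 * s ^ 4) * R2 s + (4 * s ^ 3) * R4 s + (-8 * s ^ 3 + 6 * s ^ 4) * R5 s + (2 * s ^ 3)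
      * R8 s, by fun_prop, fun s => ?_⟩
    simp [-mul_eq_mul_left_iff, -mul_eq_mul_right_iff, Matrix.mul_apply, Fin.sum_univ_three,
      nineRowOps, nineMatrix, nineOrders, nineLeading,
      edgeEdge, edgeCorner, cornerCorner, rbfLap, rbfBilap]
    simp only [rbf_zero, h1, h2, h4, h5, h8]
    ring
  · refine ⟨fun s =>
      -1576 / 3 + 922 * s - 10112 / 9 * s ^ 2 + 16039 / 15 * s ^ 3 - 224764 / 315 * s ^ 4 - 16511
      / 105 * s ^ 5 + (-48 * s ^ 4 + 96 * s ^ 5 - 48 * s ^ 6) * R1 s + (32 * s ^ 4 - 88 * s ^ 5 +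
      48 * s ^ 6) * R2 s + (16 * s ^ 4 - 76 * s ^ 5 + 48 * s ^ 6) * R4 s + (-16 * s ^ 4 + 80 * s
      ^ 5) * R5 s, by fun_prop, fun s => ?_⟩
    simp [-mul_eq_mul_left_iff, -mul_eq_mul_right_iff, Matrix.mul_apply, Fin.sum_univ_three,
      nineRowOps, nineMatrix, nineOrders, nineLeading,
      edgeEdge, edgeCorner, cornerCorner, rbfLap, rbfBilap]
    simp only [rbf_zero, h1, h2, h4, h5, h8]
    ring

/-- The row from the Laplacians of the Gaussians needs no operation, since its s-linear part is
already nonzero. -/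
theorem nineRowOps_mul_row2 (j : Fin 3) : ∃ g : ℝ → ℝ, Continuous g ∧ ∀ s,
    (nineRowOps s * nineMatrix s) 2 j =
      s ^ nineOrders 2 * (nineLeading 2 j + s * g s) := by
  obtain ⟨R1, hR1, h1⟩ := exists_continuous_rbf_remainder_nine 1
  obtain ⟨R2, hR2, h2⟩ := exists_continuous_rbf_remainder_nine 2
  obtain ⟨R4, hR4, h4⟩ := exists_continuous_rbf_remainder_nine 4
  obtain ⟨R5, hR5, h5⟩ := exists_continuous_rbf_remainder_nine 5
  obtain ⟨R8, hR8, h8⟩ := exists_continuous_rbf_remainder_nine 8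
  fin_cases j
  · refine ⟨fun s =>
      -120 + 608 / 3 * s - 710 / 3 * s ^ 2 + 1084 / 5 * s ^ 3 - 1477 / 9 * s ^ 4 + 33272 / 315 *
      s ^ 5 - 16511 / 315 * s ^ 6 + (16 * s ^ 6 - 16 * s ^ 7) * R1 s + (-8 * s ^ 6 + 16 * s ^ 7)
      * R2 s + (-4 * s ^ 6 + 16 * s ^ 7) * R4 s, by fun_prop, fun s => ?_⟩
    simp [-mul_eq_mul_left_iff, -mul_eq_mul_right_iff, Matrix.mul_apply, Fin.sum_univ_three,
      nineRowOps, nineMatrix, nineOrders, nineLeading,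
      edgeEdge, edgeCorner, cornerCorner, rbfLap, rbfBilap]
    simp only [rbf_zero, h1, h2, h4, h5, h8]
    ring
  · refine ⟨fun s =>
      -288 + 1984 / 3 * s - 1040 * s ^ 2 + 6248 / 5 * s ^ 3 - 6076 / 5 * s ^ 4 + 312496 / 315 * s
      ^ 5 - 65104 / 105 * s ^ 6 + (8 * s ^ 6 - 8 * s ^ 7) * R1 s + (-8 * s ^ 6 + 40 * s ^ 7) * R5
      s, by fun_prop, fun s => ?_⟩
    simp [-mul_eq_mul_left_iff, -mul_eq_mul_right_iff, Matrix.mul_apply, Fin.sum_univ_three,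
      nineRowOps, nineMatrix, nineOrders, nineLeading,
      edgeEdge, edgeCorner, cornerCorner, rbfLap, rbfBilap]
    simp only [rbf_zero, h1, h2, h4, h5, h8]
    ring
  · refine ⟨fun s =>
      -768 + 2304 * s - 12800 / 3 * s ^ 2 + 5760 * s ^ 3 - 30464 / 5 * s ^ 4 + 78848 / 15 * s ^ 5
      - 26624 / 7 * s ^ 6 + 242176 / 105 * s ^ 7 - 263168 / 315 * s ^ 8 + (64 * s ^ 7 - 256 * s ^
      8 + 128 * s ^ 9) * R2 s + (32 * s ^ 7 - 256 * s ^ 8 + 256 * s ^ 9) * R4 s, by fun_prop, fun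
      s => ?_⟩
    simp [-mul_eq_mul_left_iff, -mul_eq_mul_right_iff, Matrix.mul_apply, Fin.sum_univ_three,
      nineRowOps, nineMatrix, nineOrders, nineLeading,
      edgeEdge, edgeCorner, cornerCorner, rbfLap, rbfBilap]
    simp only [rbf_zero, h1, h2, h4, h5, h8]
    ring

/-- Four extra powers of s match the four coefficients in each entry of `nineTaylor`: as the leading
matrix is invertible, divisibility in all rows determines those coefficients recursively. -/
theorem nineRowOps_residual_row0 : ∃ g : ℝ → ℝ, Continuous g ∧ ∀ s,
    (nineRowOps s).mulVec ((nineMatrix s).mulVec (nineTaylor s) - nineRhs s) 0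
      = s ^ (nineOrders 0 + 4) * g s := by
  obtain ⟨R1, hR1, h1⟩ := exists_continuous_rbf_remainder_nine 1
  obtain ⟨R2, hR2, h2⟩ := exists_continuous_rbf_remainder_nine 2
  obtain ⟨R4, hR4, h4⟩ := exists_continuous_rbf_remainder_nine 4
  obtain ⟨R5, hR5, h5⟩ := exists_continuous_rbf_remainder_nine 5
  obtain ⟨R8, hR8, h8⟩ := exists_continuous_rbf_remainder_nine 8
  refine ⟨fun s =>
      68871637 / 226800 - 50975087 / 90720 * s + 96459583 / 54432 * s ^ 2 - 911090623 / 226800 *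
      s ^ 3 - 65405071 / 170100 * s ^ 4 - 1029931639 / 302400 * s ^ 5 + 9908723 / 4725 * s ^ 6 -
      191722 / 525 * s ^ 7 + (136 - 17 / 3 * s - 4721 / 36 * s ^ 2 - 385427 / 1080 * s ^ 3 +
      262613 / 720 * s ^ 4 + 1397 / 1440 * s ^ 5 + 9209 / 160 * s ^ 6) * R1 s + (-16 + 50 / 3 * s
      + 7709 / 90 * s ^ 2 + 143077 / 540 * s ^ 3 + 77317 / 270 * s ^ 4 + 137569 / 1080 * s ^ 5 -
      543 / 8 * s ^ 6 - 4181 / 15 * s ^ 7 + 1119 / 20 * s ^ 8) * R2 s + (-16 - 46 / 3 * s + 5663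
      / 90 * s ^ 2 + 36949 / 135 * s ^ 3 + 131203 / 540 * s ^ 4 - 245143 / 2160 * s ^ 5 - 6993 /
      16 * s ^ 6 - 13367 / 30 * s ^ 7 + 1119 / 10 * s ^ 8) * R4 s + (-8 - 95 / 3 * s - 5323 / 180
      * s ^ 2 + 129307 / 1080 * s ^ 3 + 724769 / 2160 * s ^ 4 + 288941 / 864 * s ^ 5 + 8045 / 96
      * s ^ 6) * R5 s, by fun_prop, fun s => ?_⟩
  simp [Matrix.mulVec, dotProduct, Fin.sum_univ_three,
    nineRowOps, nineMatrix, nineOrders,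
    nineRhs, nineTaylor,
    edgeEdge, edgeCorner, cornerCorner, rbfLap, rbfBilap]
  simp only [rbf_zero, h1, h2, h4, h5, h8]
  ring

theorem nineRowOps_residual_row1 : ∃ g : ℝ → ℝ, Continuous g ∧ ∀ s,
    (nineRowOps s).mulVec ((nineMatrix s).mulVec (nineTaylor s) - nineRhs s) 1
      = s ^ (nineOrders 1 + 4) * g s := by
  obtain ⟨R1, hR1, h1⟩ := exists_continuous_rbf_remainder_nine 1
  obtain ⟨R2, hR2, h2⟩ := exists_continuous_rbf_remainder_nine 2
  obtain ⟨R4, hR4, h4⟩ := exists_continuous_rbf_remainder_nine 4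
  obtain ⟨R5, hR5, h5⟩ := exists_continuous_rbf_remainder_nine 5
  obtain ⟨R8, hR8, h8⟩ := exists_continuous_rbf_remainder_nine 8
  refine ⟨fun s =>
      -163657 / 720 - 229484669 / 604800 * s - 281385877 / 1209600 * s ^ 2 + 77032937 / 403200 *
      s ^ 3 - 10266899 / 1209600 * s ^ 4 - 6158603 / 806400 * s ^ 5 + (30 - 179 / 4 * s - 169 /
      120 * s ^ 2 - 259 / 576 * s ^ 3 + 4531 / 1152 * s ^ 4 + 253 / 20 * s ^ 5 - 373 / 160 * s ^
      6) * R1 s + (-16 + 47 / 3 * s + 227 / 360 * s ^ 2 - 10273 / 4320 * s ^ 3 - 2713 / 2880 * s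
      ^ 4 - 11771 / 960 * s ^ 5 + 373 / 160 * s ^ 6) * R2 s + (-3 + 49 / 8 * s + 1337 / 96 * s ^
      2 + 21341 / 2880 * s ^ 3 + 901 / 1440 * s ^ 4 - 22423 / 1920 * s ^ 5 + 373 / 160 * s ^ 6) *
      R4 s + (2 - 55 / 12 * s - 5437 / 360 * s ^ 2 - 25543 / 1728 * s ^ 3 - 73111 / 5760 * s ^ 4
      + 373 / 96 * s ^ 5) * R5 s + (1 / 2 + 71 / 48 * s + 5023 / 2880 * s ^ 2 + 1609 / 3456 * s ^
      3) * R8 s, by fun_prop, fun s => ?_⟩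
  simp [Matrix.mulVec, dotProduct, Fin.sum_univ_three,
    nineRowOps, nineMatrix, nineOrders,
    nineRhs, nineTaylor,
    edgeEdge, edgeCorner, cornerCorner, rbfLap, rbfBilap]
  simp only [rbf_zero, h1, h2, h4, h5, h8]
  ring

theorem nineRowOps_residual_row2 : ∃ g : ℝ → ℝ, Continuous g ∧ ∀ s,
    (nineRowOps s).mulVec ((nineMatrix s).mulVec (nineTaylor s) - nineRhs s) 2
      = s ^ (nineOrders 2 + 4) * g s := by
  obtain ⟨R1, hR1, h1⟩ := exists_continuous_rbf_remainder_nine 1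
  obtain ⟨R2, hR2, h2⟩ := exists_continuous_rbf_remainder_nine 2
  obtain ⟨R4, hR4, h4⟩ := exists_continuous_rbf_remainder_nine 4
  obtain ⟨R5, hR5, h5⟩ := exists_continuous_rbf_remainder_nine 5
  obtain ⟨R8, hR8, h8⟩ := exists_continuous_rbf_remainder_nine 8
  refine ⟨fun s =>
      -3739 / 180 + 202897 / 2160 * s - 101923153 / 453600 * s ^ 2 + 24927397 / 64800 * s ^ 3 -
      24179249 / 48600 * s ^ 4 + 77352553 / 453600 * s ^ 5 - 1333593463 / 2721600 * s ^ 6 +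
      395393 / 1575 * s ^ 7 - 191722 / 4725 * s ^ 8 + (18 * s ^ 3 - 211 / 4 * s ^ 4 + 11633 / 240
      * s ^ 5 - 5927 / 1440 * s ^ 6 + 9209 / 1440 * s ^ 7) * R1 s + (-8 * s ^ 3 + 37 / 3 * s ^ 4
      + 3773 / 180 * s ^ 5 + 13201 / 1080 * s ^ 6 + 8047 / 1080 * s ^ 7 - 506 / 15 * s ^ 8 + 373
      / 60 * s ^ 9) * R2 s + (-4 * s ^ 3 + 85 / 6 * s ^ 4 + 7973 / 360 * s ^ 5 - 223 / 432 * s ^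
      6 - 52063 / 2160 * s ^ 7 - 1651 / 30 * s ^ 8 + 373 / 30 * s ^ 9) * R4 s + (-2 * s ^ 3 + 49
      / 12 * s ^ 4 + 16277 / 720 * s ^ 5 + 28529 / 864 * s ^ 6 + 8045 / 864 * s ^ 7) * R5 s, by
      fun_prop, fun s => ?_⟩
  simp [Matrix.mulVec, dotProduct, Fin.sum_univ_three,
    nineRowOps, nineMatrix, nineOrders,
    nineRhs, nineTaylor,
    edgeEdge, edgeCorner, cornerCorner, rbfLap, rbfBilap]
  simp only [rbf_zero, h1, h2, h4, h5, h8]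
  ring

/-- Row operations that regularise `thirteenMatrix` at `s = 0`. -/
def thirteenRowOps (s : ℝ) : Matrix (Fin 4) (Fin 4) ℝ :=
    !![-16, 0, 4 * s + 9 * s ^ 2, 0;
      -192 + 4896 * s, 12, 72 * s - 2030 * s ^ 2 - 168 * s ^ 3 - 4779 * s ^ 4,
        -36 * s + 806 * s ^ 2;
      0, 0, 1, 0;
      0, 0, -1 + 3 * s, 1]

/-- The orders at `s = 0` of the rows of `thirteenRowOps * thirteenMatrix`. -/
def thirteenOrders : Fin 4 → ℕ := ![4, 6, 1, 3]

/-- The leading coefficients of `thirteenRowOps * thirteenMatrix`. -/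
def thirteenLeading : Matrix (Fin 4) (Fin 4) ℝ :=
    !![-1192, -1024, -2816 / 3, 640 / 3;
      485344 / 5, 2634176 / 15, -6276928 / 15, -25181248 / 15;
      96, 128, 128, 128;
      120, 384, 384, 768]

/-- The Taylor polynomials of the scaled weights. -/
def thirteenTaylor (s : ℝ) : Fin 4 → ℝ :=
    ![12 / 23 - 17646 / 208955 * s + 3697010966 / 13288493225 * s ^ 2 + 1329393861667 /
        724355765694750 * s ^ 3,
      9 / 92 - 26469 / 1671640 * s - 24912958377 / 212615891600 * s ^ 2 + 4535043666647521 /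
        1931615375186000 * s ^ 3,
      -5 / 23 + 97053 / 835820 * s + 19096725789 / 106307945800 * s ^ 2 - 2108622124065179 /
        724355765694750 * s ^ 3,
      -1 / 46 - 61761 / 1671640 * s - 8234946399 / 30373698800 * s ^ 2 - 828029839457483 /
        5794846125558000 * s ^ 3]

theorem thirteenRowOps_mul_row0 (j : Fin 4) : ∃ g : ℝ → ℝ, Continuous g ∧ ∀ s,
    (thirteenRowOps s * thirteenMatrix s) 0 j =
      s ^ thirteenOrders 0 * (thirteenLeading 0 j + s * g s) := by
  obtain ⟨R1, hR1, h1⟩ := exists_continuous_rbf_remainder_thirteen 1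
  obtain ⟨R2, hR2, h2⟩ := exists_continuous_rbf_remainder_thirteen 2
  obtain ⟨R4, hR4, h4⟩ := exists_continuous_rbf_remainder_thirteen 4
  obtain ⟨R5, hR5, h5⟩ := exists_continuous_rbf_remainder_thirteen 5
  obtain ⟨R8, hR8, h8⟩ := exists_continuous_rbf_remainder_thirteen 8
  obtain ⟨R9, hR9, h9⟩ := exists_continuous_rbf_remainder_thirteen 9
  obtain ⟨R10, hR10, h10⟩ := exists_continuous_rbf_remainder_thirteen 10
  obtain ⟨R16, hR16, h16⟩ := exists_continuous_rbf_remainder_thirteen 16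
  fin_cases j
  · refine ⟨fun s =>
      10888 / 3 - 32034 / 5 * s + 74048 / 9 * s ^ 2 - 292562 / 35 * s ^ 3 + 633311 / 90 * s ^ 4 -
      12524983 / 2520 * s ^ 5 + 36614951 / 11340 * s ^ 6 - 5145467 / 2520 * s ^ 7 + (160 * s ^ 5
      + 96 * s ^ 6 + 120 * s ^ 7 - 216 * s ^ 8) * R1 s + (32 * s ^ 5 - 32 * s ^ 6 - 8 * s ^ 7 +
      144 * s ^ 8) * R2 s + (-16 * s ^ 5 - 16 * s ^ 6 + 28 * s ^ 7 + 144 * s ^ 8) * R4 s + (-32 *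
      s ^ 5 - 32 * s ^ 6 + 88 * s ^ 7 + 360 * s ^ 8) * R5 s, by fun_prop, fun s => ?_⟩
    simp [-mul_eq_mul_left_iff, -mul_eq_mul_right_iff, Matrix.mul_apply, Fin.sum_univ_four,
      thirteenRowOps, thirteenMatrix, thirteenOrders, thirteenLeading,
      edgeEdge, edgeCorner, cornerCorner, edgeFar, farFar, farCorner, rbfLap, rbfBilap]
    simp only [rbf_zero, h1, h2, h4, h5, h8, h9, h10, h16]
    ring
  · refine ⟨fun s =>
      16672 / 3 - 830848 / 45 * s + 409280 / 9 * s ^ 2 - 9322784 / 105 * s ^ 3 + 6431422 / 45 * s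
      ^ 4 - 509297476 / 2835 * s ^ 5 + 662316989 / 2835 * s ^ 6 - 109572364 / 315 * s ^ 7 + (48 *
      s ^ 5 + 48 * s ^ 6 + 60 * s ^ 7 - 108 * s ^ 8) * R1 s + (64 * s ^ 5) * R4 s + (-32 * s ^ 5
      - 32 * s ^ 6 + 88 * s ^ 7 + 360 * s ^ 8) * R5 s + (-16 * s ^ 5 - 16 * s ^ 6 + 108 * s ^ 7 +
      324 * s ^ 8) * R9 s, by fun_prop, fun s => ?_⟩
    simp [-mul_eq_mul_left_iff, -mul_eq_mul_right_iff, Matrix.mul_apply, Fin.sum_univ_four,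
      thirteenRowOps, thirteenMatrix, thirteenOrders, thirteenLeading,
      edgeEdge, edgeCorner, cornerCorner, edgeFar, farFar, farCorner, rbfLap, rbfBilap]
    simp only [rbf_zero, h1, h2, h4, h5, h8, h9, h10, h16]
    ring
  · refine ⟨fun s =>
      7456 - 94144 / 5 * s + 1354256 / 45 * s ^ 2 - 11182208 / 315 * s ^ 3 + 231270 / 7 * s ^ 4 -
      14322172 / 567 * s ^ 5 + 1321066 / 81 * s ^ 6 - 2859776 / 315 * s ^ 7 + 1895168 / 405 * s ^
      8 - 104960 / 63 * s ^ 9 + (-256 * s ^ 6 + 256 * s ^ 7) * R1 s + (128 * s ^ 6 - 448 * s ^ 8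
      - 1792 * s ^ 9 + 1152 * s ^ 10) * R2 s + (64 * s ^ 6 - 128 * s ^ 7 - 736 * s ^ 8 - 1280 * s
      ^ 9 + 2304 * s ^ 10) * R4 s, by fun_prop, fun s => ?_⟩
    simp [-mul_eq_mul_left_iff, -mul_eq_mul_right_iff, Matrix.mul_apply, Fin.sum_univ_four,
      thirteenRowOps, thirteenMatrix, thirteenOrders, thirteenLeading,
      edgeEdge, edgeCorner, cornerCorner, edgeFar, farFar, farCorner, rbfLap, rbfBilap]
    simp only [rbf_zero, h1, h2, h4, h5, h8, h9, h10, h16]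
    ring
  · refine ⟨fun s =>
      7008 - 201984 / 5 * s + 523008 / 5 * s ^ 2 - 18412432 / 105 * s ^ 3 + 7640834 / 35 * s ^ 4
      - 614375624 / 2835 * s ^ 5 + 18771689 / 105 * s ^ 6 - 356445547 / 2835 * s ^ 7 + 157877623
      / 1890 * s ^ 8 - 8138021 / 210 * s ^ 9 + (128 * s ^ 6 + 128 * s ^ 7 + 64 * s ^ 8 - 1024 * s
      ^ 9 + 288 * s ^ 10) * R1 s + (-256 * s ^ 6 + 512 * s ^ 7) * R2 s + (128 * s ^ 6 - 384 * s ^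
      7 - 1984 * s ^ 8 - 2560 * s ^ 9 + 7200 * s ^ 10) * R5 s, by fun_prop, fun s => ?_⟩
    simp [-mul_eq_mul_left_iff, -mul_eq_mul_right_iff, Matrix.mul_apply, Fin.sum_univ_four,
      thirteenRowOps, thirteenMatrix, thirteenOrders, thirteenLeading,
      edgeEdge, edgeCorner, cornerCorner, edgeFar, farFar, farCorner, rbfLap, rbfBilap]
    simp only [rbf_zero, h1, h2, h4, h5, h8, h9, h10, h16]
    ring

/-- This is the most degenerate direction: all four rows of the system are combined, with
multipliers up to degree four in s, to cancel everything below s⁶. -/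
theorem thirteenRowOps_mul_row1 (j : Fin 4) : ∃ g : ℝ → ℝ, Continuous g ∧ ∀ s,
    (thirteenRowOps s * thirteenMatrix s) 1 j =
      s ^ thirteenOrders 1 * (thirteenLeading 1 j + s * g s) := by
  obtain ⟨R1, hR1, h1⟩ := exists_continuous_rbf_remainder_thirteen 1
  obtain ⟨R2, hR2, h2⟩ := exists_continuous_rbf_remainder_thirteen 2
  obtain ⟨R4, hR4, h4⟩ := exists_continuous_rbf_remainder_thirteen 4
  obtain ⟨R5, hR5, h5⟩ := exists_continuous_rbf_remainder_thirteen 5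
  obtain ⟨R8, hR8, h8⟩ := exists_continuous_rbf_remainder_thirteen 8
  obtain ⟨R9, hR9, h9⟩ := exists_continuous_rbf_remainder_thirteen 9
  obtain ⟨R10, hR10, h10⟩ := exists_continuous_rbf_remainder_thirteen 10
  obtain ⟨R16, hR16, h16⟩ := exists_continuous_rbf_remainder_thirteen 16
  fin_cases j
  · refine ⟨fun s =>
      983184 / 5 - 46360014 / 35 * s + 9689054 / 3 * s ^ 2 - 375126733 / 70 * s ^ 3 + 842243851 /
      126 * s ^ 4 - 43341611269 / 7560 * s ^ 5 - 8158268569 / 3780 * s ^ 6 + 303582553 / 280 * s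
      ^ 7 + (1884 * s ^ 3 - 46944 * s ^ 4 - 57184 * s ^ 5 + 51136 * s ^ 6 - 110664 * s ^ 7 +
      114696 * s ^ 8) * R1 s + (360 * s ^ 3 - 11520 * s ^ 4 + 45488 * s ^ 5 - 82720 * s ^ 6 +
      35544 * s ^ 7 - 76464 * s ^ 8) * R2 s + (-288 * s ^ 3 + 4896 * s ^ 4 + 1672 * s ^ 5 - 6016
      * s ^ 6 + 16428 * s ^ 7 - 76464 * s ^ 8) * R4 s + (-360 * s ^ 3 + 9504 * s ^ 4 + 11232 * s
      ^ 5 - 47616 * s ^ 6 + 31512 * s ^ 7 - 191160 * s ^ 8) * R5 s + (144 * s ^ 4 - 4376 * s ^ 5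
      + 25792 * s ^ 6) * R8 s + (12 * s ^ 3) * R9 s + (24 * s ^ 3) * R10 s, by fun_prop, fun s =>
      ?_⟩
    simp [-mul_eq_mul_left_iff, -mul_eq_mul_right_iff, Matrix.mul_apply, Fin.sum_univ_four,
      thirteenRowOps, thirteenMatrix, thirteenOrders, thirteenLeading,
      edgeEdge, edgeCorner, cornerCorner, edgeFar, farFar, farCorner, rbfLap, rbfBilap]
    simp only [rbf_zero, h1, h2, h4, h5, h8, h9, h10, h16]
    ring
  · refine ⟨fun s =>
      -5747488 / 5 + 1471173664 / 315 * s - 198306008 / 15 * s ^ 2 + 1557401764 / 63 * s ^ 3 -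
      5041880146 / 105 * s ^ 4 + 45663475528 / 567 * s ^ 5 - 188671288381 / 945 * s ^ 6 +
      6464769476 / 35 * s ^ 7 + (576 * s ^ 3 - 13824 * s ^ 4 - 25224 * s ^ 5 + 22344 * s ^ 6 -
      55332 * s ^ 7 + 57348 * s ^ 8) * R1 s + (-288 * s ^ 4 + 7024 * s ^ 5 - 12896 * s ^ 6) * R2
      s + (672 * s ^ 3 - 19584 * s ^ 4) * R4 s + (-384 * s ^ 3 + 9216 * s ^ 4 + 19120 * s ^ 5 -
      79856 * s ^ 6 + 31512 * s ^ 7 - 191160 * s ^ 8) * R5 s + (24 * s ^ 3) * R8 s + (-192 * s ^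
      3 + 4608 * s ^ 4 + 10712 * s ^ 5 - 72408 * s ^ 6 + 13068 * s ^ 7 - 172044 * s ^ 8) * R9 s +
      (288 * s ^ 4 - 9328 * s ^ 5 + 64480 * s ^ 6) * R10 s + (12 * s ^ 3) * R16 s, by fun_prop,
      fun s => ?_⟩
    simp [-mul_eq_mul_left_iff, -mul_eq_mul_right_iff, Matrix.mul_apply, Fin.sum_univ_four,
      thirteenRowOps, thirteenMatrix, thirteenOrders, thirteenLeading,
      edgeEdge, edgeCorner, cornerCorner, edgeFar, farFar, farCorner, rbfLap, rbfBilap]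
    simp only [rbf_zero, h1, h2, h4, h5, h8, h9, h10, h16]
    ring
  · refine ⟨fun s =>
      -152480 + 73605376 / 35 * s - 299690968 / 63 * s ^ 2 + 2065767932 / 315 * s ^ 3 - 683653498
      / 105 * s ^ 4 + 1897340188 / 405 * s ^ 5 - 8833996439 / 2835 * s ^ 6 + 8232754499 / 2835 *
      s ^ 7 - 2690282752 / 945 * s ^ 8 + 6192640 / 7 * s ^ 9 + (-2928 * s ^ 4 + 78960 * s ^ 5 -
      22144 * s ^ 6 - 104320 * s ^ 7 + 25792 * s ^ 8) * R1 s + (1536 * s ^ 4 - 37632 * s ^ 5 -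
      70016 * s ^ 6 + 518144 * s ^ 7 - 522688 * s ^ 8 + 1201920 * s ^ 9 - 611712 * s ^ 10) * R2 s
      + (768 * s ^ 4 - 20352 * s ^ 5 - 5056 * s ^ 6 + 532736 * s ^ 7 - 629600 * s ^ 8 + 1180416 *
      s ^ 9 - 1223424 * s ^ 10) * R4 s + (-96 * s ^ 4 - 1824 * s ^ 5 + 74624 * s ^ 6 - 544640 * s
      ^ 7 + 644800 * s ^ 8) * R5 s + (-48 * s ^ 4 + 432 * s ^ 5) * R9 s, by fun_prop, fun s =>
      ?_⟩
    simp [-mul_eq_mul_left_iff, -mul_eq_mul_right_iff, Matrix.mul_apply, Fin.sum_univ_four,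
      thirteenRowOps, thirteenMatrix, thirteenOrders, thirteenLeading,
      edgeEdge, edgeCorner, cornerCorner, edgeFar, farFar, farCorner, rbfLap, rbfBilap]
    simp only [rbf_zero, h1, h2, h4, h5, h8, h9, h10, h16]
    ring
  · refine ⟨fun s =>
      58218976 / 5 - 1397490432 / 35 * s + 30304943048 / 315 * s ^ 2 - 56600633116 / 315 * s ^ 3
      + 12234587006 / 45 * s ^ 4 - 977293364786 / 2835 * s ^ 5 + 1013461036598 / 2835 * s ^ 6 -
      590148118516 / 2835 * s ^ 7 - 33250328963 / 630 * s ^ 8 + 1440429717 / 70 * s ^ 9 + (1536 *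
      s ^ 4 - 36096 * s ^ 5 - 99968 * s ^ 6 + 251392 * s ^ 7 - 349312 * s ^ 8 + 606336 * s ^ 9 -
      152928 * s ^ 10) * R1 s + (-2976 * s ^ 4 + 84288 * s ^ 5 - 156672 * s ^ 6) * R2 s + (-2304
      * s ^ 5 + 70016 * s ^ 6 - 431104 * s ^ 7 + 412672 * s ^ 8) * R4 s + (1536 * s ^ 4 - 42240 *
      s ^ 5 + 19840 * s ^ 6 + 1346048 * s ^ 7 - 1822336 * s ^ 8 + 2924160 * s ^ 9 - 3823200 * s ^
      10) * R5 s + (-1152 * s ^ 5 + 44224 * s ^ 6 - 449536 * s ^ 7 + 825344 * s ^ 8) * R8 s +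
      (-96 * s ^ 4 + 960 * s ^ 5) * R10 s, by fun_prop, fun s => ?_⟩
    simp [-mul_eq_mul_left_iff, -mul_eq_mul_right_iff, Matrix.mul_apply, Fin.sum_univ_four,
      thirteenRowOps, thirteenMatrix, thirteenOrders, thirteenLeading,
      edgeEdge, edgeCorner, cornerCorner, edgeFar, farFar, farCorner, rbfLap, rbfBilap]
    simp only [rbf_zero, h1, h2, h4, h5, h8, h9, h10, h16]
    ring

theorem thirteenRowOps_mul_row2 (j : Fin 4) : ∃ g : ℝ → ℝ, Continuous g ∧ ∀ s,
    (thirteenRowOps s * thirteenMatrix s) 2 j =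
      s ^ thirteenOrders 2 * (thirteenLeading 2 j + s * g s) := by
  obtain ⟨R1, hR1, h1⟩ := exists_continuous_rbf_remainder_thirteen 1
  obtain ⟨R2, hR2, h2⟩ := exists_continuous_rbf_remainder_thirteen 2
  obtain ⟨R4, hR4, h4⟩ := exists_continuous_rbf_remainder_thirteen 4
  obtain ⟨R5, hR5, h5⟩ := exists_continuous_rbf_remainder_thirteen 5
  obtain ⟨R8, hR8, h8⟩ := exists_continuous_rbf_remainder_thirteen 8
  obtain ⟨R9, hR9, h9⟩ := exists_continuous_rbf_remainder_thirteen 9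
  obtain ⟨R10, hR10, h10⟩ := exists_continuous_rbf_remainder_thirteen 10
  obtain ⟨R16, hR16, h16⟩ := exists_continuous_rbf_remainder_thirteen 16
  fin_cases j
  · refine ⟨fun s =>
      -408 + 864 * s - 3830 / 3 * s ^ 2 + 7332 / 5 * s ^ 3 - 62069 / 45 * s ^ 4 + 115256 / 105 *
      s ^ 5 - 211823 / 280 * s ^ 6 + 115817 / 252 * s ^ 7 - 5145467 / 22680 * s ^ 8 + (24 * s ^ 8
      - 24 * s ^ 9) * R1 s + (-8 * s ^ 8 + 16 * s ^ 9) * R2 s + (-4 * s ^ 8 + 16 * s ^ 9) * R4 s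
      + (-8 * s ^ 8 + 40 * s ^ 9) * R5 s, by fun_prop, fun s => ?_⟩
    simp [-mul_eq_mul_left_iff, -mul_eq_mul_right_iff, Matrix.mul_apply, Fin.sum_univ_four,
      thirteenRowOps, thirteenMatrix, thirteenOrders, thirteenLeading,
      edgeEdge, edgeCorner, cornerCorner, edgeFar, farFar, farCorner, rbfLap, rbfBilap]
    simp only [rbf_zero, h1, h2, h4, h5, h8, h9, h10, h16]
    ring
  · refine ⟨fun s =>
      -768 + 7808 / 3 * s - 19520 / 3 * s ^ 2 + 65296 / 5 * s ^ 3 - 984704 / 45 * s ^ 4 + 9878432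
      / 315 * s ^ 5 - 1369624 / 35 * s ^ 6 + 24457921 / 567 * s ^ 7 - 109572364 / 2835 * s ^ 8 +
      (12 * s ^ 8 - 12 * s ^ 9) * R1 s + (-8 * s ^ 8 + 40 * s ^ 9) * R5 s + (-4 * s ^ 8 + 36 * s
      ^ 9) * R9 s, by fun_prop, fun s => ?_⟩
    simp [-mul_eq_mul_left_iff, -mul_eq_mul_right_iff, Matrix.mul_apply, Fin.sum_univ_four,
      thirteenRowOps, thirteenMatrix, thirteenOrders, thirteenLeading,
      edgeEdge, edgeCorner, cornerCorner, edgeFar, farFar, farCorner, rbfLap, rbfBilap]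
    simp only [rbf_zero, h1, h2, h4, h5, h8, h9, h10, h16]
    ring
  · refine ⟨fun s =>
      -768 + 2304 * s - 12800 / 3 * s ^ 2 + 5760 * s ^ 3 - 30464 / 5 * s ^ 4 + 78848 / 15 * s ^ 5
      - 26624 / 7 * s ^ 6 + 16512 / 7 * s ^ 7 - 723712 / 567 * s ^ 8 + 63232 / 105 * s ^ 9 -
      104960 / 567 * s ^ 10 + (64 * s ^ 9 - 256 * s ^ 10 + 128 * s ^ 11) * R2 s + (32 * s ^ 9 -
      256 * s ^ 10 + 256 * s ^ 11) * R4 s, by fun_prop, fun s => ?_⟩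
    simp [-mul_eq_mul_left_iff, -mul_eq_mul_right_iff, Matrix.mul_apply, Fin.sum_univ_four,
      thirteenRowOps, thirteenMatrix, thirteenOrders, thirteenLeading,
      edgeEdge, edgeCorner, cornerCorner, edgeFar, farFar, farCorner, rbfLap, rbfBilap]
    simp only [rbf_zero, h1, h2, h4, h5, h8, h9, h10, h16]
    ring
  · refine ⟨fun s =>
      -1152 + 4992 * s - 13440 * s ^ 2 + 25040 * s ^ 3 - 175056 / 5 * s ^ 4 + 1750112 / 45 * s ^
      5 - 1250016 / 35 * s ^ 6 + 195313 / 7 * s ^ 7 - 56837 / 3 * s ^ 8 + 63476569 / 5670 * s ^ 9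
      - 8138021 / 1890 * s ^ 10 + (64 * s ^ 9 - 128 * s ^ 10 + 32 * s ^ 11) * R1 s + (64 * s ^ 9
      - 640 * s ^ 10 + 800 * s ^ 11) * R5 s, by fun_prop, fun s => ?_⟩
    simp [-mul_eq_mul_left_iff, -mul_eq_mul_right_iff, Matrix.mul_apply, Fin.sum_univ_four,
      thirteenRowOps, thirteenMatrix, thirteenOrders, thirteenLeading,
      edgeEdge, edgeCorner, cornerCorner, edgeFar, farFar, farCorner, rbfLap, rbfBilap]
    simp only [rbf_zero, h1, h2, h4, h5, h8, h9, h10, h16]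
    ring

/-- The two Laplacian rows, for edge and corner centres, agree at order s; the multiplier -1 + 3s
cancels the orders s and s² of their difference. -/
theorem thirteenRowOps_mul_row3 (j : Fin 4) : ∃ g : ℝ → ℝ, Continuous g ∧ ∀ s,
    (thirteenRowOps s * thirteenMatrix s) 3 j =
      s ^ thirteenOrders 3 * (thirteenLeading 3 j + s * g s) := by
  obtain ⟨R1, hR1, h1⟩ := exists_continuous_rbf_remainder_thirteen 1
  obtain ⟨R2, hR2, h2⟩ := exists_continuous_rbf_remainder_thirteen 2
  obtain ⟨R4, hR4, h4⟩ := exists_continuous_rbf_remainder_thirteen 4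
  obtain ⟨R5, hR5, h5⟩ := exists_continuous_rbf_remainder_thirteen 5
  obtain ⟨R8, hR8, h8⟩ := exists_continuous_rbf_remainder_thirteen 8
  obtain ⟨R9, hR9, h9⟩ := exists_continuous_rbf_remainder_thirteen 9
  obtain ⟨R10, hR10, h10⟩ := exists_continuous_rbf_remainder_thirteen 10
  obtain ⟨R16, hR16, h16⟩ := exists_continuous_rbf_remainder_thirteen 16
  fin_cases j
  · refine ⟨fun s =>
      -908 + 2866 * s - 5930 * s ^ 2 + 139099 / 15 * s ^ 3 - 1644001 / 140 * s ^ 4 + 31634879 /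
      2520 * s ^ 5 - 19785371 / 1890 * s ^ 6 - 5145467 / 7560 * s ^ 7 + (-32 * s ^ 6 + 104 * s ^
      7 - 72 * s ^ 8) * R1 s + (40 * s ^ 6 - 104 * s ^ 7 + 48 * s ^ 8) * R2 s + (-4 * s ^ 6 + 4 *
      s ^ 7 + 48 * s ^ 8) * R4 s + (-24 * s ^ 7 + 120 * s ^ 8) * R5 s + (-4 * s ^ 6 + 32 * s ^ 7)
      * R8 s, by fun_prop, fun s => ?_⟩
    simp [-mul_eq_mul_left_iff, -mul_eq_mul_right_iff, Matrix.mul_apply, Fin.sum_univ_four,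
      thirteenRowOps, thirteenMatrix, thirteenOrders, thirteenLeading,
      edgeEdge, edgeCorner, cornerCorner, edgeFar, farFar, farCorner, rbfLap, rbfBilap]
    simp only [rbf_zero, h1, h2, h4, h5, h8, h9, h10, h16]
    ring
  · refine ⟨fun s =>
      -6976 / 3 + 7408 * s - 150416 / 9 * s ^ 2 + 449632 / 15 * s ^ 3 - 4762648 / 105 * s ^ 4 +
      18876827 / 315 * s ^ 5 - 148558757 / 2835 * s ^ 6 - 109572364 / 945 * s ^ 7 + (-12 * s ^ 6
      + 48 * s ^ 7 - 36 * s ^ 8) * R1 s + (8 * s ^ 6 - 16 * s ^ 7) * R2 s + (8 * s ^ 6 - 64 * s ^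
      7 + 120 * s ^ 8) * R5 s + (4 * s ^ 6 - 48 * s ^ 7 + 108 * s ^ 8) * R9 s + (-8 * s ^ 6 + 80
      * s ^ 7) * R10 s, by fun_prop, fun s => ?_⟩
    simp [-mul_eq_mul_left_iff, -mul_eq_mul_right_iff, Matrix.mul_apply, Fin.sum_univ_four,
      thirteenRowOps, thirteenMatrix, thirteenOrders, thirteenLeading,
      edgeEdge, edgeCorner, cornerCorner, edgeFar, farFar, farCorner, rbfLap, rbfBilap]
    simp only [rbf_zero, h1, h2, h4, h5, h8, h9, h10, h16]
    ring
  · refine ⟨fun s =>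
      -6784 / 3 + 6480 * s - 58192 / 5 * s ^ 2 + 138208 / 9 * s ^ 3 - 112992 / 7 * s ^ 4 + 98929
      / 7 * s ^ 5 - 6006065 / 567 * s ^ 6 + 38350681 / 5670 * s ^ 7 - 13120879 / 5670 * s ^ 8 -
      104960 / 189 * s ^ 9 + (64 * s ^ 7 - 128 * s ^ 8 + 32 * s ^ 9) * R1 s + (-64 * s ^ 7 + 448
      * s ^ 8 - 896 * s ^ 9 + 384 * s ^ 10) * R2 s + (-32 * s ^ 7 + 352 * s ^ 8 - 1024 * s ^ 9 +
      768 * s ^ 10) * R4 s + (64 * s ^ 7 - 640 * s ^ 8 + 800 * s ^ 9) * R5 s, by fun_prop, fun s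
      => ?_⟩
    simp [-mul_eq_mul_left_iff, -mul_eq_mul_right_iff, Matrix.mul_apply, Fin.sum_univ_four,
      thirteenRowOps, thirteenMatrix, thirteenOrders, thirteenLeading,
      edgeEdge, edgeCorner, cornerCorner, edgeFar, farFar, farCorner, rbfLap, rbfBilap]
    simp only [rbf_zero, h1, h2, h4, h5, h8, h9, h10, h16]
    ring
  · refine ⟨fun s =>
      -17152 / 3 + 26800 * s - 424192 / 5 * s ^ 2 + 8662192 / 45 * s ^ 3 - 35117248 / 105 * s ^ 4
      + 16408747 / 35 * s ^ 5 - 312337292 / 567 * s ^ 6 + 3110734313 / 5670 * s ^ 7 - 193473703 /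
      567 * s ^ 8 - 8138021 / 630 * s ^ 9 + (-64 * s ^ 7 + 320 * s ^ 8 - 416 * s ^ 9 + 96 * s ^
      10) * R1 s + (64 * s ^ 7 - 512 * s ^ 8 + 512 * s ^ 9) * R4 s + (-64 * s ^ 7 + 832 * s ^ 8 -
      2720 * s ^ 9 + 2400 * s ^ 10) * R5 s + (32 * s ^ 7 - 512 * s ^ 8 + 1024 * s ^ 9) * R8 s, by
      fun_prop, fun s => ?_⟩
    simp [-mul_eq_mul_left_iff, -mul_eq_mul_right_iff, Matrix.mul_apply, Fin.sum_univ_four,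
      thirteenRowOps, thirteenMatrix, thirteenOrders, thirteenLeading,
      edgeEdge, edgeCorner, cornerCorner, edgeFar, farFar, farCorner, rbfLap, rbfBilap]
    simp only [rbf_zero, h1, h2, h4, h5, h8, h9, h10, h16]
    ring

/-- As for the nine-point formula, the four residual identities together say that `thirteenTaylor`
solves the regularised system up to s⁴. -/
theorem thirteenRowOps_residual_row0 : ∃ g : ℝ → ℝ, Continuous g ∧ ∀ s,
    (thirteenRowOps s).mulVec ((thirteenMatrix s).mulVec (thirteenTaylor s) - thirteenRhs s) 0
      = s ^ (thirteenOrders 0 + 4) * g s := by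
  obtain ⟨R1, hR1, h1⟩ := exists_continuous_rbf_remainder_thirteen 1
  obtain ⟨R2, hR2, h2⟩ := exists_continuous_rbf_remainder_thirteen 2
  obtain ⟨R4, hR4, h4⟩ := exists_continuous_rbf_remainder_thirteen 4
  obtain ⟨R5, hR5, h5⟩ := exists_continuous_rbf_remainder_thirteen 5
  obtain ⟨R8, hR8, h8⟩ := exists_continuous_rbf_remainder_thirteen 8
  obtain ⟨R9, hR9, h9⟩ := exists_continuous_rbf_remainder_thirteen 9
  obtain ⟨R10, hR10, h10⟩ := exists_continuous_rbf_remainder_thirteen 10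
  obtain ⟨R16, hR16, h16⟩ := exists_continuous_rbf_remainder_thirteen 16
  refine ⟨fun s =>
      -234219950354880088 / 47240593414875 + 1535645833499636111 / 1086533648542125 * s +
      923437911006151750057 / 25352451799316250 * s ^ 2 - 11196370090800154354757 /
      91268826477538500 * s ^ 3 + 2376295740785210955542 / 9778802836879125 * s ^ 4 -
      419322254287168170312931 / 1095225917730462000 * s ^ 5 + 4491429003346584824185411 /
      8214194382978465000 * s ^ 6 - 5210147263496159908790281 / 6571355506382772000 * s ^ 7 -
      252187894663529251324943 / 16428388765956930000 * s ^ 8 + 37921250917745370810629 /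
      3650753059101540000 * s ^ 9 + (2028 / 23 * s ^ 2 + 6139166 / 208955 * s ^ 3 - 775905244956
      / 13288493225 * s ^ 4 - 64726671921033197 / 724355765694750 * s ^ 5 + 690209661647336339 /
      482903843796500 * s ^ 6 - 579226956664445647 / 724355765694750 * s ^ 7 + 5626288480741567 /
      1448711531389500 * s ^ 8 + 24714033248081042 / 362177882847375 * s ^ 9 - 4968179036744898 /
      120725960949125 * s ^ 10) * R1 s + (384 / 23 * s ^ 2 - 8704832 / 208955 * s ^ 3 +
      274035786912 / 13288493225 * s ^ 4 + 86139345909907072 / 362177882847375 * s ^ 5 -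
      10991821451614784 / 72435576569475 * s ^ 6 - 207204075236279924 / 362177882847375 * s ^ 7 +
      80857336936310168 / 72435576569475 * s ^ 8 + 1964274724801004464 / 362177882847375 * s ^ 9
      - 404855447820514368 / 120725960949125 * s ^ 10) * R2 s + (-48 / 23 * s ^ 2 - 4580936 /
      208955 * s ^ 3 + 521798838716 / 13288493225 * s ^ 4 + 135881149639257796 / 362177882847375
      * s ^ 5 - 2523266463073848 / 120725960949125 * s ^ 6 - 133638455629347626 / 362177882847375
      * s ^ 7 + 789686486357055496 / 362177882847375 * s ^ 8 + 299883352535784544 /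
      72435576569475 * s ^ 9 - 809710895641028736 / 120725960949125 * s ^ 10) * R4 s + (-456 / 23
      * s ^ 2 - 4053652 / 208955 * s ^ 3 + 746763804632 / 13288493225 * s ^ 4 + 56677736852553167
      / 362177882847375 * s ^ 5 + 85224339518607941 / 724355765694750 * s ^ 6 +
      288140164642800959 / 362177882847375 * s ^ 7 + 1128125653855795039 / 724355765694750 * s ^
      8 - 114902427523349894 / 72435576569475 * s ^ 9 - 4968179036744898 / 4829038437965 * s ^
      10) * R5 s + (-36 / 23 * s ^ 2 - 274122 / 208955 * s ^ 3 + 168675370212 / 13288493225 * s ^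
      4 - 1377346852186427 / 241451921898250 * s ^ 5 - 26728623426543649 / 482903843796500 * s ^
      6 + 52056553312112211 / 241451921898250 * s ^ 7 + 367338536998449201 / 482903843796500 * s
      ^ 8) * R9 s, by fun_prop, fun s => ?_⟩
  simp [Matrix.mulVec, dotProduct, Fin.sum_univ_four,
    thirteenRowOps, thirteenMatrix, thirteenOrders,
    thirteenRhs, thirteenTaylor,
    edgeEdge, edgeCorner, cornerCorner, edgeFar, farFar, farCorner, rbfLap, rbfBilap]
  simp only [rbf_zero, h1, h2, h4, h5, h8, h9, h10, h16]
  ring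

theorem thirteenRowOps_residual_row1 : ∃ g : ℝ → ℝ, Continuous g ∧ ∀ s,
    (thirteenRowOps s).mulVec ((thirteenMatrix s).mulVec (thirteenTaylor s) - thirteenRhs s) 1
      = s ^ (thirteenOrders 1 + 4) * g s := by
  obtain ⟨R1, hR1, h1⟩ := exists_continuous_rbf_remainder_thirteen 1
  obtain ⟨R2, hR2, h2⟩ := exists_continuous_rbf_remainder_thirteen 2
  obtain ⟨R4, hR4, h4⟩ := exists_continuous_rbf_remainder_thirteen 4
  obtain ⟨R5, hR5, h5⟩ := exists_continuous_rbf_remainder_thirteen 5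
  obtain ⟨R8, hR8, h8⟩ := exists_continuous_rbf_remainder_thirteen 8
  obtain ⟨R9, hR9, h9⟩ := exists_continuous_rbf_remainder_thirteen 9
  obtain ⟨R10, hR10, h10⟩ := exists_continuous_rbf_remainder_thirteen 10
  obtain ⟨R16, hR16, h16⟩ := exists_continuous_rbf_remainder_thirteen 16
  refine ⟨fun s =>
      18161909553267757073128 / 4225408633219375 - 463536613197337106647436 / 38028677698974375 *
      s + 1749314931389188458869692 / 114086033096923125 * s ^ 2 - 2058568111143190084587337 /
      114086033096923125 * s ^ 3 - 16905021982406975122126123 / 456344132387692500 * s ^ 4 +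
      214638759291242005650894401 / 1369032397163077500 * s ^ 5 - 3894832673110158359742160669 /
      8214194382978465000 * s ^ 6 + 5126644453163662628536214771 / 10952259177304620000 * s ^ 7 +
      11399917030925933673755993 / 1095225917730462000 * s ^ 8 - 2237353804146976877827111 /
      405639228789060000 * s ^ 9 + (23904 / 23 - 5470015872 / 208955 * s - 350710490916318 /
      13288493225 * s ^ 2 + 10930549592330955289 / 120725960949125 * s ^ 3 - 45490695679140682347
      / 241451921898250 * s ^ 4 - 13309645814419212511 / 724355765694750 * s ^ 5 -
      84299043927015064513 / 289742306277900 * s ^ 6 + 231476106466358933443 / 724355765694750 *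
      s ^ 7 - 71068113811117014077 / 1448711531389500 * s ^ 8 - 5454134795562902266 /
      120725960949125 * s ^ 9 + 2638103068511540838 / 120725960949125 * s ^ 10) * R1 s + (4320 /
      23 - 264880872 / 41791 * s + 88465210999644 / 2657698645 * s ^ 2 - 240476922928227566 /
      3449313169975 * s ^ 3 - 760399078807631771 / 120725960949125 * s ^ 4 + 417619572319359013 /
      2069587901985 * s ^ 5 - 81031045931654918 / 4829038437965 * s ^ 6 - 489262623922984273604 /
      362177882847375 * s ^ 7 + 603496442306718582232 / 362177882847375 * s ^ 8 -
      87133042056553915888 / 24145192189825 * s ^ 9 + 214978242792693129408 / 120725960949125 * s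
      ^ 10) * R2 s + (-1944 / 23 + 111442572 / 208955 * s + 66199681203798 / 13288493225 * s ^ 2
      - 73525255427439854 / 120725960949125 * s ^ 3 - 18266705585809743064 / 120725960949125 * s
      ^ 4 + 73311018552036925508 / 362177882847375 * s ^ 5 - 42250270629188486792 /
      362177882847375 * s ^ 6 - 160856218534203678294 / 120725960949125 * s ^ 7 +
      44515584660827303384 / 24145192189825 * s ^ 8 - 441373934980152900064 / 120725960949125 * s
      ^ 9 + 429956485585386258816 / 120725960949125 * s ^ 10) * R4 s + (-5184 / 23 + 1229519232 /
      208955 * s + 105959840573268 / 13288493225 * s ^ 2 - 844791243997922202 / 17246565849875 *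
      s ^ 3 + 18785350444524115057 / 120725960949125 * s ^ 4 - 6633552283573059209 /
      24145192189825 * s ^ 5 - 79424849657156271887 / 103479395099250 * s ^ 6 +
      732092805164300986789 / 362177882847375 * s ^ 7 - 85579221398204150003 / 31493728943250 * s
      ^ 8 + 14938975118370142078 / 24145192189825 * s ^ 9 + 2638103068511540838 / 4829038437965 *
      s ^ 10) * R5 s + (54 / 23 + 15619473 / 208955 * s - 60411078164091 / 26576986450 * s ^ 2 +
      3139798327657382243 / 241451921898250 * s ^ 3 + 610347602566002808 / 120725960949125 * s ^
      4 - 433989806171267264 / 72435576569475 * s ^ 5 + 2055077412802835364 / 24145192189825 * s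
      ^ 6 - 57779515197256720192 / 362177882847375 * s ^ 7 - 42713091238574803072 /
      362177882847375 * s ^ 8) * R8 s + (-288 / 23 + 96797184 / 208955 * s + 11976898614666 /
      13288493225 * s ^ 2 - 990213365279199043 / 120725960949125 * s ^ 3 + 117883928113079633 /
      9658076875930 * s ^ 4 + 161027880326222681 / 10497909647750 * s ^ 5 - 81517281891674294307
      / 482903843796500 * s ^ 6 + 12275424545099895801 / 241451921898250 * s ^ 7 -
      195056763146176525731 / 482903843796500 * s ^ 8) * R9 s + (288 / 23 + 5899656 / 208955 * s
      - 12328102129356 / 13288493225 * s ^ 2 + 774141247605779338 / 120725960949125 * s ^ 3 +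
      60558093003416779 / 120725960949125 * s ^ 4 - 3572617988670485753 / 120725960949125 * s ^ 5
      + 3655245195317901926 / 24145192189825 * s ^ 6) * R10 s + (27 / 23 - 79407 / 417910 * s -
      74738875131 / 53153972900 * s ^ 2 + 13605130999942563 / 482903843796500 * s ^ 3) * R16 s,
      by fun_prop, fun s => ?_⟩
  simp [Matrix.mulVec, dotProduct, Fin.sum_univ_four,
    thirteenRowOps, thirteenMatrix, thirteenOrders,
    thirteenRhs, thirteenTaylor,
    edgeEdge, edgeCorner, cornerCorner, edgeFar, farFar, farCorner, rbfLap, rbfBilap]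
  simp only [rbf_zero, h1, h2, h4, h5, h8, h9, h10, h16]
  ring

theorem thirteenRowOps_residual_row2 : ∃ g : ℝ → ℝ, Continuous g ∧ ∀ s,
    (thirteenRowOps s).mulVec ((thirteenMatrix s).mulVec (thirteenTaylor s) - thirteenRhs s) 2
      = s ^ (thirteenOrders 2 + 4) * g s := by
  obtain ⟨R1, hR1, h1⟩ := exists_continuous_rbf_remainder_thirteen 1
  obtain ⟨R2, hR2, h2⟩ := exists_continuous_rbf_remainder_thirteen 2
  obtain ⟨R4, hR4, h4⟩ := exists_continuous_rbf_remainder_thirteen 4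
  obtain ⟨R5, hR5, h5⟩ := exists_continuous_rbf_remainder_thirteen 5
  obtain ⟨R8, hR8, h8⟩ := exists_continuous_rbf_remainder_thirteen 8
  obtain ⟨R9, hR9, h9⟩ := exists_continuous_rbf_remainder_thirteen 9
  obtain ⟨R10, hR10, h10⟩ := exists_continuous_rbf_remainder_thirteen 10
  obtain ⟨R16, hR16, h16⟩ := exists_continuous_rbf_remainder_thirteen 16
  refine ⟨fun s =>
      761984008 / 25120025 + 3256743659119652 / 5248954823875 * s - 24696158500474543 /
      4829038437965 * s ^ 2 + 36638907901499396897 / 2173067297084250 * s ^ 3 -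
      728291356150253257247 / 19841049234247500 * s ^ 4 + 28045011548734792030459 /
      456344132387692500 * s ^ 5 - 95240210363115031749889 / 1095225917730462000 * s ^ 6 +
      288537338236590335189 / 2897423062779000 * s ^ 7 - 954042731215370518320959 /
      10952259177304620000 * s ^ 8 - 36447821833224443660689 / 16428388765956930000 * s ^ 9 +
      37921250917745370810629 / 32856777531913860000 * s ^ 10 + (315 / 23 * s ^ 5 - 4120905 /
      83582 * s ^ 6 + 109202279109 / 1518684940 * s ^ 7 - 307688183534987 / 48290384379650 * s ^
      8 - 5565132778928153 / 1448711531389500 * s ^ 9 + 3482030218193434 / 362177882847375 * s ^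
      10 - 1656059678914966 / 362177882847375 * s ^ 11) * R1 s + (-96 / 23 * s ^ 5 - 1021712 /
      208955 * s ^ 6 + 790755658912 / 13288493225 * s ^ 7 - 2153337206373004 / 51739697549625 * s
      ^ 8 - 78737627063121032 / 362177882847375 * s ^ 9 + 278231332062410032 / 362177882847375 *
      s ^ 10 - 134951815940171456 / 362177882847375 * s ^ 11) * R2 s + (-48 / 23 * s ^ 5 + 361304
      / 208955 * s ^ 6 + 756167018496 / 13288493225 * s ^ 7 - 27230619964244474 / 362177882847375
      * s ^ 8 - 13205542319290856 / 120725960949125 * s ^ 9 + 286559032244477152 /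
      362177882847375 * s ^ 10 - 269903631880342912 / 362177882847375 * s ^ 11) * R4 s + (-114 /
      23 * s ^ 5 + 5055367 / 208955 * s ^ 6 + 166075748051 / 26576986450 * s ^ 7 -
      8494134195862447 / 362177882847375 * s ^ 8 + 7892051876839611 / 34493131699750 * s ^ 9 -
      9086803771672286 / 72435576569475 * s ^ 10 - 1656059678914966 / 14487115313895 * s ^ 11) *
      R5 s + (-9 / 23 * s ^ 5 + 1498239 / 417910 * s ^ 6 - 5386370613 / 53153972900 * s ^ 7 -
      3286025854171463 / 241451921898250 * s ^ 8 + 40815392999827689 / 482903843796500 * s ^ 9) *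
      R9 s, by fun_prop, fun s => ?_⟩
  simp [Matrix.mulVec, dotProduct, Fin.sum_univ_four,
    thirteenRowOps, thirteenMatrix, thirteenOrders,
    thirteenRhs, thirteenTaylor,
    edgeEdge, edgeCorner, cornerCorner, edgeFar, farFar, farCorner, rbfLap, rbfBilap]
  simp only [rbf_zero, h1, h2, h4, h5, h8, h9, h10, h16]
  ring

theorem thirteenRowOps_residual_row3 : ∃ g : ℝ → ℝ, Continuous g ∧ ∀ s,
    (thirteenRowOps s).mulVec ((thirteenMatrix s).mulVec (thirteenTaylor s) - thirteenRhs s) 3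
      = s ^ (thirteenOrders 3 + 4) * g s := by
  obtain ⟨R1, hR1, h1⟩ := exists_continuous_rbf_remainder_thirteen 1
  obtain ⟨R2, hR2, h2⟩ := exists_continuous_rbf_remainder_thirteen 2
  obtain ⟨R4, hR4, h4⟩ := exists_continuous_rbf_remainder_thirteen 4
  obtain ⟨R5, hR5, h5⟩ := exists_continuous_rbf_remainder_thirteen 5
  obtain ⟨R8, hR8, h8⟩ := exists_continuous_rbf_remainder_thirteen 8
  obtain ⟨R9, hR9, h9⟩ := exists_continuous_rbf_remainder_thirteen 9
  obtain ⟨R10, hR10, h10⟩ := exists_continuous_rbf_remainder_thirteen 10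
  obtain ⟨R16, hR16, h16⟩ := exists_continuous_rbf_remainder_thirteen 16
  refine ⟨fun s =>
      -7870799029102304 / 5248954823875 + 99119125671182047 / 10347939509925 * s -
      7014226523207954251 / 217306729708425 * s ^ 2 + 16887579343714254876811 /
      228172066193846250 * s ^ 3 - 131511932640679805362573 / 912688264775385000 * s ^ 4 +
      4224933298195605430069 / 24338353727343600 * s ^ 5 - 59095277723941618763209 /
      438090367092184800 * s ^ 6 - 9127659333415998366197207 / 32856777531913860000 * s ^ 7 +
      215016569983196067783317 / 3650753059101540000 * s ^ 8 + 37921250917745370810629 /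
      10952259177304620000 * s ^ 9 + (-411 / 23 * s ^ 3 + 33987431 / 417910 * s ^ 4 -
      9964282493577 / 53153972900 * s ^ 5 + 309991335206999813 / 1448711531389500 * s ^ 6 -
      45705274275119971 / 206958790198500 * s ^ 7 + 517511444733194749 / 1448711531389500 * s ^ 8
      - 3090829093078228 / 51739697549625 * s ^ 9 - 1656059678914966 / 120725960949125 * s ^ 10)
      * R1 s + (498 / 23 * s ^ 3 - 16176809 / 208955 * s ^ 4 + 1792558490963 / 26576986450 * s ^
      5 + 115208361414857353 / 724355765694750 * s ^ 6 + 946184482179621 / 17246565849875 * s ^ 7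
      - 514444213251773128 / 362177882847375 * s ^ 8 + 969645812127401552 / 362177882847375 * s ^
      9 - 134951815940171456 / 120725960949125 * s ^ 10) * R2 s + (-48 / 23 * s ^ 3 + 1669544 /
      208955 * s ^ 4 - 636236857584 / 13288493225 * s ^ 5 + 12687602721156478 / 51739697549625 *
      s ^ 6 - 1941895638975634 / 362177882847375 * s ^ 7 - 28612486280994552 / 24145192189825 * s
      ^ 8 + 367694591250378304 / 120725960949125 * s ^ 9 - 269903631880342912 / 120725960949125 *
      s ^ 10) * R4 s + (18 / 23 * s ^ 3 - 6567669 / 208955 * s ^ 4 + 5509147090203 / 26576986450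
      * s ^ 5 - 6326661776309567 / 34493131699750 * s ^ 6 - 52512208584658927 / 103479395099250 *
      s ^ 7 + 291668816805024559 / 103479395099250 * s ^ 8 - 187669882845656348 / 72435576569475
      * s ^ 9 - 1656059678914966 / 4829038437965 * s ^ 10) * R5 s + (-48 / 23 * s ^ 3 + 3413864 /
      208955 * s ^ 4 + 81497584316 / 13288493225 * s ^ 5 - 1131727203020804 / 362177882847375 * s
      ^ 6 + 506351411119794 / 5248954823875 * s ^ 7 - 74053717056286304 / 362177882847375 * s ^ 8
      - 52993909725278912 / 362177882847375 * s ^ 9) * R8 s + (9 / 23 * s ^ 3 - 1988829 / 417910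
      * s ^ 4 + 577069425843 / 53153972900 * s ^ 5 + 6425246177285611 / 482903843796500 * s ^ 6 -
      60531548124856467 / 482903843796500 * s ^ 7 + 122446178999483067 / 482903843796500 * s ^ 8)
      * R9 s + (-18 / 23 * s ^ 3 + 1661769 / 208955 * s ^ 4 - 8752962723 / 26576986450 * s ^ 5 -
      6798385935197971 / 241451921898250 * s ^ 6 + 4535043666647521 / 24145192189825 * s ^ 7) *
      R10 s, by fun_prop, fun s => ?_⟩
  simp [Matrix.mulVec, dotProduct, Fin.sum_univ_four,
    thirteenRowOps, thirteenMatrix, thirteenOrders,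
    thirteenRhs, thirteenTaylor,
    edgeEdge, edgeCorner, cornerCorner, edgeFar, farFar, farCorner, rbfLap, rbfBilap]
  simp only [rbf_zero, h1, h2, h4, h5, h8, h9, h10, h16]
  ring

end RowReduction

/-! ### Values of the Gaussian and its Laplacians at the nodes -/

/-- The squared distance of two grid points. -/
def sqDist (p q : ℤ × ℤ) : ℤ := (p.1 - q.1) ^ 2 + (p.2 - q.2) ^ 2

theorem basisFun_node (ε h : ℝ) (x : Plane) (p q : ℤ × ℤ) :
    basisFun ε (node x h q) (node x h p) = rbf (sqDist p q) (ε ^ 2 * h ^ 2) := by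
  rw [basisFun, gauss, norm_node_sub_node_sq, rbf, sqDist]
  congr 1
  ring

theorem lap_basisFun_node (ε h : ℝ) (x : Plane) (p q : ℤ × ℤ) :
    lap (basisFun ε (node x h q)) (node x h p)
      = ε ^ 2 * rbfLap (sqDist p q) (ε ^ 2 * h ^ 2) := by
  rw [lap_basisFun, ← gauss, ← basisFun, basisFun_node, norm_node_sub_node_sq, rbfLap, sqDist]
  ring

theorem lapBasisFun_node (ε h : ℝ) (x : Plane) (p q : ℤ × ℤ) :
    lapBasisFun ε (node x h q) (node x h p)
      = ε ^ 2 * rbfLap (sqDist p q) (ε ^ 2 * h ^ 2) := by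
  rw [lapBasisFun_apply, ← lap_basisFun, lap_basisFun_node]

theorem lap_lapBasisFun_node (ε h : ℝ) (x : Plane) (p q : ℤ × ℤ) :
    lap (lapBasisFun ε (node x h q)) (node x h p)
      = ε ^ 4 * rbfBilap (sqDist p q) (ε ^ 2 * h ^ 2) := by
  rw [lap_lapBasisFun, ← gauss, ← basisFun, basisFun_node, norm_node_sub_node_sq, rbfBilap,
    sqDist]
  ring

/-! ### Sums over the nodes of functions of the squared distance -/

theorem sqDist_zero_of_mem_edges {p : ℤ × ℤ} (hp : p ∈ edges) : sqDist (0, 0) p = 1 := by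
  revert p; decide

theorem sqDist_zero_of_mem_corners {p : ℤ × ℤ} (hp : p ∈ corners) : sqDist (0, 0) p = 2 := by
  revert p; decide

theorem sqDist_zero_of_mem_far {p : ℤ × ℤ} (hp : p ∈ far) : sqDist (0, 0) p = 4 := by
  revert p; decide

theorem sum_edges_zero (f : ℝ → ℝ) : ∑ q ∈ edges, f (sqDist q (0, 0)) = 4 * f 1 := by
  simp [sum_edges, sqDist]; ring

theorem sum_corners_zero (f : ℝ → ℝ) : ∑ q ∈ corners, f (sqDist q (0, 0)) = 4 * f 2 := by
  norm_num [sum_corners, sqDist]; ring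

theorem sum_far_zero (f : ℝ → ℝ) : ∑ q ∈ far, f (sqDist q (0, 0)) = 4 * f 4 := by
  norm_num [sum_far, sqDist]; ring

/-- The symmetries of the square permute each node set transitively, so the sum does not depend on
the choice of p. This and the analogous lemmas collapse the collocation equations to one per orbit.
-/
theorem sum_edges_of_mem_edges {p : ℤ × ℤ} (hp : p ∈ edges) (f : ℝ → ℝ) :
    ∑ q ∈ edges, f (sqDist q p) = edgeEdge f := by
  simp only [edges, Finset.mem_insert, Finset.mem_singleton] at hp
  rcases hp with rfl | rfl | rfl | rfl <;> norm_num [sum_edges, sqDist, edgeEdge] <;> ring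

theorem sum_corners_of_mem_edges {p : ℤ × ℤ} (hp : p ∈ edges) (f : ℝ → ℝ) :
    ∑ q ∈ corners, f (sqDist q p) = edgeCorner f := by
  simp only [edges, Finset.mem_insert, Finset.mem_singleton] at hp
  rcases hp with rfl | rfl | rfl | rfl <;> norm_num [sum_corners, sqDist, edgeCorner] <;> ring

theorem sum_far_of_mem_edges {p : ℤ × ℤ} (hp : p ∈ edges) (f : ℝ → ℝ) :
    ∑ q ∈ far, f (sqDist q p) = edgeFar f := by
  simp only [edges, Finset.mem_insert, Finset.mem_singleton] at hp
  rcases hp with rfl | rfl | rfl | rfl <;> norm_num [sum_far, sqDist, edgeFar] <;> ring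

theorem sum_edges_of_mem_corners {p : ℤ × ℤ} (hp : p ∈ corners) (f : ℝ → ℝ) :
    ∑ q ∈ edges, f (sqDist q p) = edgeCorner f := by
  simp only [corners, Finset.mem_insert, Finset.mem_singleton] at hp
  rcases hp with rfl | rfl | rfl | rfl <;> norm_num [sum_edges, sqDist, edgeCorner] <;> ring

theorem sum_corners_of_mem_corners {p : ℤ × ℤ} (hp : p ∈ corners) (f : ℝ → ℝ) :
    ∑ q ∈ corners, f (sqDist q p) = cornerCorner f := by
  simp only [corners, Finset.mem_insert, Finset.mem_singleton] at hp
  rcases hp with rfl | rfl | rfl | rfl <;> norm_num [sum_corners, sqDist, cornerCorner] <;> ring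

theorem sum_far_of_mem_corners {p : ℤ × ℤ} (hp : p ∈ corners) (f : ℝ → ℝ) :
    ∑ q ∈ far, f (sqDist q p) = farCorner f := by
  simp only [corners, Finset.mem_insert, Finset.mem_singleton] at hp
  rcases hp with rfl | rfl | rfl | rfl <;> norm_num [sum_far, sqDist, farCorner] <;> ring

theorem sum_edges_of_mem_far {p : ℤ × ℤ} (hp : p ∈ far) (f : ℝ → ℝ) :
    ∑ q ∈ edges, f (sqDist q p) = edgeFar f := by
  simp only [far, Finset.mem_insert, Finset.mem_singleton] at hp
  rcases hp with rfl | rfl | rfl | rfl <;> norm_num [sum_edges, sqDist, edgeFar] <;> ring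

theorem sum_corners_of_mem_far {p : ℤ × ℤ} (hp : p ∈ far) (f : ℝ → ℝ) :
    ∑ q ∈ corners, f (sqDist q p) = farCorner f := by
  simp only [far, Finset.mem_insert, Finset.mem_singleton] at hp
  rcases hp with rfl | rfl | rfl | rfl <;> norm_num [sum_corners, sqDist, farCorner] <;> ring

theorem sum_far_of_mem_far {p : ℤ × ℤ} (hp : p ∈ far) (f : ℝ → ℝ) :
    ∑ q ∈ far, f (sqDist q p) = farFar f := by
  simp only [far, Finset.mem_insert, Finset.mem_singleton] at hp
  rcases hp with rfl | rfl | rfl | rfl <;> norm_num [sum_far, sqDist, farFar] <;> ring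

/-! ### Reduction of the Gaussian systems -/

theorem Weights4.apply_basisFun (v : Weights4) (ε h : ℝ) (x : Plane) (p : ℤ × ℤ) :
    v.apply h x (basisFun ε (node x h p)) =
      v.α₀ * rbf (sqDist (0, 0) p) (ε ^ 2 * h ^ 2)
      + v.α₁ * ∑ q ∈ edges, rbf (sqDist q p) (ε ^ 2 * h ^ 2)
      + v.α₂ * ∑ q ∈ corners, rbf (sqDist q p) (ε ^ 2 * h ^ 2)
      + v.β₁ * (ε ^ 2 * ∑ q ∈ edges, rbfLap (sqDist q p) (ε ^ 2 * h ^ 2)) := by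
  have h0 := basisFun_node ε h x (0, 0) p
  rw [node_zero] at h0
  simp only [Weights4.apply, h0, basisFun_node, lap_basisFun_node, Finset.mul_sum]

theorem Weights4.apply_lapBasisFun (v : Weights4) (ε h : ℝ) (x : Plane) (p : ℤ × ℤ) :
    v.apply h x (lapBasisFun ε (node x h p)) =
      v.α₀ * (ε ^ 2 * rbfLap (sqDist (0, 0) p) (ε ^ 2 * h ^ 2))
      + v.α₁ * (ε ^ 2 * ∑ q ∈ edges, rbfLap (sqDist q p) (ε ^ 2 * h ^ 2))
      + v.α₂ * (ε ^ 2 * ∑ q ∈ corners, rbfLap (sqDist q p) (ε ^ 2 * h ^ 2))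
      + v.β₁ * (ε ^ 4 * ∑ q ∈ edges, rbfBilap (sqDist q p) (ε ^ 2 * h ^ 2)) := by
  have h0 := lapBasisFun_node ε h x (0, 0) p
  rw [node_zero] at h0
  simp only [Weights4.apply, h0, lapBasisFun_node, lap_lapBasisFun_node, Finset.mul_sum]

theorem Weights4.apply_one (v : Weights4) (h : ℝ) (x : Plane) :
    v.apply h x (fun _ => 1) = v.α₀ + 4 * v.α₁ + 4 * v.α₂ := by
  have c1 : edges.card = 4 := by decide
  have c2 : corners.card = 4 := by decide
  simp [Weights4.apply, lap_const, c1, c2]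
  ring

theorem Weights6.apply_basisFun (v : Weights6) (ε h : ℝ) (x : Plane) (p : ℤ × ℤ) :
    v.apply h x (basisFun ε (node x h p)) =
      v.α₀ * rbf (sqDist (0, 0) p) (ε ^ 2 * h ^ 2)
      + v.α₁ * (∑ q ∈ edges, rbf (sqDist q p) (ε ^ 2 * h ^ 2)
        + ∑ q ∈ corners, rbf (sqDist q p) (ε ^ 2 * h ^ 2))
      + v.α₂ * ∑ q ∈ far, rbf (sqDist q p) (ε ^ 2 * h ^ 2)
      + v.β₁ * (ε ^ 2 * ∑ q ∈ edges, rbfLap (sqDist q p) (ε ^ 2 * h ^ 2))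
      + v.β₂ * (ε ^ 2 * ∑ q ∈ corners, rbfLap (sqDist q p) (ε ^ 2 * h ^ 2)) := by
  have h0 := basisFun_node ε h x (0, 0) p
  rw [node_zero] at h0
  simp only [Weights6.apply, h0, basisFun_node, lap_basisFun_node, Finset.mul_sum,
    sum_edges_union_corners]

theorem Weights6.apply_lapBasisFun (v : Weights6) (ε h : ℝ) (x : Plane) (p : ℤ × ℤ) :
    v.apply h x (lapBasisFun ε (node x h p)) =
      v.α₀ * (ε ^ 2 * rbfLap (sqDist (0, 0) p) (ε ^ 2 * h ^ 2))
      + v.α₁ * (ε ^ 2 * ∑ q ∈ edges, rbfLap (sqDist q p) (ε ^ 2 * h ^ 2)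
        + ε ^ 2 * ∑ q ∈ corners, rbfLap (sqDist q p) (ε ^ 2 * h ^ 2))
      + v.α₂ * (ε ^ 2 * ∑ q ∈ far, rbfLap (sqDist q p) (ε ^ 2 * h ^ 2))
      + v.β₁ * (ε ^ 4 * ∑ q ∈ edges, rbfBilap (sqDist q p) (ε ^ 2 * h ^ 2))
      + v.β₂ * (ε ^ 4 * ∑ q ∈ corners, rbfBilap (sqDist q p) (ε ^ 2 * h ^ 2)) := by
  have h0 := lapBasisFun_node ε h x (0, 0) p
  rw [node_zero] at h0
  simp only [Weights6.apply, h0, lapBasisFun_node, lap_lapBasisFun_node, Finset.mul_sum,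
    sum_edges_union_corners]

theorem Weights6.apply_one (v : Weights6) (h : ℝ) (x : Plane) :
    v.apply h x (fun _ => 1) = v.α₀ + 8 * v.α₁ + 4 * v.α₂ := by
  have c1 : (edges ∪ corners).card = 8 := by decide
  have c2 : far.card = 4 := by decide
  simp [Weights6.apply, lap_const, c1, c2]
  ring

theorem lap_basisFun_center (ε h : ℝ) (x : Plane) (p : ℤ × ℤ) :
    lap (basisFun ε (node x h p)) x = ε ^ 2 * rbfLap (sqDist (0, 0) p) (ε ^ 2 * h ^ 2) := by
  have h0 := lap_basisFun_node ε h x (0, 0) p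
  rwa [node_zero] at h0

theorem lap_lapBasisFun_center (ε h : ℝ) (x : Plane) (p : ℤ × ℤ) :
    lap (lapBasisFun ε (node x h p)) x = ε ^ 4 * rbfBilap (sqDist (0, 0) p) (ε ^ 2 * h ^ 2) := by
  have h0 := lap_lapBasisFun_node ε h x (0, 0) p
  rwa [node_zero] at h0

/-- The constants give α₀ = -4α₁ - 4α₂. The multiplier γ occurs only in the Gaussian equations and
disappears when the one at the reference node is subtracted from those at an edge and at a corner
node. The Laplacian equation has no γ and is kept as it is. -/
theorem Weights4.isGaussian_iff {ε h : ℝ} (hε : ε ≠ 0) (hh : h ≠ 0) (x : Plane) (v : Weights4) :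
    v.IsGaussian ε h x ↔ v.α₀ = -4 * v.α₁ - 4 * v.α₂ ∧
      (nineMatrix (ε ^ 2 * h ^ 2)).mulVec ![h ^ 2 * v.α₁, h ^ 2 * v.α₂, v.β₁]
        = nineRhs (ε ^ 2 * h ^ 2) := by
  have e0 : (sqDist (0, 0) (0, 0) : ℤ) = 0 := by decide
  have hrow : (nineMatrix (ε ^ 2 * h ^ 2)).mulVec ![h ^ 2 * v.α₁, h ^ 2 * v.α₂, v.β₁]
      = nineRhs (ε ^ 2 * h ^ 2) ↔ ∀ i, (nineMatrix (ε ^ 2 * h ^ 2)).mulVec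
        ![h ^ 2 * v.α₁, h ^ 2 * v.α₂, v.β₁] i = nineRhs (ε ^ 2 * h ^ 2) i := funext_iff
  rw [hrow, Fin.forall_fin_succ, Fin.forall_fin_two, Weights4.IsGaussian, Weights4.apply_one]
  simp only [Matrix.mulVec, dotProduct, Fin.sum_univ_three, nineMatrix, nineRhs, Matrix.of_apply,
    Matrix.cons_val, Fin.succ_zero_eq_one, Fin.succ_one_eq_two, Finset.forall_mem_union,
    Finset.mem_singleton, forall_eq, Weights4.apply_basisFun, Weights4.apply_lapBasisFun,
    lap_basisFun_center, lap_lapBasisFun_center]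
  constructor
  · rintro ⟨⟨γ, ⟨⟨h0, hE⟩, hK⟩, hL⟩, h1⟩
    have m1 : ((1, 0) : ℤ × ℤ) ∈ edges := by decide
    have m2 : ((1, 1) : ℤ × ℤ) ∈ corners := by decide
    replace hE := hE _ m1
    replace hK := hK _ m2
    replace hL := hL _ m1
    simp only [e0, sum_edges_zero (rbf · (ε ^ 2 * h ^ 2)), sum_corners_zero (rbf · (ε ^ 2 * h ^ 2)),
      sum_edges_zero (rbfLap · (ε ^ 2 * h ^ 2)), Int.cast_zero] at h0
    simp only [sum_edges_of_mem_edges m1 (rbf · (ε ^ 2 * h ^ 2)),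
      sum_corners_of_mem_edges m1 (rbf · (ε ^ 2 * h ^ 2)),
      sum_edges_of_mem_edges m1 (rbfLap · (ε ^ 2 * h ^ 2)), sqDist_zero_of_mem_edges m1,
      Int.cast_one] at hE
    simp only [sum_edges_of_mem_corners m2 (rbf · (ε ^ 2 * h ^ 2)),
      sum_corners_of_mem_corners m2 (rbf · (ε ^ 2 * h ^ 2)),
      sum_edges_of_mem_corners m2 (rbfLap · (ε ^ 2 * h ^ 2)), sqDist_zero_of_mem_corners m2,
      Int.cast_ofNat] at hK
    simp only [sum_edges_of_mem_edges m1 (rbfLap · (ε ^ 2 * h ^ 2)),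
      sum_corners_of_mem_edges m1 (rbfLap · (ε ^ 2 * h ^ 2)),
      sum_edges_of_mem_edges m1 (rbfBilap · (ε ^ 2 * h ^ 2)), sqDist_zero_of_mem_edges m1,
      Int.cast_one] at hL
    have ha : v.α₀ = -4 * v.α₁ - 4 * v.α₂ := by linear_combination h1
    rw [ha] at h0 hE hK hL
    refine ⟨ha, ?_, ?_, ?_⟩
    -- The factor h² turns α₁, α₂ into the scaled unknowns and the factor ε² of the Laplacian terms
    -- into s.
    · linear_combination h ^ 2 * (hE - h0)
    · linear_combination h ^ 2 * (hK - h0)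
    -- Every term of the Laplacian equation carries at least ε², which is cancelled to make it
    -- depend on s alone.
    · apply mul_left_cancel₀ (pow_ne_zero 2 hε)
      linear_combination h ^ 2 * hL
  · rintro ⟨ha, hE, hK, hL⟩
    -- Conversely, γ is whatever makes the equation at the reference node hold.
    refine ⟨⟨-(v.α₀ * rbf 0 (ε ^ 2 * h ^ 2) + v.α₁ * (4 * rbf 1 (ε ^ 2 * h ^ 2))
      + v.α₂ * (4 * rbf 2 (ε ^ 2 * h ^ 2)) + v.β₁ * (ε ^ 2 * (4 * rbfLap 1 (ε ^ 2 * h ^ 2))))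
      + ε ^ 2 * rbfLap 0 (ε ^ 2 * h ^ 2), ⟨⟨?_, ?_⟩, ?_⟩, ?_⟩, ?_⟩
    · simp only [e0, sum_edges_zero (rbf · (ε ^ 2 * h ^ 2)),
        sum_corners_zero (rbf · (ε ^ 2 * h ^ 2)),
        sum_edges_zero (rbfLap · (ε ^ 2 * h ^ 2)), Int.cast_zero]
      ring
    · intro p m1
      simp only [sum_edges_of_mem_edges m1 (rbf · (ε ^ 2 * h ^ 2)),
        sum_corners_of_mem_edges m1 (rbf · (ε ^ 2 * h ^ 2)),
        sum_edges_of_mem_edges m1 (rbfLap · (ε ^ 2 * h ^ 2)), sqDist_zero_of_mem_edges m1,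
        Int.cast_one, ha]
      apply mul_left_cancel₀ (pow_ne_zero 2 hh)
      linear_combination hE
    · intro p m2
      simp only [sum_edges_of_mem_corners m2 (rbf · (ε ^ 2 * h ^ 2)),
        sum_corners_of_mem_corners m2 (rbf · (ε ^ 2 * h ^ 2)),
        sum_edges_of_mem_corners m2 (rbfLap · (ε ^ 2 * h ^ 2)), sqDist_zero_of_mem_corners m2,
        Int.cast_ofNat, ha]
      apply mul_left_cancel₀ (pow_ne_zero 2 hh)
      linear_combination hK
    · intro p m1
      simp only [sum_edges_of_mem_edges m1 (rbfLap · (ε ^ 2 * h ^ 2)),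
        sum_corners_of_mem_edges m1 (rbfLap · (ε ^ 2 * h ^ 2)),
        sum_edges_of_mem_edges m1 (rbfBilap · (ε ^ 2 * h ^ 2)), sqDist_zero_of_mem_edges m1,
        Int.cast_one, ha]
      apply mul_left_cancel₀ (pow_ne_zero 2 hh)
      linear_combination ε ^ 2 * hL
    · rw [ha]
      ring

/-- The same elimination, now with α₀ = -8α₁ - 4α₂. There is no Gaussian equation at the corners, so
the edge and far Gaussians and the two kinds of Laplacians give four equations for four unknowns. -/
theorem Weights6.isGaussian_iff {ε h : ℝ} (hε : ε ≠ 0) (hh : h ≠ 0) (x : Plane) (v : Weights6) :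
    v.IsGaussian ε h x ↔ v.α₀ = -8 * v.α₁ - 4 * v.α₂ ∧
      (thirteenMatrix (ε ^ 2 * h ^ 2)).mulVec ![h ^ 2 * v.α₁, h ^ 2 * v.α₂, v.β₁, v.β₂]
        = thirteenRhs (ε ^ 2 * h ^ 2) := by
  have e0 : (sqDist (0, 0) (0, 0) : ℤ) = 0 := by decide
  have hrow : (thirteenMatrix (ε ^ 2 * h ^ 2)).mulVec ![h ^ 2 * v.α₁, h ^ 2 * v.α₂, v.β₁, v.β₂]
      = thirteenRhs (ε ^ 2 * h ^ 2) ↔ ∀ i, (thirteenMatrix (ε ^ 2 * h ^ 2)).mulVec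
        ![h ^ 2 * v.α₁, h ^ 2 * v.α₂, v.β₁, v.β₂] i = thirteenRhs (ε ^ 2 * h ^ 2) i := funext_iff
  rw [hrow, Fin.forall_fin_succ, Fin.forall_fin_succ, Fin.forall_fin_two, Weights6.IsGaussian,
    Weights6.apply_one]
  have s1 : (Fin.succ (0 : Fin 2).succ : Fin 4) = 2 := rfl
  have s2 : (Fin.succ (1 : Fin 2).succ : Fin 4) = 3 := rfl
  have s3 : (Fin.succ (0 : Fin 3) : Fin 4) = 1 := rfl
  simp only [s1, s2, s3, Matrix.mulVec, dotProduct, Fin.sum_univ_four, thirteenMatrix, thirteenRhs,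
    Matrix.of_apply, Matrix.cons_val, Finset.forall_mem_union,
    Finset.mem_singleton, forall_eq, Weights6.apply_basisFun, Weights6.apply_lapBasisFun,
    lap_basisFun_center, lap_lapBasisFun_center]
  constructor
  · rintro ⟨⟨γ, ⟨⟨h0, hE⟩, hD⟩, hL, hK⟩, h1⟩
    have m1 : ((1, 0) : ℤ × ℤ) ∈ edges := by decide
    have m2 : ((1, 1) : ℤ × ℤ) ∈ corners := by decide
    have m3 : ((2, 0) : ℤ × ℤ) ∈ far := by decide
    replace hE := hE _ m1
    replace hD := hD _ m3
    replace hL := hL _ m1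
    replace hK := hK _ m2
    simp only [e0, sum_edges_zero (rbf · (ε ^ 2 * h ^ 2)), sum_corners_zero (rbf · (ε ^ 2 * h ^ 2)),
      sum_far_zero (rbf · (ε ^ 2 * h ^ 2)), sum_edges_zero (rbfLap · (ε ^ 2 * h ^ 2)),
      sum_corners_zero (rbfLap · (ε ^ 2 * h ^ 2)), Int.cast_zero] at h0
    simp only [sum_edges_of_mem_edges m1 (rbf · (ε ^ 2 * h ^ 2)),
      sum_corners_of_mem_edges m1 (rbf · (ε ^ 2 * h ^ 2)),
      sum_far_of_mem_edges m1 (rbf · (ε ^ 2 * h ^ 2)),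
      sum_edges_of_mem_edges m1 (rbfLap · (ε ^ 2 * h ^ 2)),
      sum_corners_of_mem_edges m1 (rbfLap · (ε ^ 2 * h ^ 2)), sqDist_zero_of_mem_edges m1,
      Int.cast_one] at hE
    simp only [sum_edges_of_mem_far m3 (rbf · (ε ^ 2 * h ^ 2)),
      sum_corners_of_mem_far m3 (rbf · (ε ^ 2 * h ^ 2)),
      sum_far_of_mem_far m3 (rbf · (ε ^ 2 * h ^ 2)),
      sum_edges_of_mem_far m3 (rbfLap · (ε ^ 2 * h ^ 2)),
      sum_corners_of_mem_far m3 (rbfLap · (ε ^ 2 * h ^ 2)), sqDist_zero_of_mem_far m3,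
      Int.cast_ofNat] at hD
    simp only [sum_edges_of_mem_edges m1 (rbfLap · (ε ^ 2 * h ^ 2)),
      sum_corners_of_mem_edges m1 (rbfLap · (ε ^ 2 * h ^ 2)),
      sum_far_of_mem_edges m1 (rbfLap · (ε ^ 2 * h ^ 2)),
      sum_edges_of_mem_edges m1 (rbfBilap · (ε ^ 2 * h ^ 2)),
      sum_corners_of_mem_edges m1 (rbfBilap · (ε ^ 2 * h ^ 2)), sqDist_zero_of_mem_edges m1,
      Int.cast_one] at hL
    simp only [sum_edges_of_mem_corners m2 (rbfLap · (ε ^ 2 * h ^ 2)),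
      sum_corners_of_mem_corners m2 (rbfLap · (ε ^ 2 * h ^ 2)),
      sum_far_of_mem_corners m2 (rbfLap · (ε ^ 2 * h ^ 2)),
      sum_edges_of_mem_corners m2 (rbfBilap · (ε ^ 2 * h ^ 2)),
      sum_corners_of_mem_corners m2 (rbfBilap · (ε ^ 2 * h ^ 2)), sqDist_zero_of_mem_corners m2,
      Int.cast_ofNat] at hK
    have ha : v.α₀ = -8 * v.α₁ - 4 * v.α₂ := by linear_combination h1
    rw [ha] at h0 hE hD hL hK
    refine ⟨ha, ?_, ?_, ?_, ?_⟩
    · linear_combination h ^ 2 * (hE - h0)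
    · linear_combination h ^ 2 * (hD - h0)
    · apply mul_left_cancel₀ (pow_ne_zero 2 hε)
      linear_combination h ^ 2 * hL
    · apply mul_left_cancel₀ (pow_ne_zero 2 hε)
      linear_combination h ^ 2 * hK
  · rintro ⟨ha, hE, hD, hL, hK⟩
    refine ⟨⟨-(v.α₀ * rbf 0 (ε ^ 2 * h ^ 2) + v.α₁ * (4 * rbf 1 (ε ^ 2 * h ^ 2)
      + 4 * rbf 2 (ε ^ 2 * h ^ 2)) + v.α₂ * (4 * rbf 4 (ε ^ 2 * h ^ 2))
      + v.β₁ * (ε ^ 2 * (4 * rbfLap 1 (ε ^ 2 * h ^ 2)))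
      + v.β₂ * (ε ^ 2 * (4 * rbfLap 2 (ε ^ 2 * h ^ 2))))
      + ε ^ 2 * rbfLap 0 (ε ^ 2 * h ^ 2), ⟨⟨?_, ?_⟩, ?_⟩, ?_, ?_⟩, ?_⟩
    · simp only [e0, sum_edges_zero (rbf · (ε ^ 2 * h ^ 2)),
        sum_corners_zero (rbf · (ε ^ 2 * h ^ 2)),
        sum_far_zero (rbf · (ε ^ 2 * h ^ 2)), sum_edges_zero (rbfLap · (ε ^ 2 * h ^ 2)),
        sum_corners_zero (rbfLap · (ε ^ 2 * h ^ 2)), Int.cast_zero]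
      ring
    · intro p m1
      simp only [sum_edges_of_mem_edges m1 (rbf · (ε ^ 2 * h ^ 2)),
        sum_corners_of_mem_edges m1 (rbf · (ε ^ 2 * h ^ 2)),
        sum_far_of_mem_edges m1 (rbf · (ε ^ 2 * h ^ 2)),
        sum_edges_of_mem_edges m1 (rbfLap · (ε ^ 2 * h ^ 2)),
        sum_corners_of_mem_edges m1 (rbfLap · (ε ^ 2 * h ^ 2)), sqDist_zero_of_mem_edges m1,
        Int.cast_one, ha]
      apply mul_left_cancel₀ (pow_ne_zero 2 hh)
      linear_combination hE
    · intro p m3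
      simp only [sum_edges_of_mem_far m3 (rbf · (ε ^ 2 * h ^ 2)),
        sum_corners_of_mem_far m3 (rbf · (ε ^ 2 * h ^ 2)),
        sum_far_of_mem_far m3 (rbf · (ε ^ 2 * h ^ 2)),
        sum_edges_of_mem_far m3 (rbfLap · (ε ^ 2 * h ^ 2)),
        sum_corners_of_mem_far m3 (rbfLap · (ε ^ 2 * h ^ 2)), sqDist_zero_of_mem_far m3,
        Int.cast_ofNat, ha]
      apply mul_left_cancel₀ (pow_ne_zero 2 hh)
      linear_combination hD
    · intro p m1
      simp only [sum_edges_of_mem_edges m1 (rbfLap · (ε ^ 2 * h ^ 2)),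
        sum_corners_of_mem_edges m1 (rbfLap · (ε ^ 2 * h ^ 2)),
        sum_far_of_mem_edges m1 (rbfLap · (ε ^ 2 * h ^ 2)),
        sum_edges_of_mem_edges m1 (rbfBilap · (ε ^ 2 * h ^ 2)),
        sum_corners_of_mem_edges m1 (rbfBilap · (ε ^ 2 * h ^ 2)), sqDist_zero_of_mem_edges m1,
        Int.cast_one, ha]
      apply mul_left_cancel₀ (pow_ne_zero 2 hh)
      linear_combination ε ^ 2 * hL
    · intro p m2
      simp only [sum_edges_of_mem_corners m2 (rbfLap · (ε ^ 2 * h ^ 2)),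
        sum_corners_of_mem_corners m2 (rbfLap · (ε ^ 2 * h ^ 2)),
        sum_far_of_mem_corners m2 (rbfLap · (ε ^ 2 * h ^ 2)),
        sum_edges_of_mem_corners m2 (rbfBilap · (ε ^ 2 * h ^ 2)),
        sum_corners_of_mem_corners m2 (rbfBilap · (ε ^ 2 * h ^ 2)), sqDist_zero_of_mem_corners m2,
        Int.cast_ofNat, ha]
      apply mul_left_cancel₀ (pow_ne_zero 2 hh)
      linear_combination ε ^ 2 * hK
    · rw [ha]
      ring

/-! ### Solution of the Gaussian systems -/

theorem exists_nine_solution : ∃ s₀ > 0, ∃ V : ℝ → Fin 3 → ℝ, ∃ C : ℝ, ∀ s, 0 < s → s < s₀ →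
    (∀ i, |V s i| ≤ C) ∧
    ∀ v, (nineMatrix s).mulVec v = nineRhs s ↔ v = nineTaylor s + s ^ 4 • V s := by
  refine exists_solution_of_row_reduction nineOrders nineMatrix nineRowOps nineLeading nineRhs
    nineTaylor ?_ (fun i j => ?_) (fun i => ?_)
  · rw [nineLeading, Matrix.det_fin_three]
    simp
    norm_num
  · fin_cases i
    exacts [nineRowOps_mul_row0 j, nineRowOps_mul_row1 j, nineRowOps_mul_row2 j]
  · fin_cases i
    exacts [nineRowOps_residual_row0, nineRowOps_residual_row1, nineRowOps_residual_row2]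

theorem exists_thirteen_solution : ∃ s₀ > 0, ∃ V : ℝ → Fin 4 → ℝ, ∃ C : ℝ,
    ∀ s, 0 < s → s < s₀ → (∀ i, |V s i| ≤ C) ∧
    ∀ v, (thirteenMatrix s).mulVec v = thirteenRhs s ↔ v = thirteenTaylor s + s ^ 4 • V s := by
  refine exists_solution_of_row_reduction thirteenOrders thirteenMatrix thirteenRowOps
    thirteenLeading thirteenRhs thirteenTaylor ?_ (fun i j => ?_) (fun i => ?_)
  -- Column indices that arise in the cofactor expansion of the 4 × 4 determinant.
  · have s1 : Fin.succAbove (1 : Fin 4) (2 : Fin 3) = 3 := rfl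
    have s2 : Fin.succAbove (2 : Fin 4) (2 : Fin 3) = 3 := rfl
    have s3 : Fin.succAbove (3 : Fin 4) (2 : Fin 3) = 2 := rfl
    simp [thirteenLeading, Matrix.det_succ_row_zero, Fin.sum_univ_succ, s1, s2, s3]
    norm_num
  · fin_cases i
    exacts [thirteenRowOps_mul_row0 j, thirteenRowOps_mul_row1 j, thirteenRowOps_mul_row2 j,
      thirteenRowOps_mul_row3 j]
  · fin_cases i
    exacts [thirteenRowOps_residual_row0, thirteenRowOps_residual_row1,
      thirteenRowOps_residual_row2, thirteenRowOps_residual_row3]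

/-! ### Bounded functions -/

/-- The function `f` is bounded on `S`. -/
def BoundedOn {ι : Type*} (S : Set ι) (f : ι → ℝ) : Prop := ∃ C : ℝ, ∀ i ∈ S, |f i| ≤ C

theorem BoundedOn.const {ι : Type*} {S : Set ι} (c : ℝ) : BoundedOn S fun _ => c :=
  ⟨|c|, fun _ _ => le_rfl⟩

theorem BoundedOn.add {ι : Type*} {S : Set ι} {f g : ι → ℝ} (hf : BoundedOn S f)
    (hg : BoundedOn S g) : BoundedOn S fun i => f i + g i := by
  obtain ⟨C, hC⟩ := hf
  obtain ⟨D, hD⟩ := hg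
  exact ⟨C + D, fun i hi => (abs_add_le _ _).trans (add_le_add (hC i hi) (hD i hi))⟩

theorem BoundedOn.mul {ι : Type*} {S : Set ι} {f g : ι → ℝ} (hf : BoundedOn S f)
    (hg : BoundedOn S g) : BoundedOn S fun i => f i * g i := by
  obtain ⟨C, hC⟩ := hf
  obtain ⟨D, hD⟩ := hg
  refine ⟨C * D, fun i hi => ?_⟩
  rw [abs_mul]
  exact mul_le_mul (hC i hi) (hD i hi) (abs_nonneg _) ((abs_nonneg _).trans (hC i hi))

theorem BoundedOn.pow {ι : Type*} {S : Set ι} {f : ι → ℝ} (hf : BoundedOn S f) (n : ℕ) :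
    BoundedOn S fun i => f i ^ n := by
  induction n with
  | zero => simpa using BoundedOn.const (S := S) 1
  | succ n ih => simpa only [pow_succ] using ih.mul hf

/-- The parameters `(ε, h)` with `ε h < δ` and `h < h₀`. -/
def paramSet (δ h₀ : ℝ) : Set (ℝ × ℝ) :=
  {i | 0 < i.1 ∧ 0 < i.2 ∧ i.2 < h₀ ∧ i.1 * i.2 < δ}

/-- Since δ ≤ 1, one has (εh)² < δ² ≤ δ ≤ s₀; hence the later choice of δ as the minimum of 1 and
s₀. -/
theorem sq_mul_sq_lt {ε h δ s₀ : ℝ} (hε : 0 < ε) (hh : 0 < h) (h1 : δ ≤ 1) (h2 : δ ≤ s₀)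
    (hδ : ε * h < δ) : ε ^ 2 * h ^ 2 < s₀ := by
  have hp : 0 < ε * h := mul_pos hε hh
  nlinarith

theorem boundedOn_sq_mul_sq {δ h₀ : ℝ} (h1 : δ ≤ 1) :
    BoundedOn (paramSet δ h₀) fun i => i.1 ^ 2 * i.2 ^ 2 := by
  refine ⟨1, fun i ⟨hε, hh, _, hδ⟩ => ?_⟩
  rw [abs_of_nonneg (by positivity)]
  exact (sq_mul_sq_lt hε hh h1 h1 hδ).le

theorem boundedOn_of_sq_mul_sq {δ h₀ s₀ C : ℝ} {f : ℝ → ℝ} (h1 : δ ≤ 1) (h2 : δ ≤ s₀)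
    (hf : ∀ s, 0 < s → s < s₀ → |f s| ≤ C) :
    BoundedOn (paramSet δ h₀) fun i => f (i.1 ^ 2 * i.2 ^ 2) :=
  ⟨C, fun _ ⟨hε, hh, _, hδ⟩ => hf _ (by positivity) (sq_mul_sq_lt hε hh h1 h2 hδ)⟩

theorem boundedOn_snd {δ h₀ C : ℝ} {f : ℝ → ℝ} (hf : ∀ h, 0 < h → h < h₀ → |f h| ≤ C) :
    BoundedOn (paramSet δ h₀) fun i => f i.2 :=
  ⟨C, fun _ ⟨_, hh, h2, _⟩ => hf _ hh h2⟩

theorem exists_forall_of_eventually_nhdsGT {p : ℝ → Prop} (h : ∀ᶠ x in 𝓝[>] (0 : ℝ), p x) :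
    ∃ h₀ : ℝ, 0 < h₀ ∧ ∀ x, 0 < x → x < h₀ → p x := by
  obtain ⟨b, hb, hs⟩ := mem_nhdsGT_iff_exists_Ioo_subset.1 h
  exact ⟨b, hb, fun x h1 h2 => hs ⟨h1, h2⟩⟩

/-- Here g is the truncated expansion at fixed h, a polynomial in ε in the applications, and the
error of order ε⁸ tends to 0. -/
theorem tendsto_flat_limit {f g : ℝ → ℝ} {δ K L : ℝ} (hδ : 0 < δ) (hg : Continuous g)
    (hg0 : g 0 = L) (h : ∀ ε, 0 < ε → ε < δ → |f ε - g ε| ≤ K * ε ^ 8) :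
    Tendsto f (𝓝[>] 0) (𝓝 L) := by
  have h1 : Tendsto g (𝓝[>] 0) (𝓝 L) := by
    rw [← hg0]
    exact (hg.tendsto 0).mono_left nhdsWithin_le_nhds
  have h2 : Tendsto (fun ε : ℝ => K * ε ^ 8) (𝓝[>] 0) (𝓝 0) := by
    have : Continuous fun ε : ℝ => K * ε ^ 8 := by fun_prop
    simpa using (this.tendsto 0).mono_left (nhdsWithin_le_nhds (s := Set.Ioi 0))
  have h3 : Tendsto (fun ε => f ε - g ε) (𝓝[>] 0) (𝓝 0) := by
    rw [tendsto_zero_iff_abs_tendsto_zero]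
    refine squeeze_zero' (Eventually.of_forall fun _ => abs_nonneg _) ?_ h2
    filter_upwards [Ioo_mem_nhdsGT hδ] with ε hε using h ε hε.1 hε.2
  simpa using h3.add h1

theorem abs_cubic_le {q z₀ z₁ z₂ z₃ D₀ D₁ D₂ D₃ : ℝ} (hq : 0 ≤ q) (h0 : |z₀| ≤ D₀)
    (h1 : |z₁| ≤ D₁) (h2 : |z₂| ≤ D₂) (h3 : |z₃| ≤ D₃) :
    |z₃ * q ^ 3 + z₂ * q ^ 2 + z₁ * q + z₀| ≤ D₃ * q ^ 3 + D₂ * q ^ 2 + D₁ * q + D₀ := by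
  refine (abs_add_le _ _).trans (add_le_add ((abs_add_le _ _).trans (add_le_add
    ((abs_add_le _ _).trans (add_le_add ?_ ?_)) ?_)) h0)
  · rw [abs_mul, abs_of_nonneg (pow_nonneg hq 3)]
    exact mul_le_mul_of_nonneg_right h3 (pow_nonneg hq 3)
  · rw [abs_mul, abs_of_nonneg (pow_nonneg hq 2)]
    exact mul_le_mul_of_nonneg_right h2 (pow_nonneg hq 2)
  · rw [abs_mul, abs_of_nonneg hq]
    exact mul_le_mul_of_nonneg_right h1 hq

/-! ### The nine-point formula -/

/-- The weights of the nine-point formula with scaled remainders `V`. -/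
def nineWeights (V : ℝ → Fin 3 → ℝ) (ε h : ℝ) : Weights4 :=
  let a := nineTaylor (ε ^ 2 * h ^ 2) + (ε ^ 2 * h ^ 2) ^ 4 • V (ε ^ 2 * h ^ 2)
  ⟨-4 * (a 0 / h ^ 2) - 4 * (a 1 / h ^ 2), a 0 / h ^ 2, a 1 / h ^ 2, a 2⟩

theorem isGaussian_iff_eq_nineWeights {V : ℝ → Fin 3 → ℝ} {ε h : ℝ} (hε : 0 < ε) (hh : 0 < h)
    (hV : ∀ v, (nineMatrix (ε ^ 2 * h ^ 2)).mulVec v = nineRhs (ε ^ 2 * h ^ 2) ↔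
      v = nineTaylor (ε ^ 2 * h ^ 2) + (ε ^ 2 * h ^ 2) ^ 4 • V (ε ^ 2 * h ^ 2))
    (x : Plane) (v : Weights4) : v.IsGaussian ε h x ↔ v = nineWeights V ε h := by
  rw [Weights4.isGaussian_iff hε.ne' hh.ne', hV]
  have h2 : h ^ 2 ≠ 0 := pow_ne_zero 2 hh.ne'
  constructor
  · rintro ⟨h0, h1⟩
    have e0 := congrFun h1 0
    have e1 := congrFun h1 1
    have e2 := congrFun h1 2
    simp only [Matrix.cons_val] at e0 e1 e2
    ext <;> simp only [nineWeights, ← e0, ← e1, ← e2, mul_div_cancel_left₀ _ h2, h0]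
  · rintro rfl
    refine ⟨rfl, ?_⟩
    ext i
    fin_cases i <;> simp only [nineWeights] <;> simp [mul_div_cancel₀ _ h2]

theorem nineWeights_alpha_one (V : ℝ → Fin 3 → ℝ) (ε : ℝ) {h : ℝ} (hh : 0 < h) :
    h ^ 2 * (nineWeights V ε h).α₁ = nineTaylor (ε ^ 2 * h ^ 2) 0
      + (ε ^ 2 * h ^ 2) ^ 4 * V (ε ^ 2 * h ^ 2) 0 := by
  have h2 : h ^ 2 ≠ 0 := pow_ne_zero 2 hh.ne'
  simp [nineWeights, mul_div_cancel₀ _ h2]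

theorem nineWeights_alpha_two (V : ℝ → Fin 3 → ℝ) (ε : ℝ) {h : ℝ} (hh : 0 < h) :
    h ^ 2 * (nineWeights V ε h).α₂ = nineTaylor (ε ^ 2 * h ^ 2) 1
      + (ε ^ 2 * h ^ 2) ^ 4 * V (ε ^ 2 * h ^ 2) 1 := by
  have h2 : h ^ 2 ≠ 0 := pow_ne_zero 2 hh.ne'
  simp [nineWeights, mul_div_cancel₀ _ h2]

theorem nineWeights_beta_one (V : ℝ → Fin 3 → ℝ) (ε h : ℝ) :
    (nineWeights V ε h).β₁ = nineTaylor (ε ^ 2 * h ^ 2) 2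
      + (ε ^ 2 * h ^ 2) ^ 4 * V (ε ^ 2 * h ^ 2) 2 := rfl

/-- The remainder is s⁴ V = ε⁸h⁸ V, divided by h² for the α's. The factor 8 = 4 + 4 comes from α₀ =
-4α₁ - 4α₂ and is generous for the other weights. -/
theorem nineWeights_expansion (V : ℝ → Fin 3 → ℝ) {C ε h : ℝ} (hh : 0 < h)
    (hV : ∀ i, |V (ε ^ 2 * h ^ 2) i| ≤ C) :
    |(nineWeights V ε h).α₀ - (-5 / h ^ 2 - 19 / 24 * ε ^ 2 + 4069 / 1440 * ε ^ 4 * h ^ 2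
        + 9791 / 8640 * ε ^ 6 * h ^ 4)| ≤ 8 * C * (ε ^ 8 * h ^ 6) ∧
    |(nineWeights V ε h).α₁ - (1 / h ^ 2 - 13 / 24 * ε ^ 2 - 2273 / 1440 * ε ^ 4 * h ^ 2
        - 4459 / 8640 * ε ^ 6 * h ^ 4)| ≤ 8 * C * (ε ^ 8 * h ^ 6) ∧
    |(nineWeights V ε h).α₂ - (1 / (4 * h ^ 2) + 71 / 96 * ε ^ 2 + 5023 / 5760 * ε ^ 4 * h ^ 2
        + 1609 / 6912 * ε ^ 6 * h ^ 4)| ≤ 8 * C * (ε ^ 8 * h ^ 6) ∧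
    |(nineWeights V ε h).β₁ - (-1 / 8 - 15 / 64 * ε ^ 2 * h ^ 2 - 213 / 1280 * ε ^ 4 * h ^ 4
        + 373 / 7680 * ε ^ 6 * h ^ 6)| ≤ 8 * C * (ε ^ 8 * h ^ 8) := by
  obtain ⟨h0, h0'⟩ := abs_le.1 (hV 0)
  obtain ⟨h1, h1'⟩ := abs_le.1 (hV 1)
  obtain ⟨h2, h2'⟩ := abs_le.1 (hV 2)
  have hC : 0 ≤ C := (abs_nonneg _).trans (hV 0)
  have bound : ∀ {x y t : ℝ}, 0 ≤ t → x = y * t → |y| ≤ 8 * C → |x| ≤ 8 * C * t := by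
    intro x y t ht hx hy
    rw [hx, abs_mul, abs_of_nonneg ht]
    exact mul_le_mul_of_nonneg_right hy ht
  have p6 : 0 ≤ ε ^ 8 * h ^ 6 := by positivity
  have p8 : 0 ≤ ε ^ 8 * h ^ 8 := by positivity
  refine ⟨bound p6 (y := -4 * V (ε ^ 2 * h ^ 2) 0 - 4 * V (ε ^ 2 * h ^ 2) 1) ?_ ?_,
    bound p6 (y := V (ε ^ 2 * h ^ 2) 0) ?_ ?_, bound p6 (y := V (ε ^ 2 * h ^ 2) 1) ?_ ?_,
    bound p8 (y := V (ε ^ 2 * h ^ 2) 2) ?_ ?_⟩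
  · simp [nineWeights, nineTaylor]
    field_simp
    ring
  · rw [abs_le]
    constructor <;> linarith
  · simp [nineWeights, nineTaylor]
    field_simp
    ring
  · rw [abs_le]
    constructor <;> linarith
  · simp [nineWeights, nineTaylor]
    field_simp
    ring
  · rw [abs_le]
    constructor <;> linarith
  · simp [nineWeights, nineTaylor]
    ring
  · rw [abs_le]
    constructor <;> linarith

/-- After expansion, derivatives of order 2m carry terms h^(2m-2) s^j = h^(2m-2+2j) ε^(2j). Those
below h⁴ cancel and those in h⁴ are the principal part. In the remainder the lowest j is 4 - m, at
most 3, and any further powers of s are bounded because εh < δ ≤ 1. C⁸ regularity gives remainders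
h⁸ for u, divided by h² in the α's, and h⁶ for Δu. -/
theorem nine_lte_bound {V : ℝ → Fin 3 → ℝ} {δ s₀ C : ℝ} (h1 : δ ≤ 1) (h2 : δ ≤ s₀)
    (hV : ∀ s, 0 < s → s < s₀ → ∀ i, |V s i| ≤ C) (x : Plane) (u : Plane → ℝ)
    (hu : ContDiffAt ℝ 8 u x) :
    ∃ P : Polynomial ℝ, P.natDegree ≤ 3 ∧ ∃ h₀ : ℝ, 0 < h₀ ∧
      ∀ ε h : ℝ, 0 < ε → 0 < h → h < h₀ → ε * h < δ →
        |(nineWeights V ε h).lte h x u - h ^ 4 / 480 *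
          (-240 * ε ^ 4 * (mixed 2 0 u x + mixed 0 2 u x)
            - 75 * ε ^ 2 * (mixed 4 0 u x + mixed 0 4 u x)
            - 3 * (mixed 6 0 u x + mixed 0 6 u x)
            + 5 * (mixed 2 4 u x + mixed 4 2 u x)
            + 130 * ε ^ 2 * mixed 2 2 u x)| ≤ h ^ 6 * P.eval (ε ^ 2) := by
  have hu8 : ContDiffAt ℝ (7 + 1 : ℕ) u x := by exact_mod_cast hu
  have hl6 : ContDiffAt ℝ (5 + 1 : ℕ) (lap u) x := contDiffAt_lap hu8
  obtain ⟨ρE, CE, hE⟩ := taylor_sum_nodes hu8 edges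
  obtain ⟨ρK, CK, hK⟩ := taylor_sum_nodes hu8 corners
  obtain ⟨ρL, CL, hL⟩ := taylor_sum_nodes hl6 edges
  obtain ⟨h₀, hh₀, hall⟩ := exists_forall_of_eventually_nhdsGT (hE.and (hK.and hL))
  have bs : BoundedOn (paramSet δ h₀) fun i => i.1 ^ 2 * i.2 ^ 2 := boundedOn_sq_mul_sq h1
  have bV : ∀ k, BoundedOn (paramSet δ h₀) fun i => V (i.1 ^ 2 * i.2 ^ 2) k := fun k =>
    boundedOn_of_sq_mul_sq (f := fun s => V s k) h1 h2 fun s a b => hV s a b k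
  have b0 := bV 0
  have b1 := bV 1
  have b2 := bV 2
  have bE : BoundedOn (paramSet δ h₀) fun i => ρE i.2 :=
    boundedOn_snd fun h a b => (hall h a b).1.1
  have bK : BoundedOn (paramSet δ h₀) fun i => ρK i.2 :=
    boundedOn_snd fun h a b => (hall h a b).2.1.1
  have bL : BoundedOn (paramSet δ h₀) fun i => ρL i.2 :=
    boundedOn_snd fun h a b => (hall h a b).2.2.1
  -- `Z3` to `Z0` are the coefficients of (ε²)³, ..., 1 once h⁶ is factored out. For k = 3, 2, 1 the
  -- k-th collects the derivatives of order 8 - 2k, with the surplus powers of s kept inside as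
  -- bounded factors.
  let Z3 : ℝ × ℝ → ℝ := fun i => (mixed 2 0 u x + mixed 0 2 u x) *
      (23 / 160 + (i.1 ^ 2 * i.2 ^ 2) * (V (i.1 ^ 2 * i.2 ^ 2) 0
        + 2 * V (i.1 ^ 2 * i.2 ^ 2) 1 + 4 * V (i.1 ^ 2 * i.2 ^ 2) 2))
  have B3 : BoundedOn (paramSet δ h₀) Z3 := by
    simp only [Z3]
    repeat' first | assumption | exact BoundedOn.const _ | apply BoundedOn.add | apply BoundedOn.mul
  let Z2 : ℝ × ℝ → ℝ := fun i => (mixed 4 0 u x + mixed 0 4 u x) *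
      (-293 / 1920 + 511 / 11520 * (i.1 ^ 2 * i.2 ^ 2) + (i.1 ^ 2 * i.2 ^ 2) ^ 2 *
        (1 / 12 * V (i.1 ^ 2 * i.2 ^ 2) 0 + 1 / 6 * V (i.1 ^ 2 * i.2 ^ 2) 1
          + V (i.1 ^ 2 * i.2 ^ 2) 2)) + mixed 2 2 u x *
      (1553 / 2880 + 5701 / 17280 * (i.1 ^ 2 * i.2 ^ 2) + (i.1 ^ 2 * i.2 ^ 2) ^ 2 *
        (V (i.1 ^ 2 * i.2 ^ 2) 1 + 2 * V (i.1 ^ 2 * i.2 ^ 2) 2))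
  have B2 : BoundedOn (paramSet δ h₀) Z2 := by
    simp only [Z2]
    repeat' first | assumption | exact BoundedOn.const _ | apply BoundedOn.add |
      apply BoundedOn.pow | apply BoundedOn.mul
  let Z1 : ℝ × ℝ → ℝ := fun i => (mixed 6 0 u x + mixed 0 6 u x) *
      (-13 / 768 + -3089 / 230400 * (i.1 ^ 2 * i.2 ^ 2)
        + 5401 / 1382400 * (i.1 ^ 2 * i.2 ^ 2) ^ 2 + (i.1 ^ 2 * i.2 ^ 2) ^ 3 *
        (1 / 360 * V (i.1 ^ 2 * i.2 ^ 2) 0 + 1 / 180 * V (i.1 ^ 2 * i.2 ^ 2) 1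
          + 1 / 12 * V (i.1 ^ 2 * i.2 ^ 2) 2)) + (mixed 2 4 u x + mixed 4 2 u x) *
      (97 / 2304 + 8129 / 138240 * (i.1 ^ 2 * i.2 ^ 2)
        + 19447 / 829440 * (i.1 ^ 2 * i.2 ^ 2) ^ 2 + (i.1 ^ 2 * i.2 ^ 2) ^ 3 *
        (1 / 12 * V (i.1 ^ 2 * i.2 ^ 2) 1 + 1 / 12 * V (i.1 ^ 2 * i.2 ^ 2) 2))
  have B1 : BoundedOn (paramSet δ h₀) Z1 := by
    simp only [Z1]
    repeat' first | assumption | exact BoundedOn.const _ | apply BoundedOn.add |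
      apply BoundedOn.pow | apply BoundedOn.mul
  -- No derivatives remain at this level, only the scaled weights times the Taylor remainders at the
  -- nodes.
  let Z0 : ℝ × ℝ → ℝ := fun i =>
      (1 + -13 / 24 * (i.1 ^ 2 * i.2 ^ 2) + -2273 / 1440 * (i.1 ^ 2 * i.2 ^ 2) ^ 2
        + -4459 / 8640 * (i.1 ^ 2 * i.2 ^ 2) ^ 3
        + (i.1 ^ 2 * i.2 ^ 2) ^ 4 * V (i.1 ^ 2 * i.2 ^ 2) 0) * ρE i.2
      + (1 / 4 + 71 / 96 * (i.1 ^ 2 * i.2 ^ 2) + 5023 / 5760 * (i.1 ^ 2 * i.2 ^ 2) ^ 2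
        + 1609 / 6912 * (i.1 ^ 2 * i.2 ^ 2) ^ 3
        + (i.1 ^ 2 * i.2 ^ 2) ^ 4 * V (i.1 ^ 2 * i.2 ^ 2) 1) * ρK i.2
      + (-1 / 8 + -15 / 64 * (i.1 ^ 2 * i.2 ^ 2) + -213 / 1280 * (i.1 ^ 2 * i.2 ^ 2) ^ 2
        + 373 / 7680 * (i.1 ^ 2 * i.2 ^ 2) ^ 3
        + (i.1 ^ 2 * i.2 ^ 2) ^ 4 * V (i.1 ^ 2 * i.2 ^ 2) 2) * ρL i.2
  have B0 : BoundedOn (paramSet δ h₀) Z0 := by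
    simp only [Z0]
    repeat' first | assumption | exact BoundedOn.const _ | apply BoundedOn.add |
      apply BoundedOn.pow | apply BoundedOn.mul
  obtain ⟨D3, hD3⟩ := B3
  obtain ⟨D2, hD2⟩ := B2
  obtain ⟨D1, hD1⟩ := B1
  obtain ⟨D0, hD0⟩ := B0
  refine ⟨Polynomial.C D3 * Polynomial.X ^ 3 + Polynomial.C D2 * Polynomial.X ^ 2
    + Polynomial.C D1 * Polynomial.X + Polynomial.C D0, Polynomial.natDegree_cubic_le, h₀, hh₀,
    fun ε h hε hh hlt hδ => ?_⟩
  have hmem : (ε, h) ∈ paramSet δ h₀ := ⟨hε, hh, hlt, hδ⟩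
  replace hD3 := hD3 _ hmem
  replace hD2 := hD2 _ hmem
  replace hD1 := hD1 _ hmem
  replace hD0 := hD0 _ hmem
  obtain ⟨⟨_, eE⟩, ⟨_, eK⟩, ⟨_, eL⟩⟩ := hall h hh hlt
  rw [sum_edges_dirTaylor_eight] at eE
  rw [sum_corners_dirTaylor_eight] at eK
  rw [sum_edges_dirTaylor_six] at eL
  have hm : ∀ i j, i + j + 2 ≤ 8 →
      mixed i j (lap u) x = mixed (i + 2) j u x + mixed i (j + 2) u x := fun i j hij =>
    mixed_lap (hu.of_le (by exact_mod_cast hij))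
  rw [hm 0 0 (by norm_num), hm 2 0 (by norm_num), hm 0 2 (by norm_num), hm 4 0 (by norm_num),
    hm 0 4 (by norm_num)] at eL
  have elap := lap_apply (hu.of_le (by norm_num))
  have a0 : (nineWeights V ε h).α₀ = -4 * (nineWeights V ε h).α₁ - 4 * (nineWeights V ε h).α₂ := rfl
  have a1 := nineWeights_alpha_one V ε hh
  have a2 := nineWeights_alpha_two V ε hh
  have a3 := nineWeights_beta_one V ε h
  simp only [nineTaylor, Matrix.cons_val] at a1 a2 a3
  have eu : mixed 0 0 u x = u x := rfl
  rw [eu] at eE eK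
  simp only [Nat.reduceAdd] at eE eK eL
  have key : (nineWeights V ε h).lte h x u - h ^ 4 / 480 *
      (-240 * ε ^ 4 * (mixed 2 0 u x + mixed 0 2 u x)
        - 75 * ε ^ 2 * (mixed 4 0 u x + mixed 0 4 u x)
        - 3 * (mixed 6 0 u x + mixed 0 6 u x)
        + 5 * (mixed 2 4 u x + mixed 4 2 u x)
        + 130 * ε ^ 2 * mixed 2 2 u x) = h ^ 6 * (Z3 (ε, h) * (ε ^ 2) ^ 3
          + Z2 (ε, h) * (ε ^ 2) ^ 2 + Z1 (ε, h) * ε ^ 2 + Z0 (ε, h)) := by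
    rw [Weights4.lte, Weights4.apply, eE, eK, eL, elap, a0]
    simp only [Z0, Z1, Z2, Z3]
    -- The terms in u(x) cancel through α₀, so every remaining term with α₁ or α₂ contains h². The
    -- multipliers are the Taylor sums without u(x), divided by h² in the case of the α's, and a1,
    -- a2, a3 replace the scaled weights by their expansions.
    linear_combination
      (mixed 2 0 u x + mixed 0 2 u x + h ^ 2 / 12 * (mixed 4 0 u x + mixed 0 4 u x)
        + h ^ 4 / 360 * (mixed 6 0 u x + mixed 0 6 u x) + h ^ 6 * ρE h) * a1
      + (2 * (mixed 2 0 u x + mixed 0 2 u x)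
        + h ^ 2 / 6 * (mixed 4 0 u x + 6 * mixed 2 2 u x + mixed 0 4 u x)
        + h ^ 4 / 180 * (mixed 6 0 u x + 15 * mixed 4 2 u x + 15 * mixed 2 4 u x + mixed 0 6 u x)
        + h ^ 6 * ρK h) * a2
      + (4 * (mixed 2 0 u x + mixed 0 2 u x)
        + h ^ 2 * (mixed 4 0 u x + mixed 2 2 u x + (mixed 2 2 u x + mixed 0 4 u x))
        + h ^ 4 / 12 * (mixed 6 0 u x + mixed 4 2 u x + (mixed 2 4 u x + mixed 0 6 u x))
        + h ^ 6 * ρL h) * a3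
  rw [key, abs_mul, abs_of_pos (pow_pos hh 6)]
  refine mul_le_mul_of_nonneg_left ?_ (pow_pos hh 6).le
  have hq : 0 ≤ ε ^ 2 := sq_nonneg ε
  refine (abs_cubic_le hq hD0 hD1 hD2 hD3).trans (le_of_eq ?_)
  simp

/-! ### The thirteen-point formula -/

theorem abs_quartic_le {q z₀ z₁ z₂ z₃ z₄ D₀ D₁ D₂ D₃ D₄ : ℝ} (hq : 0 ≤ q) (h0 : |z₀| ≤ D₀)
    (h1 : |z₁| ≤ D₁) (h2 : |z₂| ≤ D₂) (h3 : |z₃| ≤ D₃) (h4 : |z₄| ≤ D₄) :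
    |z₄ * q ^ 4 + (z₃ * q ^ 3 + z₂ * q ^ 2 + z₁ * q + z₀)| ≤
      D₄ * q ^ 4 + (D₃ * q ^ 3 + D₂ * q ^ 2 + D₁ * q + D₀) := by
  refine (abs_add_le _ _).trans (add_le_add ?_ (abs_cubic_le hq h0 h1 h2 h3))
  rw [abs_mul, abs_of_nonneg (pow_nonneg hq 4)]
  exact mul_le_mul_of_nonneg_right h4 (pow_nonneg hq 4)

/-- The weights of the thirteen-point formula with scaled remainders `V`. -/
def thirteenWeights (V : ℝ → Fin 4 → ℝ) (ε h : ℝ) : Weights6 :=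
  let a := thirteenTaylor (ε ^ 2 * h ^ 2) + (ε ^ 2 * h ^ 2) ^ 4 • V (ε ^ 2 * h ^ 2)
  ⟨-8 * (a 0 / h ^ 2) - 4 * (a 1 / h ^ 2), a 0 / h ^ 2, a 1 / h ^ 2, a 2, a 3⟩

theorem isGaussian_iff_eq_thirteenWeights {V : ℝ → Fin 4 → ℝ} {ε h : ℝ} (hε : 0 < ε) (hh : 0 < h)
    (hV : ∀ v, (thirteenMatrix (ε ^ 2 * h ^ 2)).mulVec v = thirteenRhs (ε ^ 2 * h ^ 2) ↔
      v = thirteenTaylor (ε ^ 2 * h ^ 2) + (ε ^ 2 * h ^ 2) ^ 4 • V (ε ^ 2 * h ^ 2))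
    (x : Plane) (v : Weights6) : v.IsGaussian ε h x ↔ v = thirteenWeights V ε h := by
  rw [Weights6.isGaussian_iff hε.ne' hh.ne', hV]
  have h2 : h ^ 2 ≠ 0 := pow_ne_zero 2 hh.ne'
  constructor
  · rintro ⟨h0, h1⟩
    have e0 := congrFun h1 0
    have e1 := congrFun h1 1
    have e2 := congrFun h1 2
    have e3 := congrFun h1 3
    simp only [Matrix.cons_val] at e0 e1 e2 e3
    ext <;> simp only [thirteenWeights, ← e0, ← e1, ← e2, ← e3, mul_div_cancel_left₀ _ h2, h0]
  · rintro rfl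
    refine ⟨rfl, ?_⟩
    ext i
    fin_cases i <;> simp only [thirteenWeights] <;> simp [mul_div_cancel₀ _ h2]

theorem thirteenWeights_alpha_one (V : ℝ → Fin 4 → ℝ) (ε : ℝ) {h : ℝ} (hh : 0 < h) :
    h ^ 2 * (thirteenWeights V ε h).α₁ = thirteenTaylor (ε ^ 2 * h ^ 2) 0
      + (ε ^ 2 * h ^ 2) ^ 4 * V (ε ^ 2 * h ^ 2) 0 := by
  have h2 : h ^ 2 ≠ 0 := pow_ne_zero 2 hh.ne'
  simp [thirteenWeights, mul_div_cancel₀ _ h2]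

theorem thirteenWeights_alpha_two (V : ℝ → Fin 4 → ℝ) (ε : ℝ) {h : ℝ} (hh : 0 < h) :
    h ^ 2 * (thirteenWeights V ε h).α₂ = thirteenTaylor (ε ^ 2 * h ^ 2) 1
      + (ε ^ 2 * h ^ 2) ^ 4 * V (ε ^ 2 * h ^ 2) 1 := by
  have h2 : h ^ 2 ≠ 0 := pow_ne_zero 2 hh.ne'
  simp [thirteenWeights, mul_div_cancel₀ _ h2]

theorem thirteenWeights_beta_one (V : ℝ → Fin 4 → ℝ) (ε h : ℝ) :
    (thirteenWeights V ε h).β₁ = thirteenTaylor (ε ^ 2 * h ^ 2) 2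
      + (ε ^ 2 * h ^ 2) ^ 4 * V (ε ^ 2 * h ^ 2) 2 := rfl

theorem thirteenWeights_beta_two (V : ℝ → Fin 4 → ℝ) (ε h : ℝ) :
    (thirteenWeights V ε h).β₂ = thirteenTaylor (ε ^ 2 * h ^ 2) 3
      + (ε ^ 2 * h ^ 2) ^ 4 * V (ε ^ 2 * h ^ 2) 3 := rfl

/-- The factor 12 = 8 + 4 comes from α₀ = -8α₁ - 4α₂. -/
theorem thirteenWeights_expansion (V : ℝ → Fin 4 → ℝ) {C ε h : ℝ} (hh : 0 < h)
    (hV : ∀ i, |V (ε ^ 2 * h ^ 2) i| ≤ C) :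
    |(thirteenWeights V ε h).α₀ - (-105 / (23 * h ^ 2) + 61761 / 83582 * ε ^ 2
        - 2668325501 / 1518684940 * ε ^ 4 * h ^ 2
        - 2725280260345847 / 289742306277900 * ε ^ 6 * h ^ 4)| ≤ 12 * C * (ε ^ 8 * h ^ 6) ∧
    |(thirteenWeights V ε h).α₁ - (12 / (23 * h ^ 2) - 17646 / 208955 * ε ^ 2
        + 3697010966 / 13288493225 * ε ^ 4 * h ^ 2
        + 1329393861667 / 724355765694750 * ε ^ 6 * h ^ 4)| ≤ 12 * C * (ε ^ 8 * h ^ 6) ∧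
    |(thirteenWeights V ε h).α₂ - (9 / (92 * h ^ 2) - 26469 / 1671640 * ε ^ 2
        - 24912958377 / 212615891600 * ε ^ 4 * h ^ 2
        + 4535043666647521 / 1931615375186000 * ε ^ 6 * h ^ 4)| ≤ 12 * C * (ε ^ 8 * h ^ 6) ∧
    |(thirteenWeights V ε h).β₁ - (-5 / 23 + 97053 / 835820 * ε ^ 2 * h ^ 2
        + 19096725789 / 106307945800 * ε ^ 4 * h ^ 4
        - 2108622124065179 / 724355765694750 * ε ^ 6 * h ^ 6)| ≤ 12 * C * (ε ^ 8 * h ^ 8) ∧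
    |(thirteenWeights V ε h).β₂ - (-1 / 46 - 61761 / 1671640 * ε ^ 2 * h ^ 2
        - 8234946399 / 30373698800 * ε ^ 4 * h ^ 4
        - 828029839457483 / 5794846125558000 * ε ^ 6 * h ^ 6)| ≤ 12 * C * (ε ^ 8 * h ^ 8) := by
  obtain ⟨h0, h0'⟩ := abs_le.1 (hV 0)
  obtain ⟨h1, h1'⟩ := abs_le.1 (hV 1)
  obtain ⟨h2, h2'⟩ := abs_le.1 (hV 2)
  obtain ⟨h3, h3'⟩ := abs_le.1 (hV 3)
  have hC : 0 ≤ C := (abs_nonneg _).trans (hV 0)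
  have bound : ∀ {x y t : ℝ}, 0 ≤ t → x = y * t → |y| ≤ 12 * C → |x| ≤ 12 * C * t := by
    intro x y t ht hx hy
    rw [hx, abs_mul, abs_of_nonneg ht]
    exact mul_le_mul_of_nonneg_right hy ht
  have p6 : 0 ≤ ε ^ 8 * h ^ 6 := by positivity
  have p8 : 0 ≤ ε ^ 8 * h ^ 8 := by positivity
  refine ⟨bound p6 (y := -8 * V (ε ^ 2 * h ^ 2) 0 - 4 * V (ε ^ 2 * h ^ 2) 1) ?_ ?_,
    bound p6 (y := V (ε ^ 2 * h ^ 2) 0) ?_ ?_, bound p6 (y := V (ε ^ 2 * h ^ 2) 1) ?_ ?_,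
    bound p8 (y := V (ε ^ 2 * h ^ 2) 2) ?_ ?_, bound p8 (y := V (ε ^ 2 * h ^ 2) 3) ?_ ?_⟩
  · simp [thirteenWeights, thirteenTaylor]
    field_simp
    ring
  · rw [abs_le]
    constructor <;> linarith
  · simp [thirteenWeights, thirteenTaylor]
    field_simp
    ring
  · rw [abs_le]
    constructor <;> linarith
  · simp [thirteenWeights, thirteenTaylor]
    field_simp
    ring
  · rw [abs_le]
    constructor <;> linarith
  · simp [thirteenWeights, thirteenTaylor]
    ring
  · rw [abs_le]
    constructor <;> linarith
  · simp [thirteenWeights, thirteenTaylor]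
    ring
  · rw [abs_le]
    constructor <;> linarith

/-- The same count two orders higher: h^(2m-2) s^j belongs to the principal part when m + j = 4 and
to the remainder when m + j ≥ 5, so the degree in ε² is at most 4. -/
theorem thirteen_lte_bound {V : ℝ → Fin 4 → ℝ} {δ s₀ C : ℝ} (h1 : δ ≤ 1) (h2 : δ ≤ s₀)
    (hV : ∀ s, 0 < s → s < s₀ → ∀ i, |V s i| ≤ C) (x : Plane) (u : Plane → ℝ)
    (hu : ContDiffAt ℝ 10 u x) :
    ∃ P : Polynomial ℝ, P.natDegree ≤ 4 ∧ ∃ h₀ : ℝ, 0 < h₀ ∧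
      ∀ ε h : ℝ, 0 < ε → 0 < h → h < h₀ → ε * h < δ →
        |(thirteenWeights V ε h).lte h x u - h ^ 6 / 3052560 *
          (-8605128 * ε ^ 6 * (mixed 2 0 u x + mixed 0 2 u x)
            - 1371468 * ε ^ 4 * (mixed 4 0 u x + mixed 0 4 u x)
            + 1817 * (mixed 8 0 u x + mixed 0 8 u x)
            - 123522 * ε ^ 2 * (mixed 2 4 u x + mixed 4 2 u x)
            - 3318 * (mixed 2 6 u x + mixed 6 2 u x)
            - 1364496 * ε ^ 4 * mixed 2 2 u x)| ≤ h ^ 8 * P.eval (ε ^ 2) := by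
  have hu10 : ContDiffAt ℝ (9 + 1 : ℕ) u x := by exact_mod_cast hu
  have hl8 : ContDiffAt ℝ (7 + 1 : ℕ) (lap u) x := contDiffAt_lap hu10
  obtain ⟨ρE, CE, hE⟩ := taylor_sum_nodes hu10 edges
  obtain ⟨ρK, CK, hK⟩ := taylor_sum_nodes hu10 corners
  obtain ⟨ρD, CD, hD⟩ := taylor_sum_nodes hu10 far
  obtain ⟨ρL, CL, hL⟩ := taylor_sum_nodes hl8 edges
  obtain ⟨ρM, CM, hM⟩ := taylor_sum_nodes hl8 corners
  obtain ⟨h₀, hh₀, hall⟩ :=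
    exists_forall_of_eventually_nhdsGT (hE.and (hK.and (hD.and (hL.and hM))))
  have bs : BoundedOn (paramSet δ h₀) fun i => i.1 ^ 2 * i.2 ^ 2 := boundedOn_sq_mul_sq h1
  have bV : ∀ k, BoundedOn (paramSet δ h₀) fun i => V (i.1 ^ 2 * i.2 ^ 2) k := fun k =>
    boundedOn_of_sq_mul_sq (f := fun s => V s k) h1 h2 fun s a b => hV s a b k
  have b0 := bV 0
  have b1 := bV 1
  have b2 := bV 2
  have b3 := bV 3
  have bE : BoundedOn (paramSet δ h₀) fun i => ρE i.2 :=
    boundedOn_snd fun h a b => (hall h a b).1.1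
  have bK : BoundedOn (paramSet δ h₀) fun i => ρK i.2 :=
    boundedOn_snd fun h a b => (hall h a b).2.1.1
  have bD : BoundedOn (paramSet δ h₀) fun i => ρD i.2 :=
    boundedOn_snd fun h a b => (hall h a b).2.2.1.1
  have bL : BoundedOn (paramSet δ h₀) fun i => ρL i.2 :=
    boundedOn_snd fun h a b => (hall h a b).2.2.2.1.1
  have bM : BoundedOn (paramSet δ h₀) fun i => ρM i.2 :=
    boundedOn_snd fun h a b => (hall h a b).2.2.2.2.1
  -- On second derivatives the cubic Taylor parts are used up by the principal part, whose ε⁶ term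
  -- is their s³ coefficient; only the remainders V are left.
  let Z4 : ℝ × ℝ → ℝ := fun i => (mixed 2 0 u x + mixed 0 2 u x) *
      (3 * V (i.1 ^ 2 * i.2 ^ 2) 0 + 4 * V (i.1 ^ 2 * i.2 ^ 2) 1
        + 4 * V (i.1 ^ 2 * i.2 ^ 2) 2 + 4 * V (i.1 ^ 2 * i.2 ^ 2) 3)
  have B4 : BoundedOn (paramSet δ h₀) Z4 := by
    simp only [Z4]
    repeat' first | assumption | exact BoundedOn.const _ | apply BoundedOn.add | apply BoundedOn.mul
  let Z3 : ℝ × ℝ → ℝ := fun i => (mixed 4 0 u x + mixed 0 4 u x) *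
      (-457279339 / 6933126900 + (i.1 ^ 2 * i.2 ^ 2) *
        (1 / 4 * V (i.1 ^ 2 * i.2 ^ 2) 0 + 4 / 3 * V (i.1 ^ 2 * i.2 ^ 2) 1
          + V (i.1 ^ 2 * i.2 ^ 2) 2 + 2 * V (i.1 ^ 2 * i.2 ^ 2) 3)) + mixed 2 2 u x *
      (-44315089603 / 6933126900 + (i.1 ^ 2 * i.2 ^ 2) *
        (V (i.1 ^ 2 * i.2 ^ 2) 0 + 2 * V (i.1 ^ 2 * i.2 ^ 2) 2 + 4 * V (i.1 ^ 2 * i.2 ^ 2) 3))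
  have B3 : BoundedOn (paramSet δ h₀) Z3 := by
    simp only [Z3]
    repeat' first | assumption | exact BoundedOn.const _ | apply BoundedOn.add | apply BoundedOn.mul
  let Z2 : ℝ × ℝ → ℝ := fun i => (mixed 6 0 u x + mixed 0 6 u x) *
      (-2125 / 43608 + 25125759877 / 166395045600 * (i.1 ^ 2 * i.2 ^ 2)
        + (i.1 ^ 2 * i.2 ^ 2) ^ 2 *
        (1 / 120 * V (i.1 ^ 2 * i.2 ^ 2) 0 + 8 / 45 * V (i.1 ^ 2 * i.2 ^ 2) 1
          + 1 / 12 * V (i.1 ^ 2 * i.2 ^ 2) 2 + 1 / 6 * V (i.1 ^ 2 * i.2 ^ 2) 3))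
      + (mixed 2 4 u x + mixed 4 2 u x) *
      (-7713903479 / 27732507600 + -206164924594441 / 503899663092000 * (i.1 ^ 2 * i.2 ^ 2)
        + (i.1 ^ 2 * i.2 ^ 2) ^ 2 *
        (1 / 12 * V (i.1 ^ 2 * i.2 ^ 2) 0 + 1 / 12 * V (i.1 ^ 2 * i.2 ^ 2) 2
          + 7 / 6 * V (i.1 ^ 2 * i.2 ^ 2) 3))
  have B2 : BoundedOn (paramSet δ h₀) Z2 := by
    simp only [Z2]
    repeat' first | assumption | exact BoundedOn.const _ | apply BoundedOn.add |
      apply BoundedOn.pow | apply BoundedOn.mul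
  let Z1 : ℝ × ℝ → ℝ := fun i => (mixed 8 0 u x + mixed 0 8 u x) *
      (-2941 / 30525600 + -1587805783 / 647091844000 * (i.1 ^ 2 * i.2 ^ 2)
        + 1898713810432871 / 90701939356560000 * (i.1 ^ 2 * i.2 ^ 2) ^ 2
        + (i.1 ^ 2 * i.2 ^ 2) ^ 3 *
        (1 / 6720 * V (i.1 ^ 2 * i.2 ^ 2) 0 + 4 / 315 * V (i.1 ^ 2 * i.2 ^ 2) 1
          + 1 / 360 * V (i.1 ^ 2 * i.2 ^ 2) 2 + 1 / 180 * V (i.1 ^ 2 * i.2 ^ 2) 3))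
      + (mixed 2 6 u x + mixed 6 2 u x) *
      (-320569 / 100298400 + -873641183171 / 38270860488000 * (i.1 ^ 2 * i.2 ^ 2)
        + -451617674002787 / 21730672970842500 * (i.1 ^ 2 * i.2 ^ 2) ^ 2
        + (i.1 ^ 2 * i.2 ^ 2) ^ 3 *
        (1 / 360 * V (i.1 ^ 2 * i.2 ^ 2) 0 + 1 / 360 * V (i.1 ^ 2 * i.2 ^ 2) 2
          + 4 / 45 * V (i.1 ^ 2 * i.2 ^ 2) 3))
      + mixed 4 4 u x *
      (-2941 / 436080 + -7197384889 / 166395045600 * (i.1 ^ 2 * i.2 ^ 2)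
        + -53973046185017 / 2267548483914000 * (i.1 ^ 2 * i.2 ^ 2) ^ 2
        + (i.1 ^ 2 * i.2 ^ 2) ^ 3 *
        (1 / 144 * V (i.1 ^ 2 * i.2 ^ 2) 0 + 1 / 6 * V (i.1 ^ 2 * i.2 ^ 2) 3))
  have B1 : BoundedOn (paramSet δ h₀) Z1 := by
    simp only [Z1]
    repeat' first | assumption | exact BoundedOn.const _ | apply BoundedOn.add |
      apply BoundedOn.pow | apply BoundedOn.mul
  let Z0 : ℝ × ℝ → ℝ := fun i =>
      (12 / 23 + -17646 / 208955 * (i.1 ^ 2 * i.2 ^ 2)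
        + 3697010966 / 13288493225 * (i.1 ^ 2 * i.2 ^ 2) ^ 2
        + 1329393861667 / 724355765694750 * (i.1 ^ 2 * i.2 ^ 2) ^ 3
        + (i.1 ^ 2 * i.2 ^ 2) ^ 4 * V (i.1 ^ 2 * i.2 ^ 2) 0) * (ρE i.2 + ρK i.2)
      + (9 / 92 + -26469 / 1671640 * (i.1 ^ 2 * i.2 ^ 2)
        + -24912958377 / 212615891600 * (i.1 ^ 2 * i.2 ^ 2) ^ 2
        + 4535043666647521 / 1931615375186000 * (i.1 ^ 2 * i.2 ^ 2) ^ 3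
        + (i.1 ^ 2 * i.2 ^ 2) ^ 4 * V (i.1 ^ 2 * i.2 ^ 2) 1) * ρD i.2
      + (-5 / 23 + 97053 / 835820 * (i.1 ^ 2 * i.2 ^ 2)
        + 19096725789 / 106307945800 * (i.1 ^ 2 * i.2 ^ 2) ^ 2
        + -2108622124065179 / 724355765694750 * (i.1 ^ 2 * i.2 ^ 2) ^ 3
        + (i.1 ^ 2 * i.2 ^ 2) ^ 4 * V (i.1 ^ 2 * i.2 ^ 2) 2) * ρL i.2
      + (-1 / 46 + -61761 / 1671640 * (i.1 ^ 2 * i.2 ^ 2)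
        + -8234946399 / 30373698800 * (i.1 ^ 2 * i.2 ^ 2) ^ 2
        + -828029839457483 / 5794846125558000 * (i.1 ^ 2 * i.2 ^ 2) ^ 3
        + (i.1 ^ 2 * i.2 ^ 2) ^ 4 * V (i.1 ^ 2 * i.2 ^ 2) 3) * ρM i.2
  have B0 : BoundedOn (paramSet δ h₀) Z0 := by
    simp only [Z0]
    repeat' first | assumption | exact BoundedOn.const _ | apply BoundedOn.add |
      apply BoundedOn.pow | apply BoundedOn.mul
  obtain ⟨D4, hD4⟩ := B4
  obtain ⟨D3, hD3⟩ := B3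
  obtain ⟨D2, hD2⟩ := B2
  obtain ⟨D1, hD1⟩ := B1
  obtain ⟨D0, hD0⟩ := B0
  refine ⟨Polynomial.C D4 * Polynomial.X ^ 4 + (Polynomial.C D3 * Polynomial.X ^ 3
    + Polynomial.C D2 * Polynomial.X ^ 2 + Polynomial.C D1 * Polynomial.X + Polynomial.C D0),
    by compute_degree, h₀, hh₀, fun ε h hε hh hlt hδ => ?_⟩
  have hmem : (ε, h) ∈ paramSet δ h₀ := ⟨hε, hh, hlt, hδ⟩
  replace hD4 := hD4 _ hmem
  replace hD3 := hD3 _ hmem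
  replace hD2 := hD2 _ hmem
  replace hD1 := hD1 _ hmem
  replace hD0 := hD0 _ hmem
  obtain ⟨⟨_, eE⟩, ⟨_, eK⟩, ⟨_, eD⟩, ⟨_, eL⟩, ⟨_, eM⟩⟩ := hall h hh hlt
  rw [sum_edges_dirTaylor_ten] at eE
  rw [sum_corners_dirTaylor_ten] at eK
  rw [sum_far_dirTaylor_ten] at eD
  rw [sum_edges_dirTaylor_eight] at eL
  rw [sum_corners_dirTaylor_eight] at eM
  have hm : ∀ i j, i + j + 2 ≤ 10 →
      mixed i j (lap u) x = mixed (i + 2) j u x + mixed i (j + 2) u x := fun i j hij =>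
    mixed_lap (hu.of_le (by exact_mod_cast hij))
  rw [hm 0 0 (by norm_num), hm 2 0 (by norm_num), hm 0 2 (by norm_num), hm 4 0 (by norm_num),
    hm 0 4 (by norm_num), hm 6 0 (by norm_num), hm 0 6 (by norm_num)] at eL
  rw [hm 0 0 (by norm_num), hm 2 0 (by norm_num), hm 0 2 (by norm_num), hm 4 0 (by norm_num),
    hm 2 2 (by norm_num), hm 0 4 (by norm_num), hm 6 0 (by norm_num), hm 4 2 (by norm_num),
    hm 2 4 (by norm_num), hm 0 6 (by norm_num)] at eM
  have elap := lap_apply (hu.of_le (by norm_num))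
  have a0 : (thirteenWeights V ε h).α₀ =
    -8 * (thirteenWeights V ε h).α₁ - 4 * (thirteenWeights V ε h).α₂ := rfl
  have a1 := thirteenWeights_alpha_one V ε hh
  have a2 := thirteenWeights_alpha_two V ε hh
  have a3 := thirteenWeights_beta_one V ε h
  have a4 := thirteenWeights_beta_two V ε h
  simp only [thirteenTaylor, Matrix.cons_val] at a1 a2 a3 a4
  have eu : mixed 0 0 u x = u x := rfl
  rw [eu] at eE eK eD
  simp only [Nat.reduceAdd] at eE eK eD eL eM
  have key : (thirteenWeights V ε h).lte h x u - h ^ 6 / 3052560 *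
      (-8605128 * ε ^ 6 * (mixed 2 0 u x + mixed 0 2 u x)
        - 1371468 * ε ^ 4 * (mixed 4 0 u x + mixed 0 4 u x)
        + 1817 * (mixed 8 0 u x + mixed 0 8 u x)
        - 123522 * ε ^ 2 * (mixed 2 4 u x + mixed 4 2 u x)
        - 3318 * (mixed 2 6 u x + mixed 6 2 u x)
        - 1364496 * ε ^ 4 * mixed 2 2 u x) = h ^ 8 * (Z4 (ε, h) * (ε ^ 2) ^ 4
          + (Z3 (ε, h) * (ε ^ 2) ^ 3 + Z2 (ε, h) * (ε ^ 2) ^ 2 + Z1 (ε, h) * ε ^ 2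
            + Z0 (ε, h))) := by
    rw [Weights6.lte, Weights6.apply, sum_edges_union_corners, eE, eK, eD, eL, eM, elap, a0]
    simp only [Z0, Z1, Z2, Z3, Z4]
    -- The multipliers are again the Taylor sums without u(x), with edges and corners merged in the
    -- first one because they share α₁.
    linear_combination
      (mixed 2 0 u x + mixed 0 2 u x + h ^ 2 / 12 * (mixed 4 0 u x + mixed 0 4 u x)
        + h ^ 4 / 360 * (mixed 6 0 u x + mixed 0 6 u x)
        + h ^ 6 / 20160 * (mixed 8 0 u x + mixed 0 8 u x) + h ^ 8 * ρE h
        + 2 * (mixed 2 0 u x + mixed 0 2 u x)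
        + h ^ 2 / 6 * (mixed 4 0 u x + 6 * mixed 2 2 u x + mixed 0 4 u x)
        + h ^ 4 / 180 * (mixed 6 0 u x + 15 * mixed 4 2 u x + 15 * mixed 2 4 u x + mixed 0 6 u x)
        + h ^ 6 / 10080 * (mixed 8 0 u x + 28 * mixed 6 2 u x + 70 * mixed 4 4 u x
          + 28 * mixed 2 6 u x + mixed 0 8 u x)
        + h ^ 8 * ρK h) * a1
      + (4 * (mixed 2 0 u x + mixed 0 2 u x) + 4 * h ^ 2 / 3 * (mixed 4 0 u x + mixed 0 4 u x)
        + 8 * h ^ 4 / 45 * (mixed 6 0 u x + mixed 0 6 u x)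
        + 4 * h ^ 6 / 315 * (mixed 8 0 u x + mixed 0 8 u x) + h ^ 8 * ρD h) * a2
      + (4 * (mixed 2 0 u x + mixed 0 2 u x)
        + h ^ 2 * (mixed 4 0 u x + mixed 2 2 u x + (mixed 2 2 u x + mixed 0 4 u x))
        + h ^ 4 / 12 * (mixed 6 0 u x + mixed 4 2 u x + (mixed 2 4 u x + mixed 0 6 u x))
        + h ^ 6 / 360 * (mixed 8 0 u x + mixed 6 2 u x + (mixed 2 6 u x + mixed 0 8 u x))
        + h ^ 8 * ρL h) * a3
      + (4 * (mixed 2 0 u x + mixed 0 2 u x)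
        + 2 * h ^ 2 * (mixed 4 0 u x + mixed 2 2 u x + (mixed 2 2 u x + mixed 0 4 u x))
        + h ^ 4 / 6 * (mixed 6 0 u x + mixed 4 2 u x + 6 * (mixed 4 2 u x + mixed 2 4 u x)
          + (mixed 2 4 u x + mixed 0 6 u x))
        + h ^ 6 / 180 * (mixed 8 0 u x + mixed 6 2 u x + 15 * (mixed 6 2 u x + mixed 4 4 u x)
          + 15 * (mixed 4 4 u x + mixed 2 6 u x) + (mixed 2 6 u x + mixed 0 8 u x))
        + h ^ 8 * ρM h) * a4
  rw [key, abs_mul, abs_of_pos (pow_pos hh 8)]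
  refine mul_le_mul_of_nonneg_left ?_ (pow_pos hh 8).le
  have hq : 0 ≤ ε ^ 2 := sq_nonneg ε
  refine (abs_quartic_le hq hD0 hD1 hD2 hD3 hD4).trans (le_of_eq ?_)
  simp

end RBFHFD

end

/-! ### The main theorem -/

theorem mainTheorem3 :
    -- the nine-point formula of order four
    (∃ δ : ℝ, 0 < δ ∧ ∃ w : ℝ → ℝ → RBFHFD.Weights4,
      -- the weights exist, are unique, and do not depend on the reference node
      (∀ ε h : ℝ, 0 < ε → 0 < h → ε * h < δ → ∀ (x₀ : RBFHFD.Plane) (v : RBFHFD.Weights4),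
        v.IsGaussian ε h x₀ ↔ v = w ε h) ∧
      -- expansions of the weights
      (∃ C : ℝ, ∀ ε h : ℝ, 0 < ε → 0 < h → ε * h < δ →
        |(w ε h).α₀ - (-5 / h ^ 2 - 19 / 24 * ε ^ 2 + 4069 / 1440 * ε ^ 4 * h ^ 2
            + 9791 / 8640 * ε ^ 6 * h ^ 4)| ≤ C * (ε ^ 8 * h ^ 6) ∧
        |(w ε h).α₁ - (1 / h ^ 2 - 13 / 24 * ε ^ 2 - 2273 / 1440 * ε ^ 4 * h ^ 2
            - 4459 / 8640 * ε ^ 6 * h ^ 4)| ≤ C * (ε ^ 8 * h ^ 6) ∧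
        |(w ε h).α₂ - (1 / (4 * h ^ 2) + 71 / 96 * ε ^ 2 + 5023 / 5760 * ε ^ 4 * h ^ 2
            + 1609 / 6912 * ε ^ 6 * h ^ 4)| ≤ C * (ε ^ 8 * h ^ 6) ∧
        |(w ε h).β₁ - (-1 / 8 - 15 / 64 * ε ^ 2 * h ^ 2 - 213 / 1280 * ε ^ 4 * h ^ 4
            + 373 / 7680 * ε ^ 6 * h ^ 6)| ≤ C * (ε ^ 8 * h ^ 8)) ∧
      -- flat limits of the weights
      (∀ h : ℝ, 0 < h →
        Tendsto (fun ε => (w ε h).α₀) (𝓝[>] 0) (𝓝 (-5 / h ^ 2)) ∧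
        Tendsto (fun ε => (w ε h).α₁) (𝓝[>] 0) (𝓝 (1 / h ^ 2)) ∧
        Tendsto (fun ε => (w ε h).α₂) (𝓝[>] 0) (𝓝 (1 / (4 * h ^ 2))) ∧
        Tendsto (fun ε => (w ε h).β₁) (𝓝[>] 0) (𝓝 (-1 / 8))) ∧
      -- local truncation error
      (∀ (x₀ : RBFHFD.Plane) (u : RBFHFD.Plane → ℝ), ContDiffAt ℝ 8 u x₀ →
        ∃ P : Polynomial ℝ, P.natDegree ≤ 3 ∧ ∃ h₀ : ℝ, 0 < h₀ ∧
          ∀ ε h : ℝ, 0 < ε → 0 < h → h < h₀ → ε * h < δ →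
            |(w ε h).lte h x₀ u - h ^ 4 / 480 *
              (-240 * ε ^ 4 * (RBFHFD.mixed 2 0 u x₀ + RBFHFD.mixed 0 2 u x₀)
                - 75 * ε ^ 2 * (RBFHFD.mixed 4 0 u x₀ + RBFHFD.mixed 0 4 u x₀)
                - 3 * (RBFHFD.mixed 6 0 u x₀ + RBFHFD.mixed 0 6 u x₀)
                + 5 * (RBFHFD.mixed 2 4 u x₀ + RBFHFD.mixed 4 2 u x₀)
                + 130 * ε ^ 2 * RBFHFD.mixed 2 2 u x₀)|
              ≤ h ^ 6 * P.eval (ε ^ 2))) ∧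
    -- the thirteen-point formula of order six
    (∃ δ : ℝ, 0 < δ ∧ ∃ w : ℝ → ℝ → RBFHFD.Weights6,
      -- the weights exist, are unique, and do not depend on the reference node
      (∀ ε h : ℝ, 0 < ε → 0 < h → ε * h < δ → ∀ (x₀ : RBFHFD.Plane) (v : RBFHFD.Weights6),
        v.IsGaussian ε h x₀ ↔ v = w ε h) ∧
      -- expansions of the weights
      (∃ C : ℝ, ∀ ε h : ℝ, 0 < ε → 0 < h → ε * h < δ →
        |(w ε h).α₀ - (-105 / (23 * h ^ 2) + 61761 / 83582 * ε ^ 2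
            - 2668325501 / 1518684940 * ε ^ 4 * h ^ 2
            - 2725280260345847 / 289742306277900 * ε ^ 6 * h ^ 4)| ≤ C * (ε ^ 8 * h ^ 6) ∧
        |(w ε h).α₁ - (12 / (23 * h ^ 2) - 17646 / 208955 * ε ^ 2
            + 3697010966 / 13288493225 * ε ^ 4 * h ^ 2
            + 1329393861667 / 724355765694750 * ε ^ 6 * h ^ 4)| ≤ C * (ε ^ 8 * h ^ 6) ∧
        |(w ε h).α₂ - (9 / (92 * h ^ 2) - 26469 / 1671640 * ε ^ 2
            - 24912958377 / 212615891600 * ε ^ 4 * h ^ 2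
            + 4535043666647521 / 1931615375186000 * ε ^ 6 * h ^ 4)| ≤ C * (ε ^ 8 * h ^ 6) ∧
        |(w ε h).β₁ - (-5 / 23 + 97053 / 835820 * ε ^ 2 * h ^ 2
            + 19096725789 / 106307945800 * ε ^ 4 * h ^ 4
            - 2108622124065179 / 724355765694750 * ε ^ 6 * h ^ 6)| ≤ C * (ε ^ 8 * h ^ 8) ∧
        |(w ε h).β₂ - (-1 / 46 - 61761 / 1671640 * ε ^ 2 * h ^ 2
            - 8234946399 / 30373698800 * ε ^ 4 * h ^ 4
            - 828029839457483 / 5794846125558000 * ε ^ 6 * h ^ 6)| ≤ C * (ε ^ 8 * h ^ 8)) ∧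
      -- flat limits of the weights
      (∀ h : ℝ, 0 < h →
        Tendsto (fun ε => (w ε h).α₀) (𝓝[>] 0) (𝓝 (-105 / (23 * h ^ 2))) ∧
        Tendsto (fun ε => (w ε h).α₁) (𝓝[>] 0) (𝓝 (12 / (23 * h ^ 2))) ∧
        Tendsto (fun ε => (w ε h).α₂) (𝓝[>] 0) (𝓝 (9 / (92 * h ^ 2))) ∧
        Tendsto (fun ε => (w ε h).β₁) (𝓝[>] 0) (𝓝 (-5 / 23)) ∧
        Tendsto (fun ε => (w ε h).β₂) (𝓝[>] 0) (𝓝 (-1 / 46))) ∧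
      -- local truncation error
      (∀ (x₀ : RBFHFD.Plane) (u : RBFHFD.Plane → ℝ), ContDiffAt ℝ 10 u x₀ →
        ∃ P : Polynomial ℝ, P.natDegree ≤ 4 ∧ ∃ h₀ : ℝ, 0 < h₀ ∧
          ∀ ε h : ℝ, 0 < ε → 0 < h → h < h₀ → ε * h < δ →
            |(w ε h).lte h x₀ u - h ^ 6 / 3052560 *
              (-8605128 * ε ^ 6 * (RBFHFD.mixed 2 0 u x₀ + RBFHFD.mixed 0 2 u x₀)
                - 1371468 * ε ^ 4 * (RBFHFD.mixed 4 0 u x₀ + RBFHFD.mixed 0 4 u x₀)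
                + 1817 * (RBFHFD.mixed 8 0 u x₀ + RBFHFD.mixed 0 8 u x₀)
                - 123522 * ε ^ 2 * (RBFHFD.mixed 2 4 u x₀ + RBFHFD.mixed 4 2 u x₀)
                - 3318 * (RBFHFD.mixed 2 6 u x₀ + RBFHFD.mixed 6 2 u x₀)
                - 1364496 * ε ^ 4 * RBFHFD.mixed 2 2 u x₀)|
              ≤ h ^ 8 * P.eval (ε ^ 2))) := by
  constructor
  · obtain ⟨s₀, hs₀, V, C, hV⟩ := RBFHFD.exists_nine_solution
    have h1 : min 1 s₀ ≤ 1 := min_le_left _ _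
    have h2 : min 1 s₀ ≤ s₀ := min_le_right _ _
    have hδ : 0 < min 1 s₀ := lt_min one_pos hs₀
    have hsys : ∀ ε h : ℝ, 0 < ε → 0 < h → ε * h < min 1 s₀ → _ := fun ε h hε hh hlt =>
      hV (ε ^ 2 * h ^ 2) (by positivity) (RBFHFD.sq_mul_sq_lt hε hh h1 h2 hlt)
    refine ⟨min 1 s₀, hδ, RBFHFD.nineWeights V,
      fun ε h hε hh hlt x₀ v =>
        RBFHFD.isGaussian_iff_eq_nineWeights hε hh (hsys ε h hε hh hlt).2 x₀ v,
      ⟨8 * C, fun ε h hε hh hlt => RBFHFD.nineWeights_expansion V hh (hsys ε h hε hh hlt).1⟩,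
      fun h hh => ?_,
      fun x₀ u hu => RBFHFD.nine_lte_bound h1 h2 (fun s a b => (hV s a b).1) x₀ u hu⟩
    -- For fixed h the condition εh < δ reads ε < δ / h, so the uniform expansion is available for
    -- all small ε and yields the flat limits.
    have hex : ∀ ε, 0 < ε → ε < min 1 s₀ / h → _ := fun ε hε hlt =>
      RBFHFD.nineWeights_expansion (ε := ε) V hh
        (hsys ε h hε hh ((lt_div_iff₀ hh).1 hlt)).1
    have hd := div_pos hδ hh
    refine ⟨RBFHFD.tendsto_flat_limit (K := 8 * C * h ^ 6) hd ?_ ?_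
        fun ε a b => (hex ε a b).1.trans_eq (by ring),
      RBFHFD.tendsto_flat_limit (K := 8 * C * h ^ 6) hd ?_ ?_
        fun ε a b => (hex ε a b).2.1.trans_eq (by ring),
      RBFHFD.tendsto_flat_limit (K := 8 * C * h ^ 6) hd ?_ ?_
        fun ε a b => (hex ε a b).2.2.1.trans_eq (by ring),
      RBFHFD.tendsto_flat_limit (K := 8 * C * h ^ 8) hd ?_ ?_
        fun ε a b => (hex ε a b).2.2.2.trans_eq (by ring)⟩
    all_goals first | fun_prop | norm_num
  · obtain ⟨s₀, hs₀, V, C, hV⟩ := RBFHFD.exists_thirteen_solution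
    have h1 : min 1 s₀ ≤ 1 := min_le_left _ _
    have h2 : min 1 s₀ ≤ s₀ := min_le_right _ _
    have hδ : 0 < min 1 s₀ := lt_min one_pos hs₀
    have hsys : ∀ ε h : ℝ, 0 < ε → 0 < h → ε * h < min 1 s₀ → _ := fun ε h hε hh hlt =>
      hV (ε ^ 2 * h ^ 2) (by positivity) (RBFHFD.sq_mul_sq_lt hε hh h1 h2 hlt)
    refine ⟨min 1 s₀, hδ, RBFHFD.thirteenWeights V,
      fun ε h hε hh hlt x₀ v =>
        RBFHFD.isGaussian_iff_eq_thirteenWeights hε hh (hsys ε h hε hh hlt).2 x₀ v,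
      ⟨12 * C, fun ε h hε hh hlt =>
        RBFHFD.thirteenWeights_expansion V hh (hsys ε h hε hh hlt).1⟩,
      fun h hh => ?_,
      fun x₀ u hu => RBFHFD.thirteen_lte_bound h1 h2 (fun s a b => (hV s a b).1) x₀ u hu⟩
    have hex : ∀ ε, 0 < ε → ε < min 1 s₀ / h → _ := fun ε hε hlt =>
      RBFHFD.thirteenWeights_expansion (ε := ε) V hh
        (hsys ε h hε hh ((lt_div_iff₀ hh).1 hlt)).1
    have hd := div_pos hδ hh
    refine ⟨RBFHFD.tendsto_flat_limit (K := 12 * C * h ^ 6) hd ?_ ?_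
        fun ε a b => (hex ε a b).1.trans_eq (by ring),
      RBFHFD.tendsto_flat_limit (K := 12 * C * h ^ 6) hd ?_ ?_
        fun ε a b => (hex ε a b).2.1.trans_eq (by ring),
      RBFHFD.tendsto_flat_limit (K := 12 * C * h ^ 6) hd ?_ ?_
        fun ε a b => (hex ε a b).2.2.1.trans_eq (by ring),
      RBFHFD.tendsto_flat_limit (K := 12 * C * h ^ 8) hd ?_ ?_
        fun ε a b => (hex ε a b).2.2.2.1.trans_eq (by ring),
      RBFHFD.tendsto_flat_limit (K := 12 * C * h ^ 8) hd ?_ ?_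
        fun ε a b => (hex ε a b).2.2.2.2.trans_eq (by ring)⟩
    all_goals first | fun_prop | norm_num
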